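/- **Setting.** A *semi-labelled tree* is a finite tree $T=(V,E)$ with a set $W=[n]\subseteq V$ of *regular* nodes such that every node of degree at most $2$ is regular; the other nodes are called *latent*. Let $\Delta$ be the maximal degree of $T$. Let $Z=(Z_v)_{v\in V}$ be a Gaussian random vector whose law has a Lebesgue density that factorizes along $T$, i.e. is a product of nonnegative functions $\psi_{uv}(z_u,z_v)$, $uv\in E$ (and of functions of single coordinates, which are needed only if $|V|=1$), and suppose that $\mathrm{corr}(Z_u,Z_v)\neq 0$ for every edge $uv\in E$. Let $Y_v=f_v(Z_v)$ for strictly monotone (increasing or decreasing) functions $f_v:\mathbb R\to\mathbb R$, and let $X=(Y_i)_{i\in W}$ be the subvector of the regular nodes. With $X'$ an independent copy of $X$, let $$\kappa_{ij}=\mathbb P\{(X_i-X_i')(X_j-X_j')>0\}-\mathbb P\{(X_i-X_i')(X_j-X_j')<0\}$$ be the Kendall-$\tau$ coefficient, and put $d(i,j)=-\log|\sin(\tfrac{\pi}{2}\kappa_{ij})|$ for $i,j\in W$. **The algorithm** (input: $\Delta$ and the values $d(i,j)$). A *bag* $B$ is a finite set of nodes with a representative $\rho(B)\in B$. Keep a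 queue of bags, initially containing only $W$ with an arbitrary representative $u\in W$, and a set $S$ of edges (skeleton), initially empty. While the queue is non-empty, remove its first bag $B$. * If $|B|\le\Delta$, add to $S$ all edges of the semi-labelled tree with regular nodes $B$ and positive edge lengths whose path lengths between nodes of $B$ are the distances $d$ (its latent nodes get new names). * If $|B|>\Delta$, repeat the following with fresh independent samples until all resulting bags have at most $|B|/\sqrt\Delta$ nodes; then add the resulting edges to $S$ and append the resulting bags to the queue. Sample $u_1,\dots,u_\Delta$ uniformly without replacement from $B\setminus\{\rho(B)\}$. Start with the collection of bags $\{B\}$; for $i=1,\dots,\Delta$, let $B^*$ be the bag of the collection that contains $u_i$, and if $u_i\ne\rho(B^*)$, replace it by the bags output by $\textsc{basic}(B^*,u_i)$. Finally replace each bag by the output of $\textsc{explode}$. $\textsc{basic}(B,\alpha)$, with $\rho=\rho(B)$, groups the nodes $v\in B$ by the value of $d(v,\alpha)-d(v,\rho)$ into bags $B_1,\dots,B_k$, ordered by this value. Let $u_i\in B_i$ minimize $d(\cdot,\alpha)$. If $d(\rho,u_i)+d(u_i,\alpha)=d(\rho,\alpha)$, set $\rho(B_i)=u_i$; otherwise create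 a new latent node $w_i$, set $d(v,w_i)=\frac12(d(v,\alpha)+d(v,\rho)-d(\alpha,\rho))$ for $v\in B_i$, add $w_i$ to $B_i$, and set $\rho(B_i)=w_i$. The output is $B_1,\dots,B_k$ and the edges $\rho(B_i)\rho(B_{i+1})$, $1\le i<k$. $\textsc{explode}(B)$, with $\rho=\rho(B)$, repeatedly picks a remaining $u\in B\setminus\{\rho\}$ and outputs the bag consisting of $\rho$ and all remaining $v\ne\rho$ with $d(u,v)<d(u,\rho)+d(\rho,v)$, with representative $\rho$, until no node of $B\setminus\{\rho\}$ remains. **Proposition (non-paranormal distributions).** For every choice of the initial representative, the algorithm applied to $d$ halts with probability one, and whenever it halts, it returns $T$: the skeleton $S$ is the edge set of a tree that is isomorphic to $T$ by an isomorphism that fixes all regular nodes. -/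

import Mathlib

open MeasureTheory ProbabilityTheory Filter Topology
open scoped ENNReal NNReal

/-! ## Semi-labelled trees -/

/-- A semi-labelled tree on the vertex set `V` with regular nodes labelled by `Fin n`: a tree in
which every vertex that is not labelled (a latent vertex) has degree at least three. -/
structure SemiLabeledTree (V : Type*) [Fintype V] (n : ℕ) where
  graph : SimpleGraph V
  isTree : graph.IsTree
  label : Fin n ↪ V
  three_le_degree : ∀ v : V, v ∉ Set.range label → 3 ≤ (graph.neighborSet v).ncard

open Classical in
/-- The maximal degree of a semi-labelled tree. -/
noncomputable def SemiLabeledTree.maxDeg {V : Type*} [Fintype V] {n : ℕ}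
    (T : SemiLabeledTree V n) : ℕ :=
  T.graph.maxDegree

/-! ## Gaussian tree models and the Kendall `τ` coefficient -/

open Classical in
/-- The random vector `Z` is jointly Gaussian and its law has a density with respect to Lebesgue
measure that factorizes along the graph `G`: it is a product of nonnegative potentials, one for
each edge `uv` (a function of `z u` and `z v` only) and one for each vertex. The vertex potentials
can be absorbed into the edge potentials unless the tree is a single vertex. -/
structure IsGaussianGraphicalModel {V Ω : Type*} [Fintype V] [MeasurableSpace Ω]
    (G : SimpleGraph V) (P : Measure Ω) (Z : V → Ω → ℝ) : Prop where
  measurable : ∀ v, Measurable (Z v)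
  gaussian : HasGaussianLaw (fun ω => fun v => Z v ω) P
  factorizes : ∃ (φ : V → ℝ → ℝ≥0) (ψ : Sym2 V → (V → ℝ) → ℝ≥0),
    (∀ v, Measurable (φ v)) ∧ (∀ e, Measurable (ψ e)) ∧
    (∀ e, DependsOn (ψ e) {v | v ∈ e}) ∧
    P.map (fun ω => fun v => Z v ω) = (volume : Measure (V → ℝ)).withDensity
      (fun z => (((∏ v, φ v (z v)) * ∏ e ∈ G.edgeFinset, ψ e z : ℝ≥0) : ℝ≥0∞))

/-- The Kendall `τ` coefficient of the pair `(X, Y)`: the probability of concordance minus the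
probability of discordance of `(X, Y)` and an independent copy `(X', Y')`. -/
noncomputable def kendallTau {Ω : Type*} [MeasurableSpace Ω] (P : Measure Ω) (X Y : Ω → ℝ) : ℝ :=
  (P.prod P).real {p | 0 < (X p.1 - X p.2) * (Y p.1 - Y p.2)} -
    (P.prod P).real {p | (X p.1 - X p.2) * (Y p.1 - Y p.2) < 0}

/-- The distance `d(i,j) = -log |sin (π κ_ij / 2)|`. -/
noncomputable def kendallDist {Ω : Type*} [MeasurableSpace Ω] {n : ℕ} (P : Measure Ω)
    (X : Fin n → Ω → ℝ) (i j : Fin n) : ℝ :=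
  -Real.log |Real.sin (Real.pi / 2 * kendallTau P (X i) (X j))|

/-! ## The algorithm -/

namespace TreeRecovery

/-- The nodes handled by the algorithm: the regular nodes `1, …, n` and the names `0, 1, 2, …` that
are given to latent nodes when they are discovered. -/
abbrev Node (n : ℕ) : Type := Fin n ⊕ ℕ

/-- A skeleton: a finite set of edges. -/
abbrev Skeleton (n : ℕ) : Type := Finset (Sym2 (Node n))

/-- A bag: a finite set of nodes with a representative. -/
structure Bag (n : ℕ) where
  nodes : Finset (Node n)
  rep : Node n

/-- The distances currently known, and the first name not yet used for a latent node. -/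
structure Oracle (n : ℕ) where
  dist : Node n → Node n → ℝ
  next : ℕ

/-- At the beginning only the distances between regular nodes are known. -/
noncomputable def initOracle {n : ℕ} (d : Fin n → Fin n → ℝ) : Oracle n where
  dist := fun a b => match a, b with
    | Sum.inl i, Sum.inl j => d i j
    | _, _ => 0
  next := 0

/-- A minimizer of `g` over `s` (and `a` if `s` is empty). -/
noncomputable def argMin {n : ℕ} (s : Finset (Node n)) (g : Node n → ℝ) (a : Node n) : Node n :=
  open Classical in
  if h : s.Nonempty then (s.exists_min_image g h).choose else a

/-- The quantity `D(v) = d(v, α) - d(v, ρ(B))` of the procedure `basic`. -/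
noncomputable def Dval {n : ℕ} (o : Oracle n) (B : Bag n) (α v : Node n) : ℝ :=
  o.dist v α - o.dist v B.rep

/-- The oracle after the new latent node `w = inr o.next` has been inserted with
`d(v, w) = (d(v, α) + d(v, ρ) - d(α, ρ)) / 2` for all `v ∈ s`. -/
noncomputable def addLatent {n : ℕ} (o : Oracle n) (s : Finset (Node n)) (α ρ : Node n) : Oracle n where
  dist := fun a b =>
    let w : Node n := Sum.inr o.next
    let δ : Node n → ℝ := fun v => (o.dist v α + o.dist v ρ - o.dist α ρ) / 2
    if a = w ∧ b = w then 0
    else if a = w ∧ b ∈ s then δ b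
    else if b = w ∧ a ∈ s then δ a
    else o.dist a b
  next := o.next + 1

/-- One round of the second loop of `basic`: the bag of the nodes `v` with `D(v) = x` with its
representative, and the updated oracle. -/
noncomputable def basicPart {n : ℕ} (B : Bag n) (α : Node n) (x : ℝ) (o : Oracle n) :
    Bag n × Oracle n :=
  let s := B.nodes.filter (fun v => Dval o B α v = x)
  let u := argMin s (fun v => o.dist v α) α
  if o.dist B.rep u + o.dist u α = o.dist B.rep α then
    (⟨s, u⟩, o)
  else
    (⟨insert (Sum.inr o.next) s, Sum.inr o.next⟩, addLatent o s α B.rep)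

/-- The loop of `basic` over the values of `D`. -/
noncomputable def basicLoop {n : ℕ} (B : Bag n) (α : Node n) :
    List ℝ → Oracle n → List (Bag n) × Oracle n
  | [], o => ([], o)
  | x :: xs, o =>
    let r := basicPart B α x o
    let r' := basicLoop B α xs r.2
    (r.1 :: r'.1, r'.2)

/-- The edges between consecutive elements of a list. -/
def chainEdges {n : ℕ} : List (Node n) → Skeleton n
  | [] => ∅
  | [_] => ∅
  | a :: b :: l => insert s(a, b) (chainEdges (b :: l))

/-- The procedure `basic(B, α)`: the bags, the skeleton and the updated oracle. -/
noncomputable def basic {n : ℕ} (o : Oracle n) (B : Bag n) (α : Node n) :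
    List (Bag n) × Skeleton n × Oracle n :=
  let r := basicLoop B α ((B.nodes.image (Dval o B α)).sort (· ≤ ·)) o
  (r.1, chainEdges (r.1.map Bag.rep), r.2)

/-- The loop of `explode`, where `R` is the set of the nodes other than `ρ` that have not been put
into a bag yet. The first argument bounds the number of rounds; every round removes at least the
chosen node `u` from `R` as soon as `d(u, u) = 0 < d(u, ρ)`, so `|R|` rounds are enough. -/
noncomputable def explodeLoop {n : ℕ} (o : Oracle n) (ρ : Node n) :
    ℕ → Finset (Node n) → List (Bag n)
  | 0, _ => []
  | k + 1, R =>
    open Classical in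
    if h : R.Nonempty then
      let u := h.choose
      let s := R.filter (fun v => o.dist u v < o.dist u ρ + o.dist v ρ)
      ⟨insert ρ s, ρ⟩ :: explodeLoop o ρ k (R \ s)
    else []

/-- The procedure `explode(B)`. -/
noncomputable def explode {n : ℕ} (o : Oracle n) (B : Bag n) : List (Bag n) :=
  explodeLoop o B.rep (B.nodes.erase B.rep).card (B.nodes.erase B.rep)

/-- The variables of `bigsplit`: current collection of bags, skeleton and oracle. -/
structure SplitState (n : ℕ) where
  bags : List (Bag n)
  skel : Skeleton n
  oracle : Oracle n

/-- One round of the `for` loop of `bigsplit`: the bag that contains `u` is replaced by the bags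
produced by `basic`, unless `u` is its representative. -/
noncomputable def splitAt {n : ℕ} (st : SplitState n) (u : Node n) : SplitState n :=
  open Classical in
  match st.bags.find? (fun B => decide (u ∈ B.nodes)) with
  | none => st
  | some B =>
    if u = B.rep then st
    else
      let r := basic st.oracle B u
      ⟨st.bags.erase B ++ r.1, st.skel ∪ r.2.1, r.2.2⟩

/-- One pass of `bigsplit(B, u₁, …, u_k)`: the `for` loop over `u₁, …, u_k`, after which every bag
is exploded. -/
noncomputable def bigsplitPass {n : ℕ} (o : Oracle n) (B : Bag n) (us : List (Node n)) :
    SplitState n :=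
  let r := us.foldl splitAt ⟨[B], ∅, o⟩
  ⟨r.bags.flatMap (explode r.oracle), r.skel, r.oracle⟩

/-- The size of the largest bag of a list. -/
def maxSize {n : ℕ} (l : List (Bag n)) : ℕ :=
  (l.map (fun B => B.nodes.card)).foldr max 0

/-- `S` is the edge set of the semi-labelled tree with regular nodes `R` (some of which may be
previously discovered latent nodes) that realizes the distances between the elements of `R`; its
other nodes have the names `lo, …, hi - 1`. -/
def IsInducedTree {n : ℕ} (dist : Node n → Node n → ℝ) (R : Finset (Node n)) (lo hi : ℕ)
    (S : Skeleton n) : Prop :=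
  let G : SimpleGraph (Node n) := SimpleGraph.fromEdgeSet (S : Set (Sym2 (Node n)))
  ∃ U : Finset (Node n), R ⊆ U ∧
    (∀ e ∈ S, ¬ e.IsDiag ∧ ∀ a ∈ e, a ∈ U) ∧
    (G.induce (U : Set (Node n))).IsTree ∧
    (∀ a ∈ U, a ∉ R →
      (∃ m, lo ≤ m ∧ m < hi ∧ a = Sum.inr m) ∧ 3 ≤ (G.neighborSet a).ncard) ∧
    ∃ ℓ : Sym2 (Node n) → ℝ, (∀ e ∈ S, 0 < ℓ e) ∧
      ∀ a ∈ R, ∀ b ∈ R, ∀ p : G.Walk a b, p.IsPath → dist a b = (p.edges.map ℓ).sum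

/-- The full skeleton of the tree induced by a small bag, with the updated first unused name
(nothing is added if the known distances are not realized by any semi-labelled tree). -/
noncomputable def fullSkeleton {n : ℕ} (o : Oracle n) (R : Finset (Node n)) : Skeleton n × ℕ :=
  open Classical in
  if h : ∃ r : Skeleton n × ℕ, o.next ≤ r.2 ∧ IsInducedTree o.dist R o.next r.2 r.1
  then h.choose else (∅, o.next)

/-- The state of the main loop: queue of bags, skeleton found so far, and oracle. -/
structure State (n : ℕ) where
  queue : List (Bag n)
  skel : Skeleton n
  oracle : Oracle n

/-- The initial state: the only bag consists of all regular nodes, with representative `root`. -/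
noncomputable def initState {n : ℕ} (d : Fin n → Fin n → ℝ) (root : Fin n) : State n where
  queue := [⟨Finset.univ.image Sum.inl, Sum.inl root⟩]
  skel := ∅
  oracle := initOracle d

theorem nonempty_samples {n κ : ℕ} (B : Bag n) (h : ¬ B.nodes.card ≤ κ) :
    Nonempty (Fin κ ↪ {v : Node n // v ∈ B.nodes.erase B.rep}) := by
  apply Function.Embedding.nonempty_of_card_le
  have := Finset.pred_card_le_card_erase (s := B.nodes) (a := B.rep)
  rw [Fintype.card_fin, Fintype.card_coe]
  omega

/-- What happens to the bag `B` taken from the front of the queue (the rest of which is `Q`) for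
the sample `us`: if the pass of `bigsplit` leaves only bags of size at most `|B| / √κ`, it is
accepted; otherwise `bigsplit` has to be repeated with a new sample, and the state is unchanged. -/
noncomputable def splitOutcome {n : ℕ} (κ : ℕ) (s : State n) (B : Bag n) (Q : List (Bag n))
    (us : List (Node n)) : State n :=
  open Classical in
  let r := bigsplitPass s.oracle B us
  if (maxSize r.bags : ℝ) * √(κ : ℝ) ≤ (B.nodes.card : ℝ) then
    ⟨Q ++ r.bags, s.skel ∪ r.skel, r.oracle⟩
  else s

/-- One random step of the main loop with parameter `κ`. A bag with at most `κ` nodes is solved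
completely; for a larger bag `B`, one pass of `bigsplit` is made with `κ` nodes sampled uniformly
without replacement from `B \ {ρ(B)}`. Nothing happens once the queue is empty. -/
noncomputable def step {n : ℕ} (κ : ℕ) (s : State n) : PMF (State n) :=
  match s.queue with
  | [] => PMF.pure s
  | B :: Q =>
    if h : B.nodes.card ≤ κ then
      let r := fullSkeleton s.oracle B.nodes
      PMF.pure ⟨Q, s.skel ∪ r.1, ⟨s.oracle.dist, r.2⟩⟩
    else
      haveI := nonempty_samples B h
      (PMF.uniformOfFintype (Fin κ ↪ {v : Node n // v ∈ B.nodes.erase B.rep})).map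
        (fun us => splitOutcome κ s B Q (List.ofFn (fun i => (us i : Node n))))

/-- The distribution of the state after `t` steps of the algorithm with parameter `κ`, applied to
the distance oracle `d`, where `root` is the node picked at the beginning. -/
noncomputable def run {n : ℕ} (κ : ℕ) (d : Fin n → Fin n → ℝ) (root : Fin n) : ℕ → PMF (State n)
  | 0 => PMF.pure (initState d root)
  | t + 1 => (run κ d root t).bind (step κ)

/-- The skeleton `S` is the tree `T` up to the names of the latent nodes. -/
def Recovers {V : Type*} [Fintype V] {n : ℕ} (T : SemiLabeledTree V n) (S : Skeleton n) : Prop :=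
  ∃ φ : V → Node n, Function.Injective φ ∧ (∀ i, φ (T.label i) = Sum.inl i) ∧
    (S : Set (Sym2 (Node n))) = Sym2.map φ '' T.graph.edgeSet

/-- The algorithm with parameter `κ`, applied to the oracle `d`, correctly recovers `T`: whichever
regular node is picked at the beginning, the algorithm halts (its queue becomes empty) with
probability one, and whenever it has halted, the skeleton it returns is `T`. -/
def AlgorithmRecovers {V : Type*} [Fintype V] {n : ℕ} (κ : ℕ) (d : Fin n → Fin n → ℝ)
    (T : SemiLabeledTree V n) : Prop :=
  ∀ root : Fin n,
    (∀ t, ∀ s ∈ (run κ d root t).support, s.queue = [] → Recovers T s.skel) ∧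
    Tendsto (fun t => (run κ d root t).toOuterMeasure {s | s.queue = []}) atTop (𝓝 1)

end TreeRecovery

/-! The proof has a probabilistic and a combinatorial half. They meet in the statement that `d` is
the restriction to the labels of a path metric on `T` with positive edge lengths.

Probability. A strictly monotone change of a coordinate alters Kendall's τ by at most a sign
(`abs_sin_kendallTau_comp`), so `Y` may be replaced by `Z`. The difference of two independent copies
of a Gaussian pair is a centred Gaussian pair with the same correlation ρ. Its orthant probabilities
are angles, so κ = (2/π) arcsin ρ and d = -log |ρ| (`kendallTau_eq_of_hasGaussianLaw`). The
factorization makes `Z u` and `Z v` conditionally independent given `Z w` for every `w` on the path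
between them, whence ρ_uv = ρ_uw ρ_wv (`variance_mul_covariance`, `pearsonCorr_mul`). So `d` adds up
the lengths -log |ρ_e| along paths. These are well defined because edge correlations are nonzero,
and positive because a density excludes |ρ_e| = 1.

Correctness. The invariant `Inv` says that each bag consists of the labels and the gate of a region
of the tree that can be left only through its gate, that the regions have disjoint interiors, that
all edges found so far are edges of `T`, and that whatever has not been found lies in a region.
`basic` cuts a region along a path and `explode` cuts it into the branches at its gate (`Inv.basic`,
`Inv.explode`). A small bag is solved correctly because a tree metric is determined by its values on
the labels (`exists_isometry`, `Inv.fullSkeleton`). When the queue is empty nothing is missing, and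
the skeleton is `T`.

Halting. The bags of a pass have interiors that are whole branches of the tree, and sampled nodes
lie in no interior. The large branches form a laminar family that few points can hit, so for every
large bag some sample is accepted (`Inv.exists_good_sample`). Hence a potential with values in ℕ
never increases, and while the queue is non-empty it decreases with probability bounded below.
Comparing expectations, the probability of a non-empty queue tends to zero
(`PMF.tendsto_one_of_potential`). -/

/-! ## Tree metrics -/

/-- `x` lies between `u` and `v` in the metric `D`. -/
def Betw {V : Type*} (D : V → V → ℝ) (u x v : V) : Prop := D u x + D x v = D u v

/-- The path metric of a tree with positive edge lengths: a metric with medians, in which a vertex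
that separates `u` from `v` separates every vertex from `u` or from `v`. -/
structure IsTreeMetric {V : Type*} (D : V → V → ℝ) : Prop where
  self : ∀ u, D u u = 0
  symm : ∀ u v, D u v = D v u
  pos : ∀ u v, u ≠ v → 0 < D u v
  triangle : ∀ u v w, D u w ≤ D u v + D v w
  median : ∀ u v w, ∃ m, Betw D u m v ∧ Betw D u m w ∧ Betw D v m w
  branch : ∀ u m v, Betw D u m v → ∀ y, Betw D y m u ∨ Betw D y m v

/-- Every vertex outside `L` has a vertex of `L` in a third branch. -/
def HasThirdBranch {V : Type*} (D : V → V → ℝ) (L : Set V) : Prop :=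
  ∀ p ∉ L, ∀ u w, ∃ v ∈ L, Betw D v p u ∧ Betw D v p w

namespace IsTreeMetric

variable {V : Type*} {D : V → V → ℝ}

theorem nonneg (h : IsTreeMetric D) (u v : V) : 0 ≤ D u v := by
  rcases eq_or_ne u v with rfl | e
  · exact (h.self u).ge
  · exact (h.pos u v e).le

theorem eq_of_le (h : IsTreeMetric D) {u v : V} (e : D u v ≤ 0) : u = v := by
  by_contra hne
  exact absurd (h.pos u v hne) e.not_gt

theorem betw_comm (h : IsTreeMetric D) {u x v : V} : Betw D u x v ↔ Betw D v x u := by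
  unfold Betw; rw [h.symm u x, h.symm x v, h.symm u v, add_comm]

theorem betw_left (h : IsTreeMetric D) (u v : V) : Betw D u u v := by simp [Betw, h.self]

theorem betw_right (h : IsTreeMetric D) (u v : V) : Betw D u v v := by simp [Betw, h.self]

theorem not_betw_self (h : IsTreeMetric D) {u p : V} (e : u ≠ p) : ¬ Betw D u p u := by
  intro hb
  have := h.pos u p e
  have h1 := h.symm u p
  have h2 := h.self u
  unfold Betw at hb
  linarith

/-- The relation of lying in the same branch at `p` is transitive. -/
theorem not_betw_trans (h : IsTreeMetric D) {p u v y : V} (h1 : ¬ Betw D u p y)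
    (h2 : ¬ Betw D y p v) : ¬ Betw D u p v := by
  intro hb
  rcases h.branch u p v hb y with h3 | h3
  · exact h1 (h.betw_comm.1 h3)
  · exact h2 h3

theorem eq_of_betw_betw (h : IsTreeMetric D) {u p q : V} (h1 : Betw D u p q) (h2 : Betw D u q p) :
    p = q := by
  apply h.eq_of_le
  have := h.symm p q
  unfold Betw at *
  linarith

/-- Points of a geodesic are ordered by their distance to its start. -/
theorem betw_of_dist_le (h : IsTreeMetric D) {u v p q : V} (hp : Betw D u p v) (hq : Betw D u q v)
    (hle : D u p ≤ D u q) : Betw D u p q ∧ Betw D p q v := by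
  have key : Betw D u p q := by
    rcases h.branch u p v hp q with h1 | h1
    · exact h.betw_comm.1 h1
    · have : q = p := h.eq_of_le (by unfold Betw at *; linarith)
      subst this
      exact h.betw_right u q
  refine ⟨key, ?_⟩
  unfold Betw at *
  linarith

theorem eq_of_dist_eq (h : IsTreeMetric D) {u v p q : V} (hp : Betw D u p v) (hq : Betw D u q v)
    (he : D u p = D u q) : p = q := by
  have h1 := (h.betw_of_dist_le hp hq he.le).1
  have h2 := (h.betw_of_dist_le hq hp he.ge).1
  exact h.eq_of_betw_betw h1 h2

/-- If `p` is the projection of `x` to the geodesic from `u` to `v`, then it is the gate of `x`. -/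
theorem betw_of_proj (h : IsTreeMetric D) {u v x p q : V} (h1 : Betw D x p u) (h2 : Betw D x p v)
    (hp : Betw D u p v) (hq : Betw D u q v) : Betw D x p q := by
  have t1 := h.triangle x q u
  have t2 := h.triangle x q v
  have t3 := h.triangle x p q
  have s1 := h.symm p u
  have s2 := h.symm q u
  rcases le_total (D u p) (D u q) with hle | hle
  · obtain ⟨h3, h4⟩ := h.betw_of_dist_le hp hq hle
    unfold Betw at *; linarith
  · obtain ⟨h3, h4⟩ := h.betw_of_dist_le hq hp hle
    have := h.symm p q
    unfold Betw at *; linarith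

/-- Distances between vertices with different projections to a geodesic. -/
theorem dist_of_proj (h : IsTreeMetric D) {u v x y p q : V} (hp : Betw D u p v)
    (hq : Betw D u q v) (hxu : Betw D x p u) (hxv : Betw D x p v)
    (hyu : Betw D y q u) (hyv : Betw D y q v) (hne : p ≠ q) :
    D x y = D x p + D p q + D q y := by
  have hxq := h.betw_of_proj hxu hxv hp hq
  have hyp := h.betw_of_proj hyu hyv hq hp
  -- If `q` did not separate `x` from `y`, the branch property at `q` would put `q` between `x` and
  -- both ends of the geodesic, so `q` would be a second projection of `x`.
  have hb : Betw D x q y := by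
    by_contra hcon
    have h1 : Betw D x q u := by
      rcases h.branch y q u hyu x with h1 | h1
      · exact absurd h1 hcon
      · exact h1
    have h2 : Betw D x q v := by
      rcases h.branch y q v hyv x with h1 | h1
      · exact absurd h1 hcon
      · exact h1
    have h3 := h.betw_of_proj h1 h2 hq hp
    exact hne (h.eq_of_betw_betw hxq h3)
  unfold Betw at *; linarith

/-- Beyond every vertex there is a labelled one. -/
theorem exists_beyond (h : IsTreeMetric D) {L : Set V} (hL : HasThirdBranch D L) (x y : V) :
    ∃ v ∈ L, Betw D x y v := by
  by_cases hy : y ∈ L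
  · exact ⟨y, hy, h.betw_right x y⟩
  · obtain ⟨v, hv, h1, -⟩ := hL y hy x x
    exact ⟨v, hv, h.betw_comm.1 h1⟩

/-- A tree metric on the vertices of a semi-labelled tree is determined by its values on the
labelled vertices: the vertices are matched by their distances to the labelled ones. -/
theorem exists_match {V₂ R : Type*} {D₂ : V₂ → V₂ → ℝ} (h₁ : IsTreeMetric D)
    (h₂ : IsTreeMetric D₂) (a : R → V) (b : R → V₂)
    (t₁ : HasThirdBranch D (Set.range a))
    (hd : ∀ r s, D (a r) (a s) = D₂ (b r) (b s)) (x : V) :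
    ∃ y : V₂, ∀ r, D x (a r) = D₂ y (b r) := by
  by_cases hx : x ∈ Set.range a
  · obtain ⟨r, rfl⟩ := hx
    exact ⟨b r, fun s => hd r s⟩
  · obtain ⟨_, ⟨r, rfl⟩, -, -⟩ := t₁ x hx x x
    obtain ⟨_, ⟨s, rfl⟩, hs, -⟩ := t₁ x hx (a r) (a r)
    obtain ⟨_, ⟨t, rfl⟩, ht, ht'⟩ := t₁ x hx (a r) (a s)
    -- The three labels were chosen in different branches at `x`, so `x` is their median. The median
    -- of their counterparts has the same distances to them.
    obtain ⟨y, y1, y2, y3⟩ := h₂.median (b r) (b s) (b t)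
    have e1 := hd r s
    have e2 := hd r t
    have e3 := hd s t
    have s1 := h₁.symm x (a r)
    have s2 := h₁.symm x (a s)
    have s3 := h₁.symm x (a t)
    have s1' := h₂.symm y (b r)
    have s2' := h₂.symm y (b s)
    have s3' := h₂.symm y (b t)
    have u1 := h₁.symm (a r) (a s)
    have u2 := h₁.symm (a r) (a t)
    have u3 := h₁.symm (a s) (a t)
    have er : D x (a r) = D₂ y (b r) := by unfold Betw at *; linarith
    have es : D x (a s) = D₂ y (b s) := by unfold Betw at *; linarith
    -- By the branch property, `x` lies between label `k` and one of labels `r`, `s`. This writes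
    -- its distance to `k` as a difference of known distances, and the triangle inequality at `y`
    -- bounds that difference. The reverse inequality exchanges the roles of the two metrics.
    refine ⟨y, fun k => le_antisymm ?_ ?_⟩
    · have v1 := hd k r
      have v2 := hd k s
      have w1 := h₂.triangle (b k) y (b r)
      have w2 := h₂.triangle (b k) y (b s)
      have w3 := h₂.symm (b k) y
      have w4 := h₁.symm x (a k)
      rcases h₁.branch (a s) x (a r) hs (a k) with hb | hb <;> unfold Betw at hb <;> linarith
    · have v1 := hd k r
      have v2 := hd k s
      have w1 := h₁.triangle (a k) x (a r)
      have w2 := h₁.triangle (a k) x (a s)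
      have w3 := h₂.symm (b k) y
      have w4 := h₁.symm x (a k)
      rcases h₂.branch (b r) y (b s) y1 (b k) with hb | hb <;> unfold Betw at hb <;> linarith

/-- Prolong the geodesic from `x` to `x'` up to a label. The distance of `x` and `x'` is then the
difference of their distances to that label, which the triangle inequality bounds on the other side.
In particular a vertex is determined by its distances to the labels. -/
theorem dist_le_of_match {V₂ R : Type*} {D₂ : V₂ → V₂ → ℝ} (h₁ : IsTreeMetric D)
    (h₂ : IsTreeMetric D₂) (a : R → V) (b : R → V₂) (t₁ : HasThirdBranch D (Set.range a))
    {x x' : V} {y y' : V₂} (hx : ∀ r, D x (a r) = D₂ y (b r))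
    (hx' : ∀ r, D x' (a r) = D₂ y' (b r)) : D x x' ≤ D₂ y y' := by
  obtain ⟨_, ⟨r, rfl⟩, hr⟩ := h₁.exists_beyond t₁ x x'
  have := h₂.triangle y y' (b r)
  have h3 := hx r
  have h4 := hx' r
  unfold Betw at hr
  linarith

/-- Uniqueness of the semi-labelled tree that realizes given distances. -/
theorem exists_isometry {V₂ R : Type*} {D₂ : V₂ → V₂ → ℝ} (h₁ : IsTreeMetric D)
    (h₂ : IsTreeMetric D₂) (a : R → V) (b : R → V₂)
    (t₁ : HasThirdBranch D (Set.range a)) (t₂ : HasThirdBranch D₂ (Set.range b))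
    (hd : ∀ r s, D (a r) (a s) = D₂ (b r) (b s)) :
    ∃ F : V ≃ V₂, (∀ r, F (a r) = b r) ∧ ∀ x y, D₂ (F x) (F y) = D x y := by
  choose F hF using h₁.exists_match h₂ a b t₁ hd
  choose G hG using h₂.exists_match h₁ b a t₂ (fun r s => (hd r s).symm)
  -- `G (F x)` and `x` have the same distances to all labels, so they are at distance at most `D x x
  -- = 0`.
  have hGF : ∀ x, G (F x) = x := fun x => h₁.eq_of_le (by
    have := h₁.dist_le_of_match h₁ a a t₁ (x := G (F x)) (x' := x) (y := x) (y' := x)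
      (fun r => by rw [← hG, ← hF]) (fun r => rfl)
    rwa [h₁.self] at this)
  have hFG : ∀ y, F (G y) = y := fun y => h₂.eq_of_le (by
    have := h₂.dist_le_of_match h₂ b b t₂ (x := F (G y)) (x' := y) (y := y) (y' := y)
      (fun r => by rw [← hF, ← hG]) (fun r => rfl)
    rwa [h₂.self] at this)
  refine ⟨⟨F, G, hGF, hFG⟩, fun r => ?_, fun x y => ?_⟩
  · change F (a r) = b r
    refine h₂.eq_of_le ?_
    have := h₂.dist_le_of_match h₁ b a t₂ (x := F (a r)) (x' := b r) (y := a r) (y' := a r)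
      (fun s => (hF _ _).symm) (fun s => (hd r s).symm)
    rwa [h₁.self] at this
  · exact le_antisymm
      (h₂.dist_le_of_match h₁ b a t₂ (fun r => (hF x r).symm) (fun r => (hF y r).symm))
      (h₁.dist_le_of_match h₂ a b t₁ (hF x) (hF y))

end IsTreeMetric

/-! ## The path metric of a weighted tree -/

namespace SimpleGraph.IsTree

variable {V : Type*} {G : SimpleGraph V}

/-- The sum of the weights of the edges on the path from `u` to `v`. -/
noncomputable def pathDist (hG : G.IsTree) (ℓ : Sym2 V → ℝ) (u v : V) : ℝ :=
  ((hG.existsUnique_path u v).choose.edges.map ℓ).sum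

theorem pathDist_eq (hG : G.IsTree) (ℓ : Sym2 V → ℝ) {u v : V} {p : G.Walk u v} (hp : p.IsPath) :
    hG.pathDist ℓ u v = (p.edges.map ℓ).sum := by
  have h := (hG.existsUnique_path u v).choose_spec
  rw [pathDist, h.2 p hp]

theorem pathDist_append (hG : G.IsTree) (ℓ : Sym2 V → ℝ) {u v w : V} {p : G.Walk u v}
    {q : G.Walk v w} (h : (p.append q).IsPath) :
    hG.pathDist ℓ u v + hG.pathDist ℓ v w = hG.pathDist ℓ u w := by
  rw [hG.pathDist_eq ℓ h, hG.pathDist_eq ℓ h.of_append_left, hG.pathDist_eq ℓ h.of_append_right,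
    Walk.edges_append, List.map_append, List.sum_append]

theorem pathDist_of_mem_support (hG : G.IsTree) (ℓ : Sym2 V → ℝ) {u v x : V} {p : G.Walk u v}
    (hp : p.IsPath) (hx : x ∈ p.support) : Betw (hG.pathDist ℓ) u x v := by
  obtain ⟨q, r, -, -, rfl⟩ := hp.mem_support_iff_exists_append.1 hx
  exact hG.pathDist_append ℓ hp

theorem pathDist_symm (hG : G.IsTree) (ℓ : Sym2 V → ℝ) (u v : V) :
    hG.pathDist ℓ u v = hG.pathDist ℓ v u := by
  obtain ⟨p, hp, -⟩ := hG.existsUnique_path u v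
  rw [hG.pathDist_eq ℓ hp, hG.pathDist_eq ℓ hp.reverse, Walk.edges_reverse, List.map_reverse,
    List.sum_reverse]

theorem pathDist_pos (hG : G.IsTree) {ℓ : Sym2 V → ℝ} (hℓ : ∀ e ∈ G.edgeSet, 0 < ℓ e) (u v : V)
    (hne : u ≠ v) : 0 < hG.pathDist ℓ u v := by
  obtain ⟨p, hp, -⟩ := hG.existsUnique_path u v
  rw [hG.pathDist_eq ℓ hp]
  apply List.sum_pos
  · intro x hx
    obtain ⟨e, he, rfl⟩ := List.mem_map.1 hx
    exact hℓ e (p.edges_subset_edgeSet he)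
  · cases p with
    | nil => exact absurd rfl hne
    | cons h q => simp

theorem pathDist_self (hG : G.IsTree) (ℓ : Sym2 V → ℝ) (u : V) : hG.pathDist ℓ u u = 0 := by
  rw [hG.pathDist_eq ℓ (Walk.IsPath.nil (u := u))]; simp

theorem isPath_append {u v w : V} {p : G.Walk u v} {q : G.Walk v w} (hp : p.IsPath)
    (hq : q.IsPath) (h : ∀ y ∈ p.support, y ∈ q.support → y = v) : (p.append q).IsPath := by
  rw [Walk.isPath_def, Walk.support_append, List.nodup_append']
  refine ⟨hp.support_nodup, hq.support_nodup.sublist (List.tail_sublist _), ?_⟩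
  intro y hy hy'
  have := h y hy (List.mem_of_mem_tail hy')
  subst this
  have hn := hq.support_nodup
  rw [← Walk.cons_tail_support] at hn
  exact (List.nodup_cons.1 hn).1 hy'

/-- The vertex of the path from `u` to `v` closest to `x` is the median. -/
theorem exists_mem_support_proj [Finite V] (hG : G.IsTree) {ℓ : Sym2 V → ℝ}
    (hℓ : ∀ e ∈ G.edgeSet, 0 < ℓ e) {u v : V} (x : V) {p : G.Walk u v} (hp : p.IsPath) :
    ∃ m ∈ p.support, Betw (hG.pathDist ℓ) x m u ∧ Betw (hG.pathDist ℓ) x m v := by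
  classical
  obtain ⟨m, hm, hmin⟩ := p.support.toFinset.exists_min_image (hG.pathDist ℓ x)
    ⟨u, by simp⟩
  rw [List.mem_toFinset] at hm
  obtain ⟨q, hq, -⟩ := hG.existsUnique_path x m
  -- The path from `x` to the closest vertex `m` of `p` meets `p` only in `m`, since an earlier
  -- common vertex would be closer. It can therefore be prolonged along `p` in either direction.
  have key : ∀ y ∈ q.support, y ∈ p.support → y = m := by
    intro y hy hyp
    by_contra hne
    have h1 := hmin y (by simpa using hyp)
    have h2 := hG.pathDist_of_mem_support ℓ hq hy
    have h3 := hG.pathDist_pos hℓ y m hne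
    unfold Betw at h2
    linarith
  obtain ⟨r, s, hr, hs, rfl⟩ := hp.mem_support_iff_exists_append.1 hm
  refine ⟨m, hm, hG.pathDist_append ℓ (isPath_append hq hr.reverse ?_),
    hG.pathDist_append ℓ (isPath_append hq hs ?_)⟩
  · intro y hy hy'
    refine key y hy ?_
    rw [Walk.mem_support_append_iff]
    exact Or.inl (by simpa using hy')
  · intro y hy hy'
    refine key y hy ?_
    rw [Walk.mem_support_append_iff]
    exact Or.inr hy'

/-- With `m` the projection of `x` to the path, the detour through `x` exceeds the distance of the
ends by twice the distance from `x` to `m`. Betweenness thus forces `x = m`. -/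
theorem betw_iff_mem_support [Finite V] (hG : G.IsTree) {ℓ : Sym2 V → ℝ}
    (hℓ : ∀ e ∈ G.edgeSet, 0 < ℓ e) {u v x : V} {p : G.Walk u v} (hp : p.IsPath) :
    Betw (hG.pathDist ℓ) u x v ↔ x ∈ p.support := by
  refine ⟨fun hb => ?_, hG.pathDist_of_mem_support ℓ hp⟩
  obtain ⟨m, hm, h1, h2⟩ := hG.exists_mem_support_proj hℓ x hp
  have h3 := hG.pathDist_of_mem_support ℓ hp hm
  have s1 := hG.pathDist_symm ℓ x u
  have s2 := hG.pathDist_symm ℓ m u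
  by_cases hxm : x = m
  · exact hxm ▸ hm
  · have := hG.pathDist_pos hℓ x m hxm
    unfold Betw at *
    linarith

theorem isTreeMetric_pathDist [Finite V] (hG : G.IsTree) {ℓ : Sym2 V → ℝ}
    (hℓ : ∀ e ∈ G.edgeSet, 0 < ℓ e) : IsTreeMetric (hG.pathDist ℓ) where
  self := hG.pathDist_self ℓ
  symm := hG.pathDist_symm ℓ
  pos := hG.pathDist_pos hℓ
  triangle u v w := by
    obtain ⟨p, hp, -⟩ := hG.existsUnique_path u w
    obtain ⟨m, hm, h1, h2⟩ := hG.exists_mem_support_proj hℓ v hp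
    have h3 := hG.pathDist_of_mem_support ℓ hp hm
    have s1 := hG.pathDist_symm ℓ v u
    have s2 := hG.pathDist_symm ℓ m u
    have h4 : 0 ≤ hG.pathDist ℓ v m := by
      rcases eq_or_ne v m with rfl | e
      · exact (hG.pathDist_self ℓ v).ge
      · exact (hG.pathDist_pos hℓ _ _ e).le
    unfold Betw at *
    linarith
  median u v w := by
    obtain ⟨p, hp, -⟩ := hG.existsUnique_path u v
    obtain ⟨m, hm, h1, h2⟩ := hG.exists_mem_support_proj hℓ w hp
    have h3 := hG.pathDist_of_mem_support ℓ hp hm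
    refine ⟨m, h3, ?_, ?_⟩ <;> unfold Betw at *
    · rw [hG.pathDist_symm ℓ u m, hG.pathDist_symm ℓ m w, hG.pathDist_symm ℓ u w, add_comm]
      exact h1
    · rw [hG.pathDist_symm ℓ v m, hG.pathDist_symm ℓ m w, hG.pathDist_symm ℓ v w, add_comm]
      exact h2
  branch u m v hb y := by
    classical
    by_contra! hcon
    obtain ⟨p, hp, -⟩ := hG.existsUnique_path y u
    obtain ⟨q, hq, -⟩ := hG.existsUnique_path y v
    rw [hG.betw_iff_mem_support hℓ hp, hG.betw_iff_mem_support hℓ hq] at hcon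
    -- The path from `u` to `v` is contained in the union of the paths from `y` to `u` and to `v`,
    -- being what remains of their concatenation after loops are removed.
    rw [hG.betw_iff_mem_support hℓ (Walk.bypass_isPath (p.reverse.append q))] at hb
    have := Walk.support_bypass_subset_support _ hb
    rw [Walk.mem_support_append_iff] at this
    simp only [Walk.support_reverse, List.mem_reverse] at this
    tauto

/-- Adjacency is read off from the metric, so isometries of path metrics are isomorphisms of trees.
-/
theorem adj_iff_forall_betw [Finite V] (hG : G.IsTree) {ℓ : Sym2 V → ℝ}
    (hℓ : ∀ e ∈ G.edgeSet, 0 < ℓ e) {u v : V} :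
    G.Adj u v ↔ u ≠ v ∧ ∀ x, Betw (hG.pathDist ℓ) u x v → x = u ∨ x = v := by
  constructor
  · intro h
    refine ⟨h.ne, fun x hx => ?_⟩
    rw [hG.betw_iff_mem_support hℓ (Walk.IsPath.of_adj h)] at hx
    simpa using hx
  · rintro ⟨hne, h⟩
    obtain ⟨p, hp, -⟩ := hG.existsUnique_path u v
    cases p with
    | nil => exact absurd rfl hne
    | cons hadj q =>
      rename_i w
      rcases h w ((hG.betw_iff_mem_support hℓ hp).2 (by simp)) with rfl | rfl
      · exact absurd rfl hadj.ne
      · exact hadj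

/-- The neighbours of `p` lie in different branches, so at most one is in the branch of `u` and at
most one in that of `w`. A third neighbour `x` remains. A vertex `v` farthest from `p` among those
beyond `x` must be in `L`: otherwise it too has at least three neighbours, and one of them is still
farther away. -/
theorem hasThirdBranch_pathDist [Finite V] (hG : G.IsTree) {ℓ : Sym2 V → ℝ}
    (hℓ : ∀ e ∈ G.edgeSet, 0 < ℓ e) {L : Set V} (hL : ∀ v ∉ L, 3 ≤ (G.neighborSet v).ncard) :
    HasThirdBranch (hG.pathDist ℓ) L := by
  classical
  have hD := hG.isTreeMetric_pathDist hℓ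
  set D := hG.pathDist ℓ
  have hnb : ∀ p x y, G.Adj p x → G.Adj p y → x ≠ y → Betw D x p y := by
    intro p x y hx hy hne
    have : (Walk.cons hx.symm (Walk.cons hy Walk.nil)).IsPath := by
      simp [Walk.cons_isPath_iff, hx.ne', hy.ne, hne]
    exact (hG.betw_iff_mem_support hℓ this).2 (by simp)
  have huniq : ∀ p u x y, G.Adj p x → G.Adj p y → ¬ Betw D x p u → ¬ Betw D y p u → x = y := by
    intro p u x y hx hy h1 h2
    by_contra hne
    exact hD.not_betw_trans h1 (fun h => h2 (hD.betw_comm.1 h)) (hnb p x y hx hy hne)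
  have hthird : ∀ p ∉ L, ∀ u w, ∃ x, G.Adj p x ∧ Betw D x p u ∧ Betw D x p w := by
    intro p hp u w
    have h3 := hL p hp
    by_contra! hcon
    have hsub : G.neighborSet p ⊆ {x | G.Adj p x ∧ ¬ Betw D x p u} ∪
        {x | G.Adj p x ∧ ¬ Betw D x p w} := by
      intro x hx
      by_cases h : Betw D x p u
      · exact Or.inr ⟨hx, hcon x hx h⟩
      · exact Or.inl ⟨hx, h⟩
    have h1 : ∀ z, ({x | G.Adj p x ∧ ¬ Betw D x p z} : Set V).ncard ≤ 1 := fun z =>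
      (Set.ncard_le_one (Set.toFinite _)).2 fun a ha b hb =>
        huniq p z a b ha.1 hb.1 ha.2 hb.2
    have := (Set.ncard_le_ncard hsub (Set.toFinite _)).trans (Set.ncard_union_le _ _)
    have := h1 u
    have := h1 w
    omega
  intro p hp u w
  obtain ⟨x, hpx, hxu, hxw⟩ := hthird p hp u w
  obtain ⟨v, hv, hmax⟩ := Set.exists_max_image {v | Betw D p x v} (D p) (Set.toFinite _)
    ⟨x, hD.betw_right p x⟩
  have hvp : Betw D p x v := hv
  have key : ∀ z, Betw D x p z → Betw D v p z := by
    intro z hz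
    by_contra hcon
    refine hD.not_betw_trans (p := p) (u := x) (y := v) ?_ hcon hz
    intro h
    exact hpx.ne (hD.eq_of_betw_betw (hD.betw_comm.1 h) (hD.betw_comm.1 hvp))
  refine ⟨v, ?_, key u hxu, key w hxw⟩
  by_contra hvL
  obtain ⟨y, hvy, hyp, -⟩ := hthird v hvL p p
  have h1 := hD.pos v y hvy.ne
  have hyp' := hD.betw_comm.1 hyp
  have h2 : Betw D p x y := by
    have := hD.triangle p x y
    have := hD.triangle x v y
    unfold Betw at *
    linarith
  have h3 := hmax y h2
  unfold Betw at hyp'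
  linarith

end SimpleGraph.IsTree

/-! ## Configurations of the algorithm -/

/-- A semi-labelled tree with positive edge lengths. -/
structure WeightedSemiLabeledTree (V : Type*) [Fintype V] (n : ℕ) extends SemiLabeledTree V n where
  len : Sym2 V → ℝ
  len_pos : ∀ e ∈ graph.edgeSet, 0 < len e

namespace TreeRecovery

/-- A set of vertices with a distinguished one. -/
structure Region (V : Type*) where
  carrier : Set V
  gate : V

/-- The vertices of a region other than its gate. -/
def Region.interior {V : Type*} (r : Region V) : Set V := {x | x ∈ r.carrier ∧ x ≠ r.gate}

/-- Every path that leaves the region passes through its gate. -/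
structure Region.IsGated {V : Type*} (D : V → V → ℝ) (r : Region V) : Prop where
  gate_mem : r.gate ∈ r.carrier
  betw : ∀ x ∈ r.carrier, ∀ y ∉ r.carrier, Betw D x r.gate y

/-- Gated regions are convex: a geodesic that left the region would pass through the gate on the way
out and again on the way back. -/
theorem Region.IsGated.mem_of_betw {V : Type*} {D : V → V → ℝ} (hD : IsTreeMetric D)
    {r : Region V} (h : r.IsGated D) {x y z : V} (hx : x ∈ r.carrier) (hy : y ∈ r.carrier)
    (hz : Betw D x z y) : z ∈ r.carrier := by
  by_contra hcon
  have h1 := h.betw x hx z hcon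
  have h2 := h.betw y hy z hcon
  have := hD.triangle x r.gate y
  have := hD.symm r.gate y
  have := hD.symm z y
  have h3 : r.gate = z := hD.eq_of_le (by unfold Betw at *; linarith)
  exact hcon (h3 ▸ h.gate_mem)

/-- The nodes of a bag other than its representative. -/
def Bag.intr {n : ℕ} (B : Bag n) : Finset (Node n) := B.nodes.erase B.rep

section

variable {V : Type*} [Fintype V] {n : ℕ} (M : WeightedSemiLabeledTree V n)

/-- The path metric of a weighted tree. -/
noncomputable def treeDist : V → V → ℝ := M.isTree.pathDist M.len

theorem isTreeMetric_treeDist : IsTreeMetric (treeDist M) :=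
  M.isTree.isTreeMetric_pathDist M.len_pos

theorem hasThirdBranch_treeDist : HasThirdBranch (treeDist M) (Set.range M.label) :=
  M.isTree.hasThirdBranch_pathDist M.len_pos M.three_le_degree

theorem adj_iff_treeDist {u v : V} :
    M.graph.Adj u v ↔ u ≠ v ∧ ∀ x, Betw (treeDist M) u x v → x = u ∨ x = v :=
  M.isTree.adj_iff_forall_betw M.len_pos

/-- The vertices of a region that are known to the algorithm: the labelled ones and the gate. -/
def known (r : Region V) : Set V := {x | x ∈ r.carrier ∧ (x ∈ Set.range M.label ∨ x = r.gate)}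

open Classical in
/-- The bag of the names of the known vertices of a region. -/
noncomputable def toBag (φ : V → Node n) (r : Region V) : Bag n :=
  ⟨(Finset.univ.filter (· ∈ known M r)).image φ, φ r.gate⟩

/-- `φ` gives distinct names to the vertices in `N`, extending the labels; the names `inr m` with
`o.next ≤ m` are not in use. -/
structure IsNaming (φ : V → Node n) (N : Set V) (o : Oracle n) : Prop where
  inj : Set.InjOn φ N
  label_mem : ∀ i, M.label i ∈ N
  label_eq : ∀ i, φ (M.label i) = Sum.inl i
  fresh : ∀ x ∈ N, ∀ m, φ x = Sum.inr m → m < o.next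

/-- The vertices in `N` have been found, with names `φ`, and the edges in `E`; the remaining
vertices and edges are in the regions `rs`, whose interiors are disjoint. -/
structure IsConfig (φ : V → Node n) (N : Set V) (rs : List (Region V)) (E : Set (Sym2 V))
    (o : Oracle n) : Prop where
  naming : IsNaming M φ N o
  gated : ∀ r ∈ rs, r.IsGated (treeDist M)
  mem_iff : ∀ r ∈ rs, ∀ x ∈ r.carrier, x ∈ N ↔ x ∈ known M r
  dist : ∀ r ∈ rs, ∀ x ∈ known M r, ∀ y ∈ known M r, o.dist (φ x) (φ y) = treeDist M x y
  disj : rs.Pairwise fun r r' => Disjoint r.interior r'.interior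
  edges : ∀ e ∈ E, e ∈ M.graph.edgeSet ∧ ∀ x ∈ e, x ∈ N
  edges_cover : ∀ e ∈ M.graph.edgeSet, e ∈ E ∨ ∃ r ∈ rs, ∀ x ∈ e, x ∈ r.carrier
  cover : ∀ x, x ∈ N ∨ ∃ r ∈ rs, x ∈ r.carrier
  -- Several regions may share a gate. A sampled node that is the representative of one bag is
  -- thereby in the interior of none.
  gate_notMem : ∀ r ∈ rs, ∀ r' ∈ rs, r.gate ∉ r'.interior
  -- One label outside all interiors serves as a common root, relative to which branches are
  -- laminar.
  outside : ∃ i, ∀ r ∈ rs, M.label i ∉ r.interior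

/-- The invariant of the algorithm. -/
def Inv (bags : List (Bag n)) (S : Skeleton n) (o : Oracle n) : Prop :=
  ∃ φ N rs E, IsConfig M φ N rs E o ∧ bags = rs.map (toBag M φ) ∧
    (S : Set (Sym2 (Node n))) = Sym2.map φ '' E

variable {M}

theorem mem_toBag_nodes {φ : V → Node n} {r : Region V} {a : Node n} :
    a ∈ (toBag M φ r).nodes ↔ ∃ x ∈ known M r, φ x = a := by
  simp [toBag]

theorem toBag_congr {φ φ' : V → Node n} {r : Region V} (hg : r.gate ∈ known M r)
    (h : Set.EqOn φ φ' (known M r)) : toBag M φ r = toBag M φ' r := by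
  unfold toBag
  rw [Bag.mk.injEq]
  refine ⟨?_, h hg⟩
  ext a
  simp only [Finset.mem_image, Finset.mem_filter, Finset.mem_univ, true_and]
  constructor
  · rintro ⟨x, hx, rfl⟩; exact ⟨x, hx, (h hx).symm⟩
  · rintro ⟨x, hx, rfl⟩; exact ⟨x, hx, h hx⟩

theorem Region.IsGated.gate_mem_known {D : V → V → ℝ} {r : Region V} (h : r.IsGated D) :
    r.gate ∈ known M r := ⟨h.gate_mem, Or.inr rfl⟩

/-- The order of the bags is immaterial, so the bag to be processed can be brought to the front. -/
theorem Inv.perm {bags bags' : List (Bag n)} {S : Skeleton n} {o : Oracle n} (h : Inv M bags S o)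
    (hp : bags'.Perm bags) : Inv M bags' S o := by
  obtain ⟨φ, N, rs, E, hc, rfl, hS⟩ := h
  obtain ⟨rs', h1, rfl⟩ : ∃ rs', List.Perm rs' rs ∧ bags' = rs'.map (toBag M φ) := by
    clear hc hS
    generalize hb : rs.map (toBag M φ) = l at hp
    induction hp generalizing rs with
    | nil => exact ⟨[], by simpa using hb, rfl⟩
    | cons x _ ih =>
      obtain ⟨r, rs, rfl, rfl, h2⟩ := List.map_eq_cons_iff.1 hb
      obtain ⟨rs', h3, rfl⟩ := ih rs h2
      exact ⟨r :: rs', h3.cons r, rfl⟩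
    | swap x y l =>
      obtain ⟨r, rs, rfl, rfl, h2⟩ := List.map_eq_cons_iff.1 hb
      obtain ⟨r', rs, rfl, rfl, rfl⟩ := List.map_eq_cons_iff.1 h2
      exact ⟨r' :: r :: rs, List.Perm.swap _ _ _, rfl⟩
    | trans _ _ ih1 ih2 =>
      obtain ⟨rs1, h1, h2⟩ := ih2 rs hb
      obtain ⟨rs2, h3, h4⟩ := ih1 rs1 h2.symm
      exact ⟨rs2, h3.trans h1, h4⟩
  refine ⟨φ, N, rs', E, ?_, rfl, hS⟩
  have hm : ∀ r, r ∈ rs' ↔ r ∈ rs := fun r => h1.mem_iff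
  exact
  { naming := hc.naming
    gated := fun r hr => hc.gated r ((hm r).1 hr)
    mem_iff := fun r hr => hc.mem_iff r ((hm r).1 hr)
    dist := fun r hr => hc.dist r ((hm r).1 hr)
    disj := (h1.pairwise_iff fun h => h.symm).2 hc.disj
    edges := hc.edges
    edges_cover := by simpa only [hm] using hc.edges_cover
    cover := by simpa only [hm] using hc.cover
    gate_notMem := by simpa only [hm] using hc.gate_notMem
    outside := by simpa only [hm] using hc.outside }

/-- A region may be replaced by smaller ones, after some of its vertices and edges have been
found. -/
theorem IsConfig.replace {φ φ' : V → Node n} {N N' : Set V} {r : Region V}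
    {rs rs' : List (Region V)} {E E' : Set (Sym2 V)} {o o' : Oracle n} {S S' : Skeleton n}
    (h : IsConfig M φ N (r :: rs) E o) (hS : (S : Set (Sym2 (Node n))) = Sym2.map φ '' E)
    (hφ : Set.EqOn φ' φ N) (hN : N ⊆ N') (hN' : N' ⊆ N ∪ r.carrier) (hn : IsNaming M φ' N' o')
    (ho : ∀ x ∈ N, ∀ y ∈ N, o'.dist (φ x) (φ y) = o.dist (φ x) (φ y))
    (gated : ∀ r' ∈ rs', r'.IsGated (treeDist M))
    (sub : ∀ r' ∈ rs', r'.interior ⊆ r.interior)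
    (mem_iff : ∀ r' ∈ rs', ∀ x ∈ r'.carrier, x ∈ N' ↔ x ∈ known M r')
    (dist : ∀ r' ∈ rs', ∀ x ∈ known M r', ∀ y ∈ known M r',
      o'.dist (φ' x) (φ' y) = treeDist M x y)
    (disj : rs'.Pairwise fun r r' => Disjoint r.interior r'.interior)
    (edges : ∀ e ∈ E', e ∈ M.graph.edgeSet ∧ ∀ x ∈ e, x ∈ N')
    (edges_cover : ∀ e ∈ M.graph.edgeSet, (∀ x ∈ e, x ∈ r.carrier) →
      e ∈ E' ∨ ∃ r' ∈ rs', ∀ x ∈ e, x ∈ r'.carrier)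
    (cover : ∀ x ∈ r.carrier, x ∈ N' ∨ ∃ r' ∈ rs', x ∈ r'.carrier)
    (gate_mem : ∀ r' ∈ rs', r'.gate ∈ r.carrier)
    (gate_notMem : ∀ r₁ ∈ rs', ∀ r₂ ∈ rs', r₁.gate ∉ r₂.interior)
    (hS' : (S' : Set (Sym2 (Node n))) = Sym2.map φ' '' E') :
    Inv M (rs'.map (toBag M φ') ++ rs.map (toBag M φ)) (S ∪ S') o' := by
  have hr := h.gated r (by simp)
  have hknown : ∀ r₀ ∈ rs, known M r₀ ⊆ N := fun r₀ hr₀ x hx =>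
    (h.mem_iff r₀ (by simp [hr₀]) x hx.1).2 hx
  have hgate : ∀ r₀ ∈ rs, r₀.gate ∈ N := fun r₀ hr₀ =>
    hknown r₀ hr₀ (h.gated r₀ (by simp [hr₀])).gate_mem_known
  have hrgate : r.gate ∈ N := (h.mem_iff r (by simp) _ hr.gate_mem).2 hr.gate_mem_known
  refine ⟨φ', N', rs' ++ rs, E ∪ E', ?_, ?_, ?_⟩
  · exact
    { naming := hn
      gated := by
        intro r₀ hr₀
        rcases List.mem_append.1 hr₀ with h1 | h1
        · exact gated r₀ h1
        · exact h.gated r₀ (by simp [h1])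
      mem_iff := by
        intro r₀ hr₀ x hx
        rcases List.mem_append.1 hr₀ with h1 | h1
        · exact mem_iff r₀ h1 x hx
        · rw [← h.mem_iff r₀ (by simp [h1]) x hx]
          refine ⟨fun hxN => ?_, fun hxN => hN hxN⟩
          -- A newly found vertex lies in `r` and is neither its gate nor that of `r₀`. If it were
          -- also in `r₀`, it would lie in two disjoint interiors.
          by_contra hcon
          have hxr : x ∈ r.carrier := (hN' hxN).resolve_left hcon
          have hd := (List.pairwise_cons.1 h.disj).1 r₀ h1
          refine Set.disjoint_left.1 hd (⟨hxr, ?_⟩ : x ∈ r.interior) ⟨hx, ?_⟩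
          · rintro rfl; exact hcon hrgate
          · rintro rfl; exact hcon (hgate r₀ h1)
      dist := by
        intro r₀ hr₀ x hx y hy
        rcases List.mem_append.1 hr₀ with h1 | h1
        · exact dist r₀ h1 x hx y hy
        · have hx' := hknown r₀ h1 hx
          have hy' := hknown r₀ h1 hy
          rw [hφ hx', hφ hy', ho x hx' y hy']
          exact h.dist r₀ (by simp [h1]) x hx y hy
      disj := by
        rw [List.pairwise_append]
        refine ⟨disj, (List.pairwise_cons.1 h.disj).2, fun r₁ h1 r₂ h2 => ?_⟩
        exact ((List.pairwise_cons.1 h.disj).1 r₂ h2).mono_left (sub r₁ h1)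
      edges := by
        rintro e (he | he)
        · exact ⟨(h.edges e he).1, fun x hx => hN ((h.edges e he).2 x hx)⟩
        · exact edges e he
      edges_cover := by
        intro e he
        rcases h.edges_cover e he with h1 | ⟨r₀, h1, h2⟩
        · exact Or.inl (Or.inl h1)
        · rcases List.mem_cons.1 h1 with rfl | h1
          · rcases edges_cover e he h2 with h3 | ⟨r', h3, h4⟩
            · exact Or.inl (Or.inr h3)
            · exact Or.inr ⟨r', by simp [h3], h4⟩
          · exact Or.inr ⟨r₀, by simp [h1], h2⟩
      cover := by
        intro x
        rcases h.cover x with h1 | ⟨r₀, h1, h2⟩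
        · exact Or.inl (hN h1)
        · rcases List.mem_cons.1 h1 with rfl | h1
          · rcases cover x h2 with h3 | ⟨r', h3, h4⟩
            · exact Or.inl h3
            · exact Or.inr ⟨r', by simp [h3], h4⟩
          · exact Or.inr ⟨r₀, by simp [h1], h2⟩
      gate_notMem := by
        intro r₁ h1 r₂ h2 hcon
        rcases List.mem_append.1 h1 with h1 | h1 <;> rcases List.mem_append.1 h2 with h2 | h2
        · exact gate_notMem r₁ h1 r₂ h2 hcon
        · by_cases hg : r₁.gate = r.gate
          · exact h.gate_notMem r (by simp) r₂ (by simp [h2]) (hg ▸ hcon)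
          · exact Set.disjoint_left.1 ((List.pairwise_cons.1 h.disj).1 r₂ h2)
              (⟨gate_mem r₁ h1, hg⟩ : r₁.gate ∈ r.interior) hcon
        · exact h.gate_notMem r₁ (by simp [h1]) r (by simp) (sub r₂ h2 hcon)
        · exact h.gate_notMem r₁ (by simp [h1]) r₂ (by simp [h2]) hcon
      outside := by
        obtain ⟨i, hi⟩ := h.outside
        refine ⟨i, fun r₀ hr₀ => ?_⟩
        rcases List.mem_append.1 hr₀ with h1 | h1
        · exact fun h2 => hi r (by simp) (sub r₀ h1 h2)
        · exact hi r₀ (by simp [h1]) }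
  · rw [List.map_append]
    congr 1
    refine List.map_congr_left fun r₀ hr₀ => toBag_congr ?_ ?_
    · exact (h.gated r₀ (by simp [hr₀])).gate_mem_known
    · exact fun x hx => (hφ (hknown r₀ hr₀ hx)).symm
  · rw [Finset.coe_union, hS, hS', Set.image_union]
    congr 1
    refine Set.image_congr fun e he => ?_
    exact Sym2.map_congr fun x hx => (hφ ((h.edges e he).2 x hx)).symm

/-- When no bag is left, the tree has been found. -/
theorem Inv.recovers {S : Skeleton n} {o : Oracle n} (h : Inv M [] S o) :
    Recovers M.toSemiLabeledTree S := by
  obtain ⟨φ, N, rs, E, hc, hb, hS⟩ := h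
  have hrs : rs = [] := by simpa using hb.symm
  subst hrs
  have hN : ∀ x, x ∈ N := fun x => (hc.cover x).resolve_right (by simp)
  refine ⟨φ, fun x y hxy => hc.naming.inj (hN x) (hN y) hxy, hc.naming.label_eq, ?_⟩
  rw [hS]
  congr 1
  ext e
  exact ⟨fun he => (hc.edges e he).1, fun he => (hc.edges_cover e he).resolve_right (by simp)⟩

theorem IsConfig.rep_mem {φ : V → Node n} {N : Set V} {rs : List (Region V)} {E : Set (Sym2 V)}
    {o : Oracle n} (h : IsConfig M φ N rs E o) {r : Region V} (hr : r ∈ rs) :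
    (toBag M φ r).rep ∈ (toBag M φ r).nodes :=
  mem_toBag_nodes.2 ⟨r.gate, (h.gated r hr).gate_mem_known, rfl⟩

theorem Inv.rep_mem {bags : List (Bag n)} {S : Skeleton n} {o : Oracle n} (h : Inv M bags S o)
    {B : Bag n} (hB : B ∈ bags) : B.rep ∈ B.nodes := by
  obtain ⟨φ, N, rs, E, hc, rfl, hS⟩ := h
  obtain ⟨r, hr, rfl⟩ := List.mem_map.1 hB
  exact hc.rep_mem hr

/-- A latent vertex enters a bag only as its gate, so interiors of bags contain only labels. They
can be compared across different namings and have at most `n` elements. -/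
theorem mem_intr_toBag {φ : V → Node n} {N : Set V} {o : Oracle n} (hn : IsNaming M φ N o)
    {r : Region V} (hr : r.gate ∈ known M r) (hN : known M r ⊆ N) {a : Node n} :
    a ∈ (toBag M φ r).intr ↔ ∃ i, M.label i ∈ r.interior ∧ a = Sum.inl i := by
  rw [Bag.intr, Finset.mem_erase, mem_toBag_nodes]
  constructor
  · rintro ⟨hne, x, hx, rfl⟩
    have hxg : x ≠ r.gate := by rintro rfl; exact hne rfl
    obtain ⟨i, rfl⟩ := hx.2.resolve_right hxg
    exact ⟨i, ⟨hx.1, hxg⟩, hn.label_eq i⟩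
  · rintro ⟨i, hi, rfl⟩
    have hk : M.label i ∈ known M r := ⟨hi.1, Or.inl ⟨i, rfl⟩⟩
    rw [← hn.label_eq i]
    refine ⟨fun h => hi.2 (hn.inj (hN hk) (hN hr) h), _, hk, rfl⟩

theorem IsConfig.mem_intr {φ : V → Node n} {N : Set V} {rs : List (Region V)} {E : Set (Sym2 V)}
    {o : Oracle n} (h : IsConfig M φ N rs E o) {r : Region V} (hr : r ∈ rs) {a : Node n} :
    a ∈ (toBag M φ r).intr ↔ ∃ i, M.label i ∈ r.interior ∧ a = Sum.inl i :=
  mem_intr_toBag h.naming (h.gated r hr).gate_mem_known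
    fun x hx => (h.mem_iff r hr x hx.1).2 hx

theorem Inv.rep_notMem_intr {bags : List (Bag n)} {S : Skeleton n} {o : Oracle n}
    (h : Inv M bags S o) {B B' : Bag n} (hB : B ∈ bags) (hB' : B' ∈ bags) : B.rep ∉ B'.intr := by
  obtain ⟨φ, N, rs, E, hc, rfl, hS⟩ := h
  obtain ⟨r, hr, rfl⟩ := List.mem_map.1 hB
  obtain ⟨r', hr', rfl⟩ := List.mem_map.1 hB'
  intro hcon
  obtain ⟨i, hi, he⟩ := (hc.mem_intr hr').1 hcon
  have hg := (hc.gated r hr).gate_mem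
  have : r.gate = M.label i := hc.naming.inj
    ((hc.mem_iff r hr _ hg).2 ⟨hg, Or.inr rfl⟩) (hc.naming.label_mem i)
    (he.trans (hc.naming.label_eq i).symm)
  exact hc.gate_notMem r hr r' hr' (this ▸ hi)

theorem Inv.disjoint_intr {bags : List (Bag n)} {S : Skeleton n} {o : Oracle n}
    (h : Inv M bags S o) : bags.Pairwise fun B B' => Disjoint B.intr B'.intr := by
  obtain ⟨φ, N, rs, E, hc, rfl, hS⟩ := h
  rw [List.pairwise_map]
  refine hc.disj.imp_of_mem fun {r r'} hr hr' hd => ?_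
  rw [Finset.disjoint_left]
  intro a ha ha'
  obtain ⟨i, hi, rfl⟩ := (hc.mem_intr hr).1 ha
  obtain ⟨j, hj, hij⟩ := (hc.mem_intr hr').1 ha'
  obtain rfl := Sum.inl.inj hij
  exact Set.disjoint_left.1 hd hi hj

end

end TreeRecovery

namespace TreeRecovery

/-! ## The procedure `basic` -/

/-- The vertices of a region whose projection to the path from the gate to `α` is `p`. -/
def slice {V : Type*} (D : V → V → ℝ) (r : Region V) (α p : V) : Region V :=
  ⟨{v | v ∈ r.carrier ∧ Betw D v p r.gate ∧ Betw D v p α}, p⟩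

section Slice

variable {V : Type*} {D : V → V → ℝ} {r : Region V} {α p q v : V}

theorem mem_slice_self (hD : IsTreeMetric D) (hp : p ∈ r.carrier) :
    p ∈ (slice D r α p).carrier := ⟨hp, hD.betw_left _ _, hD.betw_left _ _⟩

/-- This is why `basic` groups by the difference of two distances. The difference does not change
when `v` is replaced by its projection to the path from the gate to `α`, and along that path it is
strictly monotone. -/
theorem mem_slice_iff (hD : IsTreeMetric D) (hp : Betw D r.gate p α) (hv : v ∈ r.carrier) :
    v ∈ (slice D r α p).carrier ↔ D v α - D v r.gate = D p α - D p r.gate := by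
  constructor
  · rintro ⟨-, h1, h2⟩
    unfold Betw at *; linarith
  · intro h
    obtain ⟨m, h1, h2, h3⟩ := hD.median v r.gate α
    have : m = p := hD.eq_of_dist_eq h3 hp (by
      have := hD.symm p r.gate
      have := hD.symm m r.gate
      unfold Betw at *; linarith)
    subst this
    exact ⟨hv, h1, h2⟩

theorem exists_mem_slice (hD : IsTreeMetric D) (α : V) (hv : v ∈ r.carrier) :
    ∃ p, Betw D r.gate p α ∧ v ∈ (slice D r α p).carrier := by
  obtain ⟨m, h1, h2, h3⟩ := hD.median v r.gate α
  exact ⟨m, h3, hv, h1, h2⟩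

theorem slice_eq (hD : IsTreeMetric D) (hp : Betw D r.gate p α) (hq : Betw D r.gate q α)
    (hv : v ∈ (slice D r α p).carrier) (hv' : v ∈ (slice D r α q).carrier) : p = q := by
  have h1 := (mem_slice_iff hD hp hv.1).1 hv
  have h2 := (mem_slice_iff hD hq hv.1).1 hv'
  refine hD.eq_of_dist_eq hp hq ?_
  have := hD.symm p r.gate
  have := hD.symm q r.gate
  unfold Betw at *; linarith

/-- From a slice one reaches another slice along the path, hence through `p`, and the exterior of
`r` through the gate of `r`, hence again through `p`. -/
theorem isGated_slice (hD : IsTreeMetric D) (hr : r.IsGated D) (hα : α ∈ r.carrier)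
    (hp : Betw D r.gate p α) : (slice D r α p).IsGated D := by
  refine ⟨mem_slice_self hD (hr.mem_of_betw hD hr.gate_mem hα hp), fun x hx y hy => ?_⟩
  change Betw D x p y
  by_cases hyr : y ∈ r.carrier
  · obtain ⟨q, hq, hyq⟩ := exists_mem_slice hD α hyr
    have hne : p ≠ q := by rintro rfl; exact hy hyq
    have := hD.dist_of_proj hp hq hx.2.1 hx.2.2 hyq.2.1 hyq.2.2 hne
    have := hD.triangle p q y
    have := hD.triangle x p y
    unfold Betw; linarith
  · have h1 := hr.betw x hx.1 y hyr
    have h2 := hx.2.1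
    have := hD.triangle p r.gate y
    have := hD.triangle x p y
    unfold Betw at *; linarith

theorem slice_interior_subset (hD : IsTreeMetric D) :
    (slice D r α p).interior ⊆ r.interior := by
  rintro x ⟨hx, hxp⟩
  refine ⟨hx.1, ?_⟩
  rintro rfl
  exact hD.not_betw_self hxp hx.2.1

theorem slice_interior_disjoint (hD : IsTreeMetric D) (hp : Betw D r.gate p α)
    (hq : Betw D r.gate q α) (hne : p ≠ q) :
    Disjoint (slice D r α p).interior (slice D r α q).interior :=
  Set.disjoint_left.2 fun _ h1 h2 => hne (slice_eq hD hp hq h1.1 h2.1)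

end Slice

/-- Consecutive entries of a sorted list are those with no entry strictly between them. This form
can be compared with adjacency in the tree. -/
theorem mem_chainEdges_map {n : ℕ} (f : ℝ → Node n) (l : List ℝ) (hl : l.Pairwise (· < ·))
    (e : Sym2 (Node n)) : e ∈ chainEdges (l.map f) ↔
      ∃ a ∈ l, ∃ b ∈ l, a < b ∧ (∀ c ∈ l, ¬ (a < c ∧ c < b)) ∧ e = s(f a, f b) := by
  induction l with
  | nil => simp [chainEdges]
  | cons x l ih =>
    cases l with
    | nil => simp [chainEdges]
    | cons y l =>
      have hx := (List.pairwise_cons.1 hl).1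
      have hy := (List.pairwise_cons.1 (List.pairwise_cons.1 hl).2).1
      have ih' := ih (List.pairwise_cons.1 hl).2
      simp only [List.map_cons, chainEdges, Finset.mem_insert] at ih' ⊢
      rw [ih']
      constructor
      · rintro (rfl | ⟨a, ha, b, hb, hab, hc, rfl⟩)
        · refine ⟨x, by simp, y, by simp, hx y (by simp), ?_, rfl⟩
          rintro c hc ⟨h1, h2⟩
          rcases List.mem_cons.1 hc with rfl | hc
          · exact lt_irrefl _ h1
          rcases List.mem_cons.1 hc with rfl | hc
          · exact lt_irrefl _ h2
          · exact lt_asymm h2 (hy c hc)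
        · refine ⟨a, List.mem_cons_of_mem _ ha, b, List.mem_cons_of_mem _ hb, hab, ?_, rfl⟩
          rintro c hcl ⟨h1, h2⟩
          rcases List.mem_cons.1 hcl with rfl | hcl
          · exact lt_asymm h1 (hx a ha)
          · exact hc c hcl ⟨h1, h2⟩
      · rintro ⟨a, ha, b, hb, hab, hc, rfl⟩
        have hbl : b ∈ y :: l := by
          rcases List.mem_cons.1 hb with rfl | hb
          · rcases List.mem_cons.1 ha with rfl | ha
            · exact absurd hab (lt_irrefl _)
            · exact absurd hab (lt_asymm (hx a ha))
          · exact hb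
        rcases List.mem_cons.1 ha with rfl | ha
        · left
          rcases List.mem_cons.1 hbl with rfl | hbl
          · rfl
          · exact absurd ⟨hx y (by simp), hy b hbl⟩ (hc y (by simp))
        · exact Or.inr ⟨a, ha, b, hbl, hab, fun c hc' => hc c (List.mem_cons_of_mem _ hc'), rfl⟩

theorem argMin_spec {n : ℕ} (s : Finset (Node n)) (g : Node n → ℝ) (a : Node n)
    (h : s.Nonempty) : argMin s g a ∈ s ∧ ∀ b ∈ s, g (argMin s g a) ≤ g b := by
  unfold argMin
  rw [dif_pos h]
  exact (s.exists_min_image g h).choose_spec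

theorem addLatent_dist_of_ne {n : ℕ} (o : Oracle n) (s : Finset (Node n)) (α ρ : Node n)
    {a b : Node n} (ha : a ≠ Sum.inr o.next) (hb : b ≠ Sum.inr o.next) :
    (addLatent o s α ρ).dist a b = o.dist a b := by
  simp [addLatent, ha, hb]

section

variable {V : Type*} [Fintype V] {n : ℕ} {M : WeightedSemiLabeledTree V n}

theorem IsNaming.ne_fresh {φ : V → Node n} {N : Set V} {o : Oracle n} (h : IsNaming M φ N o)
    {x : V} (hx : x ∈ N) : φ x ≠ Sum.inr o.next :=
  fun he => lt_irrefl _ (h.fresh x hx _ he)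

theorem IsNaming.addLatent {φ : V → Node n} {N : Set V} {o : Oracle n} (h : IsNaming M φ N o)
    {p : V} (hp : p ∉ N) (s : Finset (Node n)) (α ρ : Node n) [DecidableEq V] :
    IsNaming M (Function.update φ p (Sum.inr o.next)) (insert p N) (addLatent o s α ρ) := by
  have hne : ∀ x ∈ N, x ≠ p := fun x hx e => hp (e ▸ hx)
  have hup : ∀ x ∈ N, Function.update φ p (Sum.inr o.next) x = φ x := fun x hx =>
    Function.update_of_ne (hne x hx) _ _
  refine ⟨?_, fun i => Or.inr (h.label_mem i), fun i => ?_, ?_⟩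
  · rintro x (rfl | hx) y (rfl | hy) hxy
    · rfl
    · rw [Function.update_self, hup y hy] at hxy
      exact absurd hxy.symm (h.ne_fresh hy)
    · rw [Function.update_self, hup x hx] at hxy
      exact absurd hxy (h.ne_fresh hx)
    · rw [hup x hx, hup y hy] at hxy
      exact h.inj hx hy hxy
  · rw [hup _ (h.label_mem i), h.label_eq]
  · rintro x (rfl | hx) m hm
    · rw [Function.update_self] at hm
      have := Sum.inr.inj hm
      simp only [TreeRecovery.addLatent]; omega
    · rw [hup x hx] at hm
      have := h.fresh x hx m hm
      simp only [TreeRecovery.addLatent]; omega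

/-- The data that `basic` uses about a region. -/
structure IsKnownRegion (M : WeightedSemiLabeledTree V n) (φ : V → Node n) (N : Set V)
    (o : Oracle n) (r : Region V) : Prop where
  naming : IsNaming M φ N o
  gated : r.IsGated (treeDist M)
  subset : known M r ⊆ N
  dist : ∀ x ∈ known M r, ∀ y ∈ known M r, o.dist (φ x) (φ y) = treeDist M x y

/-- A latent vertex has a label in a third branch, and that label projects to it. Hence undiscovered
vertices of the path also show up as values in `basic`. The label is in the region because the way
out would pass through the gate. -/
theorem exists_label_mem_slice {r : Region V} {α p : V} (hr : r.IsGated (treeDist M))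
    (hpk : p ∉ Set.range M.label) (hpg : p ≠ r.gate)
    (hpr : p ∈ r.carrier) :
    ∃ v ∈ Set.range M.label, v ∈ (slice (treeDist M) r α p).carrier := by
  have hD := isTreeMetric_treeDist M
  obtain ⟨v, hv, h1, h2⟩ := hasThirdBranch_treeDist M p hpk r.gate α
  refine ⟨v, hv, ?_, h1, h2⟩
  by_contra hcon
  have h3 := hr.betw p hpr v hcon
  have := hD.symm v p
  have := hD.symm v r.gate
  exact hpg (hD.eq_of_le (by unfold Betw at *; linarith))

theorem known_slice {r : Region V} {α p : V} (hpr : p ∈ r.carrier) {v : V} :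
    v ∈ known M (slice (treeDist M) r α p) ↔
      v = p ∨ (v ∈ known M r ∧ v ∈ (slice (treeDist M) r α p).carrier) := by
  have hD := isTreeMetric_treeDist M
  constructor
  · rintro ⟨h1, h2 | h2⟩
    · exact Or.inr ⟨⟨h1.1, Or.inl h2⟩, h1⟩
    · exact Or.inl h2
  · rintro (rfl | ⟨h1, h2⟩)
    · exact ⟨mem_slice_self hD hpr, Or.inr rfl⟩
    · refine ⟨h2, ?_⟩
      rcases h1.2 with h3 | rfl
      · exact Or.inl h3
      · right
        by_contra hne
        exact hD.not_betw_self hne h2.2.1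

/-- The test in `basic` decides whether the path vertex `p` is already known. If it is, it is the
minimizer and becomes the representative. If not, it is latent and receives the fresh name, while
the distances already known between vertices of `N` are unchanged. -/
theorem basicPart_spec {φ : V → Node n} {N : Set V} {o : Oracle n} {r : Region V} {α p : V}
    (h : IsKnownRegion M φ N o r) (hα : α ∈ known M r)
    (hp : Betw (treeDist M) r.gate p α) (hpN : p ∈ N ↔ p ∈ known M r) :
    ∃ φ', Set.EqOn φ' φ N ∧
      IsNaming M φ' (insert p N) (basicPart (toBag M φ r) (φ α)
        (treeDist M p α - treeDist M p r.gate) o).2 ∧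
      (basicPart (toBag M φ r) (φ α) (treeDist M p α - treeDist M p r.gate) o).1 =
        toBag M φ' (slice (treeDist M) r α p) ∧
      (∀ x ∈ N, ∀ y ∈ N, (basicPart (toBag M φ r) (φ α)
        (treeDist M p α - treeDist M p r.gate) o).2.dist (φ x) (φ y) = o.dist (φ x) (φ y)) ∧
      ∀ x ∈ known M (slice (treeDist M) r α p), ∀ y ∈ known M (slice (treeDist M) r α p),
        (basicPart (toBag M φ r) (φ α) (treeDist M p α - treeDist M p r.gate) o).2.dist
          (φ' x) (φ' y) = treeDist M x y := by
  classical
  have hD := isTreeMetric_treeDist M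
  set D := treeDist M with hDdef
  have hpr : p ∈ r.carrier := h.gated.mem_of_betw hD h.gated.gate_mem hα.1 hp
  have hg : r.gate ∈ known M r := h.gated.gate_mem_known
  set s := (toBag M φ r).nodes.filter
    (fun v => Dval o (toBag M φ r) (φ α) v = D p α - D p r.gate) with hs
  have hmem : ∀ a, a ∈ s ↔ ∃ v ∈ known M r, v ∈ (slice D r α p).carrier ∧ φ v = a := by
    intro a
    rw [hs, Finset.mem_filter, mem_toBag_nodes]
    constructor
    · rintro ⟨⟨v, hv, rfl⟩, h1⟩
      refine ⟨v, hv, (mem_slice_iff hD hp hv.1).2 ?_, rfl⟩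
      rw [Dval, h.dist v hv α hα] at h1
      change D v α - o.dist (φ v) (φ r.gate) = _ at h1
      rwa [h.dist v hv _ hg] at h1
    · rintro ⟨v, hv, h1, rfl⟩
      refine ⟨⟨v, hv, rfl⟩, ?_⟩
      rw [Dval, h.dist v hv α hα]
      change D v α - o.dist (φ v) (φ r.gate) = _
      rw [h.dist v hv _ hg]
      exact (mem_slice_iff hD hp hv.1).1 h1
  have hgα : o.dist (φ r.gate) (φ α) = D r.gate α := h.dist _ hg _ hα
  set u := argMin s (fun v => o.dist v (φ α)) (φ α) with hu
  have hunfold : basicPart (toBag M φ r) (φ α) (D p α - D p r.gate) o =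
      if o.dist (φ r.gate) u + o.dist u (φ α) = o.dist (φ r.gate) (φ α) then (⟨s, u⟩, o)
      else (⟨insert (Sum.inr o.next) s, Sum.inr o.next⟩, addLatent o s (φ α) (φ r.gate)) := rfl
  rw [hunfold]
  by_cases hpk : p ∈ known M r
  · have hps : φ p ∈ s := (hmem _).2 ⟨p, hpk, mem_slice_self hD hpr, rfl⟩
    obtain ⟨hus, hmin⟩ := argMin_spec s (fun v => o.dist v (φ α)) (φ α) ⟨_, hps⟩
    -- Every vertex of the slice reaches `α` through `p`, so `p` is the unique vertex of the slice
    -- closest to `α`.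
    have hup : u = φ p := by
      obtain ⟨v, hv, hvs, hvu⟩ := (hmem _).1 hus
      have h1 := hmin _ hps
      rw [← hvu, h.dist v hv α hα, h.dist p hpk α hα] at h1
      have h2 := hvs.2.2
      rw [hu, ← hvu]
      congr 1
      exact hD.eq_of_le (by unfold Betw at h2; linarith)
    have hcond : o.dist (φ r.gate) u + o.dist u (φ α) = o.dist (φ r.gate) (φ α) := by
      rw [hup, h.dist _ hg p hpk, h.dist p hpk α hα, hgα]
      exact hp
    rw [if_pos hcond]
    have hsub : ∀ x ∈ known M (slice D r α p), x ∈ known M r := by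
      intro x hx
      rcases (known_slice hpr).1 hx with rfl | h2
      · exact hpk
      · exact h2.1
    refine ⟨φ, fun _ _ => rfl, ?_, ?_, fun _ _ _ _ => rfl, ?_⟩
    · rw [Set.insert_eq_of_mem (hpN.2 hpk)]
      exact h.naming
    · unfold toBag
      rw [Bag.mk.injEq]
      refine ⟨?_, hup⟩
      ext a
      rw [hmem]
      simp only [Finset.mem_image, Finset.mem_filter, Finset.mem_univ, true_and]
      constructor
      · rintro ⟨v, hv, hvs, rfl⟩
        exact ⟨v, (known_slice hpr).2 (Or.inr ⟨hv, hvs⟩), rfl⟩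
      · rintro ⟨v, hv, rfl⟩
        exact ⟨v, hsub v hv, hv.1, rfl⟩
    · intro x hx y hy
      exact h.dist x (hsub x hx) y (hsub y hy)
  · have hpn : p ∉ N := fun hc => hpk (hpN.1 hc)
    have hpL : p ∉ Set.range M.label := fun hc => hpk ⟨hpr, Or.inl hc⟩
    have hpg : p ≠ r.gate := fun hc => hpk ⟨hpr, Or.inr hc⟩
    obtain ⟨v₀, hv₀, hv₀s⟩ := exists_label_mem_slice (α := α) h.gated hpL hpg hpr
    have hne : s.Nonempty := ⟨φ v₀, (hmem _).2 ⟨v₀, ⟨hv₀s.1, Or.inl hv₀⟩, hv₀s, rfl⟩⟩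
    obtain ⟨hus, -⟩ := argMin_spec s (fun v => o.dist v (φ α)) (φ α) hne
    -- Success of the test would put the minimizer on the path. It would then be its own projection,
    -- hence `p`, which is not known.
    have hcond : ¬ (o.dist (φ r.gate) u + o.dist u (φ α) = o.dist (φ r.gate) (φ α)) := by
      obtain ⟨v, hv, hvs, hvu⟩ := (hmem _).1 hus
      rw [hu, ← hvu, h.dist _ hg v hv, h.dist v hv α hα, hgα]
      intro hb
      have hvself := mem_slice_self (α := α) hD hv.1
      exact hpk (slice_eq hD hp hb hvs hvself ▸ hv)
    rw [if_neg hcond]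
    set φ' := Function.update φ p (Sum.inr o.next) with hφ'
    have hEq : Set.EqOn φ' φ N := fun x hx =>
      Function.update_of_ne (by rintro rfl; exact hpn hx) _ _
    have hφp : φ' p = Sum.inr o.next := Function.update_self _ _ _
    have hk : ∀ x ∈ known M (slice D r α p), x ≠ p →
        x ∈ known M r ∧ x ∈ N ∧ φ x ∈ s := by
      intro x hx hxp
      have h1 := ((known_slice hpr).1 hx).resolve_left hxp
      exact ⟨h1.1, h.subset h1.1, (hmem _).2 ⟨x, h1.1, h1.2, rfl⟩⟩
    refine ⟨φ', hEq, h.naming.addLatent hpn _ _ _, ?_, ?_, ?_⟩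
    · unfold toBag
      rw [Bag.mk.injEq]
      refine ⟨?_, hφp.symm⟩
      ext a
      rw [Finset.mem_insert, hmem]
      simp only [Finset.mem_image, Finset.mem_filter, Finset.mem_univ, true_and]
      constructor
      · rintro (rfl | ⟨v, hv, hvs, rfl⟩)
        · exact ⟨p, (known_slice hpr).2 (Or.inl rfl), hφp⟩
        · exact ⟨v, (known_slice hpr).2 (Or.inr ⟨hv, hvs⟩), hEq (h.subset hv)⟩
      · rintro ⟨v, hv, rfl⟩
        by_cases hvp : v = p
        · subst hvp; exact Or.inl hφp
        · obtain ⟨h1, h2, -⟩ := hk v hv hvp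
          exact Or.inr ⟨v, h1, hv.1, (hEq h2).symm⟩
    · intro x hx y hy
      exact addLatent_dist_of_ne _ _ _ _ (h.naming.ne_fresh hx) (h.naming.ne_fresh hy)
    -- The half-sum is a Gromov product: the distance of `x` from the path between the gate and `α`,
    -- which is its distance to its projection `p`.
    · have hδ : ∀ x ∈ known M (slice D r α p), x ≠ p →
          (o.dist (φ x) (φ α) + o.dist (φ x) (φ r.gate) - o.dist (φ α) (φ r.gate)) / 2 =
            D x p := by
        intro x hx hxp
        obtain ⟨h1, h2, -⟩ := hk x hx hxp
        rw [h.dist x h1 α hα, h.dist x h1 _ hg, h.dist α hα _ hg]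
        obtain ⟨-, h3, h4⟩ := hx.1
        have := hD.symm α r.gate
        have := hD.symm p r.gate
        unfold Betw at *
        linarith
      intro x hx y hy
      by_cases hxp : x = p <;> by_cases hyp : y = p
      · subst hxp; subst hyp
        simp [addLatent, hφp, hD.self]
      · subst hxp
        obtain ⟨h1, h2, h3⟩ := hk y hy hyp
        have hne := h.naming.ne_fresh h2
        rw [hφp, hEq h2, hD.symm, ← hδ y hy hyp]
        simp [addLatent, hne, h3]
      · subst hyp
        obtain ⟨h1, h2, h3⟩ := hk x hx hxp
        have hne := h.naming.ne_fresh h2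
        rw [hφp, hEq h2, ← hδ x hx hxp]
        simp [addLatent, hne, h3]
      · obtain ⟨h1, h2, -⟩ := hk x hx hxp
        obtain ⟨h1', h2', -⟩ := hk y hy hyp
        rw [hEq h2, hEq h2', addLatent_dist_of_ne _ _ _ _ (h.naming.ne_fresh h2)
          (h.naming.ne_fresh h2')]
        exact h.dist x h1 y h1'

theorem basicLoop_spec {φ : V → Node n} {N : Set V} {o : Oracle n} {r : Region V} {α : V}
    (h : IsKnownRegion M φ N o r) (hα : α ∈ known M r) (ps : List V) (hnd : ps.Nodup)
    (hps : ∀ p ∈ ps, Betw (treeDist M) r.gate p α ∧ (p ∈ N ↔ p ∈ known M r)) :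
    ∃ φ', Set.EqOn φ' φ N ∧
      IsNaming M φ' (N ∪ {p | p ∈ ps}) (basicLoop (toBag M φ r) (φ α)
        (ps.map fun p => treeDist M p α - treeDist M p r.gate) o).2 ∧
      (basicLoop (toBag M φ r) (φ α)
        (ps.map fun p => treeDist M p α - treeDist M p r.gate) o).1 =
        ps.map (fun p => toBag M φ' (slice (treeDist M) r α p)) ∧
      (∀ x ∈ N, ∀ y ∈ N, (basicLoop (toBag M φ r) (φ α)
        (ps.map fun p => treeDist M p α - treeDist M p r.gate) o).2.dist (φ x) (φ y) =
          o.dist (φ x) (φ y)) ∧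
      ∀ p ∈ ps, ∀ x ∈ known M (slice (treeDist M) r α p),
        ∀ y ∈ known M (slice (treeDist M) r α p),
        (basicLoop (toBag M φ r) (φ α)
          (ps.map fun p => treeDist M p α - treeDist M p r.gate) o).2.dist
          (φ' x) (φ' y) = treeDist M x y := by
  have hD := isTreeMetric_treeDist M
  induction ps generalizing φ N o with
  | nil =>
    refine ⟨φ, fun _ _ => rfl, ?_, rfl, fun _ _ _ _ => rfl, by simp⟩
    simpa [basicLoop] using h.naming
  | cons p ps ih =>
    obtain ⟨hp, hpN⟩ := hps p (by simp)
    obtain ⟨φ₁, he₁, hn₁, hb₁, ho₁, hd₁⟩ := basicPart_spec h hα hp hpN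
    simp only [List.map_cons, basicLoop]
    set P := basicPart (toBag M φ r) (φ α) (treeDist M p α - treeDist M p r.gate) o
    have hg : r.gate ∈ known M r := h.gated.gate_mem_known
    have hpr : p ∈ r.carrier := h.gated.mem_of_betw hD h.gated.gate_mem hα.1 hp
    have hbag : toBag M φ₁ r = toBag M φ r :=
      toBag_congr hg fun x hx => he₁ (h.subset hx)
    have hφα : φ₁ α = φ α := he₁ (h.subset hα)
    have h₁ : IsKnownRegion M φ₁ (insert p N) P.2 r := by
      refine ⟨hn₁, h.gated, fun x hx => Or.inr (h.subset hx), fun x hx y hy => ?_⟩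
      rw [he₁ (h.subset hx), he₁ (h.subset hy), ho₁ x (h.subset hx) y (h.subset hy)]
      exact h.dist x hx y hy
    obtain ⟨φ₂, he₂, hn₂, hb₂, ho₂, hd₂⟩ := ih h₁ (List.nodup_cons.1 hnd).2 (by
      intro q hq
      obtain ⟨h1, h2⟩ := hps q (by simp [hq])
      refine ⟨h1, ?_⟩
      rw [← h2, Set.mem_insert_iff]
      -- The path vertices are distinct, so naming `p` does not affect whether a later one is
      -- already found.
      have : q ≠ p := by rintro rfl; exact (List.nodup_cons.1 hnd).1 hq
      simp [this])
    rw [hbag, hφα] at hn₂ hb₂ ho₂ hd₂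
    have hsl : known M (slice (treeDist M) r α p) ⊆ insert p N := by
      intro x hx
      rcases (known_slice hpr).1 hx with rfl | h2
      · exact Or.inl rfl
      · exact Or.inr (h.subset h2.1)
    refine ⟨φ₂, ?_, ?_, ?_, ?_, ?_⟩
    · intro x hx
      rw [he₂ (Or.inr hx), he₁ hx]
    · convert hn₂ using 1
      ext x
      simp only [List.mem_cons, Set.mem_union, Set.mem_ofPred_eq, Set.mem_insert_iff]
      tauto
    · rw [hb₂, hb₁]
      congr 1
      refine toBag_congr ((known_slice hpr).2 (Or.inl rfl)) fun x hx => (he₂ (hsl hx)).symm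
    · intro x hx y hy
      rw [← he₁ hx, ← he₁ hy, ho₂ x (Or.inr hx) y (Or.inr hy), he₁ hx, he₁ hy, ho₁ x hx y hy]
    · intro q hq x hx y hy
      rcases List.mem_cons.1 hq with rfl | hq
      · rw [he₂ (hsl hx), he₂ (hsl hy), ho₂ x (hsl hx) y (hsl hy)]
        exact hd₁ x hx y hy
      · exact hd₂ q hq x hx y hy

end

end TreeRecovery

/-! ### Branches at a vertex, and invariance under `basic`. -/

namespace TreeRecovery

/-- The vertices in the same branch as `u` at `ρ`, and `ρ`. -/
def branchRegion {V : Type*} (D : V → V → ℝ) (ρ u : V) : Region V :=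
  ⟨{x | x = ρ ∨ ¬ Betw D u ρ x}, ρ⟩

theorem isGated_branchRegion {V : Type*} {D : V → V → ℝ} (hD : IsTreeMetric D) (ρ u : V) :
    (branchRegion D ρ u).IsGated D := by
  refine ⟨Or.inl rfl, fun x hx y hy => ?_⟩
  change Betw D x ρ y
  have hy' : Betw D u ρ y := by
    by_contra hcon
    exact hy (Or.inr hcon)
  rcases hx with rfl | hx
  · exact hD.betw_left _ _
  · by_contra hcon
    exact hD.not_betw_trans hx hcon hy'

theorem mem_branchRegion_interior {V : Type*} {D : V → V → ℝ} (hD : IsTreeMetric D) {ρ u x : V} :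
    x ∈ (branchRegion D ρ u).interior ↔ ¬ Betw D u ρ x := by
  constructor
  · rintro ⟨h1 | h1, h2⟩
    · exact absurd h1 h2
    · exact h1
  · intro h
    refine ⟨Or.inr h, ?_⟩
    rintro rfl
    exact h (hD.betw_right _ _)

theorem mem_carrier_of_not_betw {V : Type*} {D : V → V → ℝ} {r : Region V}
    (hr : r.IsGated D) {u x : V} (hu : u ∈ r.carrier) (h : ¬ Betw D u r.gate x) :
    x ∈ r.carrier := by
  by_contra hcon
  exact h (hr.betw u hu x hcon)

section

variable {V : Type*} [Fintype V] {n : ℕ} {M : WeightedSemiLabeledTree V n}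

theorem IsConfig.isKnownRegion {φ : V → Node n} {N : Set V} {rs : List (Region V)}
    {E : Set (Sym2 V)} {o : Oracle n} (h : IsConfig M φ N rs E o) {r : Region V} (hr : r ∈ rs) :
    IsKnownRegion M φ N o r :=
  ⟨h.naming, h.gated r hr, fun x hx => (h.mem_iff r hr x hx.1).2 hx, h.dist r hr⟩

/-- The values of `D` on the vertices of a bag are those at the vertices of the path from the
representative to `α`. -/
theorem exists_path_points {r : Region V} (hr : r.IsGated (treeDist M)) {α : V}
    (hα : α ∈ known M r) (l : List ℝ)
    (hl : ∀ x, x ∈ l ↔ ∃ v ∈ known M r, treeDist M v α - treeDist M v r.gate = x) :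
    ∃ pt : ℝ → V, (∀ x ∈ l, Betw (treeDist M) r.gate (pt x) α ∧
      treeDist M (pt x) α - treeDist M (pt x) r.gate = x) ∧
      ∀ p, Betw (treeDist M) r.gate p α →
        treeDist M p α - treeDist M p r.gate ∈ l ∧
        pt (treeDist M p α - treeDist M p r.gate) = p := by
  have hD := isTreeMetric_treeDist M
  have h1 : ∀ x, ∃ p, x ∈ l → Betw (treeDist M) r.gate p α ∧
      treeDist M p α - treeDist M p r.gate = x := by
    intro x
    by_cases hx : x ∈ l
    · obtain ⟨v, hv, rfl⟩ := (hl x).1 hx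
      obtain ⟨p, hp, hvp⟩ := exists_mem_slice hD α hv.1
      exact ⟨p, fun _ => ⟨hp, ((mem_slice_iff hD hp hv.1).1 hvp).symm⟩⟩
    · exact ⟨r.gate, fun h => absurd h hx⟩
  choose pt hpt using h1
  refine ⟨pt, hpt, fun p hp => ?_⟩
  have hpr : p ∈ r.carrier := hr.mem_of_betw hD hr.gate_mem hα.1 hp
  have hmem : treeDist M p α - treeDist M p r.gate ∈ l := by
    rw [hl]
    by_cases hpk : p ∈ known M r
    · exact ⟨p, hpk, rfl⟩
    · obtain ⟨v, hv, hvs⟩ := exists_label_mem_slice (α := α) hr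
        (fun hc => hpk ⟨hpr, Or.inl hc⟩) (fun hc => hpk ⟨hpr, Or.inr hc⟩) hpr
      exact ⟨v, ⟨hvs.1, Or.inl hv⟩, (mem_slice_iff hD hp hvs.1).1 hvs⟩
  refine ⟨hmem, ?_⟩
  obtain ⟨h1, h2⟩ := hpt _ hmem
  exact slice_eq hD h1 hp ((mem_slice_iff hD h1 hpr).2 h2.symm) (mem_slice_self hD hpr)

/-- The edges of the path from the gate to `α`. -/
def pathEdges (M : WeightedSemiLabeledTree V n) (r : Region V) (α : V) : Set (Sym2 V) :=
  {e | e ∈ M.graph.edgeSet ∧ ∀ x ∈ e, Betw (treeDist M) r.gate x α}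

/-- Sorting by value orders the vertices of the path by their distance to the gate, with larger
values nearer to it. Since `l` misses no vertex of the path, consecutive entries are exactly the
adjacent ones. -/
theorem coe_chainEdges {r : Region V} {α : V} (l : List ℝ) (hl : l.Pairwise (· < ·)) (pt : ℝ → V)
    (hpt : ∀ x ∈ l, Betw (treeDist M) r.gate (pt x) α ∧
      treeDist M (pt x) α - treeDist M (pt x) r.gate = x)
    (hpt' : ∀ p, Betw (treeDist M) r.gate p α →
        treeDist M p α - treeDist M p r.gate ∈ l ∧
        pt (treeDist M p α - treeDist M p r.gate) = p) (φ : V → Node n) :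
    (chainEdges (l.map fun x => φ (pt x)) : Set (Sym2 (Node n))) =
      Sym2.map φ '' pathEdges M r α := by
  have hD := isTreeMetric_treeDist M
  have hadj : ∀ a ∈ l, ∀ b ∈ l, a < b →
      (M.graph.Adj (pt a) (pt b) ↔ ∀ c ∈ l, ¬ (a < c ∧ c < b)) := by
    intro a ha b hb hab
    obtain ⟨ha1, ha2⟩ := hpt a ha
    obtain ⟨hb1, hb2⟩ := hpt b hb
    have hle : treeDist M r.gate (pt b) ≤ treeDist M r.gate (pt a) := by
      have := hD.symm r.gate (pt a)
      have := hD.symm r.gate (pt b)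
      unfold Betw at *; linarith
    obtain ⟨hba, hba'⟩ := hD.betw_of_dist_le hb1 ha1 hle
    rw [adj_iff_treeDist]
    constructor
    · rintro ⟨hne, h⟩ c hc ⟨hac, hcb⟩
      obtain ⟨hc1, hc2⟩ := hpt c hc
      have e1 := hD.symm r.gate (pt a)
      have e2 := hD.symm r.gate (pt b)
      have e3 := hD.symm r.gate (pt c)
      have hca : treeDist M r.gate (pt c) ≤ treeDist M r.gate (pt a) := by
        unfold Betw at *; linarith
      have hbc : treeDist M r.gate (pt b) ≤ treeDist M r.gate (pt c) := by
        unfold Betw at *; linarith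
      have h1 := (hD.betw_of_dist_le hc1 ha1 hca).1
      have h2 := (hD.betw_of_dist_le hb1 hc1 hbc).1
      have h3 : Betw (treeDist M) (pt a) (pt c) (pt b) := by
        rw [hD.betw_comm]; unfold Betw at *; linarith
      rcases h (pt c) h3 with h4 | h4
      · rw [h4] at hc2; linarith
      · rw [h4] at hc2; linarith
    · intro h
      refine ⟨fun he => ?_, fun x hx => ?_⟩
      · rw [he] at ha2; linarith
      · rw [hD.betw_comm] at hx
        have hx1 : Betw (treeDist M) r.gate x α := by
          have := hD.triangle r.gate x α
          have := hD.triangle r.gate (pt b) x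
          have := hD.triangle x (pt a) α
          unfold Betw at *; linarith
        obtain ⟨h1, h2⟩ := hpt' x hx1
        have e1 := hD.symm r.gate (pt a)
        have e2 := hD.symm r.gate (pt b)
        have e3 := hD.symm r.gate x
        have t1 := hD.triangle r.gate (pt b) x
        have t2 := hD.triangle r.gate x (pt a)
        have t3 := hD.nonneg (pt b) x
        have t4 := hD.nonneg x (pt a)
        have h3 := h _ h1
        rw [not_and_or, not_lt, not_lt] at h3
        rcases h3 with h3 | h3
        · exact Or.inl (hD.eq_of_le (by unfold Betw at *; linarith))
        · exact Or.inr (hD.eq_of_le (by rw [hD.symm]; unfold Betw at *; linarith))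
  ext e
  rw [Finset.mem_coe, mem_chainEdges_map (fun x => φ (pt x)) l hl]
  constructor
  · rintro ⟨a, ha, b, hb, hab, hc, rfl⟩
    refine ⟨s(pt a, pt b), ⟨(hadj a ha b hb hab).2 hc, ?_⟩, by simp⟩
    intro x hx
    rcases Sym2.mem_iff.1 hx with rfl | rfl
    · exact (hpt a ha).1
    · exact (hpt b hb).1
  · rintro ⟨e, ⟨he, hx⟩, rfl⟩
    induction e using Sym2.inductionOn with
    | _ x y =>
    have key : ∀ x y, M.graph.Adj x y → Betw (treeDist M) r.gate x α →
        Betw (treeDist M) r.gate y α →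
        treeDist M x α - treeDist M x r.gate ≤ treeDist M y α - treeDist M y r.gate →
        ∃ a ∈ l, ∃ b ∈ l, a < b ∧ (∀ c ∈ l, ¬ (a < c ∧ c < b)) ∧
          s(φ x, φ y) = s(φ (pt a), φ (pt b)) := by
      intro x y hxy hx hy hle
      obtain ⟨h1, h2⟩ := hpt' x hx
      obtain ⟨h3, h4⟩ := hpt' y hy
      have hlt := lt_of_le_of_ne hle fun he => hxy.ne (by rw [← h2, ← h4, he])
      refine ⟨_, h1, _, h3, hlt, ?_, by rw [h2, h4]⟩
      rw [← hadj _ h1 _ h3 hlt, h2, h4]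
      exact hxy
    have hx1 := hx x (by simp)
    have hy1 := hx y (by simp)
    rcases le_total (treeDist M x α - treeDist M x r.gate)
      (treeDist M y α - treeDist M y r.gate) with hle | hle
    · exact key x y he hx1 hy1 hle
    · rw [Sym2.map_mk, Sym2.eq_swap]
      exact key y x (SimpleGraph.Adj.symm he) hy1 hx1 hle

/-- The slices partition the region, and the only edges between different slices are those of the
path, which `basic` outputs. The node `α` projects to itself and becomes the gate of its slice, so
it leaves all interiors. This is the source of progress. -/
theorem Inv.basic {B : Bag n} {Q : List (Bag n)} {S : Skeleton n} {o : Oracle n}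
    (h : Inv M (B :: Q) S o) {a : Node n} (ha : a ∈ B.nodes) :
    Inv M ((basic o B a).1 ++ Q) (S ∪ (basic o B a).2.1) (basic o B a).2.2 ∧
      ∀ b ∈ (basic o B a).1, b.intr ⊆ B.intr ∧ a ∉ b.intr := by
  classical
  obtain ⟨φ, N, rs, E, hc, hb, hS⟩ := h
  have hD := isTreeMetric_treeDist M
  obtain ⟨r, rs, rfl, rfl, rfl⟩ := List.map_eq_cons_iff.1 hb.symm
  obtain ⟨α, hα, rfl⟩ := mem_toBag_nodes.1 ha
  have hk := hc.isKnownRegion (r := r) (by simp)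
  have hg : r.gate ∈ known M r := hk.gated.gate_mem_known
  set l := ((toBag M φ r).nodes.image (Dval o (toBag M φ r) (φ α))).sort (· ≤ ·) with hl
  have hlmem : ∀ x, x ∈ l ↔ ∃ v ∈ known M r, treeDist M v α - treeDist M v r.gate = x := by
    intro x
    have hval : ∀ v ∈ known M r, Dval o (toBag M φ r) (φ α) (φ v) =
        treeDist M v α - treeDist M v r.gate := by
      intro v hv
      rw [Dval, hk.dist v hv α hα]
      change _ - o.dist (φ v) (φ r.gate) = _
      rw [hk.dist v hv _ hg]
    rw [hl, Finset.mem_sort, Finset.mem_image]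
    constructor
    · rintro ⟨_, hb, rfl⟩
      obtain ⟨v, hv, rfl⟩ := mem_toBag_nodes.1 hb
      exact ⟨v, hv, (hval v hv).symm⟩
    · rintro ⟨v, hv, rfl⟩
      exact ⟨φ v, mem_toBag_nodes.2 ⟨v, hv, rfl⟩, hval v hv⟩
  have hlt : l.Pairwise (· < ·) := (Finset.sortedLT_sort _).pairwise
  obtain ⟨pt, hpt, hpt'⟩ := exists_path_points hk.gated hα l hlmem
  have hlps : l = (l.map pt).map fun p => treeDist M p α - treeDist M p r.gate := by
    rw [List.map_map]
    conv_lhs => rw [← List.map_id l]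
    exact List.map_congr_left fun x hx => (hpt x hx).2.symm
  have hmemps : ∀ p, p ∈ l.map pt ↔ Betw (treeDist M) r.gate p α := by
    intro p
    rw [List.mem_map]
    constructor
    · rintro ⟨x, hx, rfl⟩; exact (hpt x hx).1
    · intro hp; exact ⟨_, (hpt' p hp).1, (hpt' p hp).2⟩
  have hnd : (l.map pt).Nodup := by
    have : l.Nodup := hlt.imp fun h => h.ne
    rw [hlps] at this
    exact this.of_map
  obtain ⟨φ', he, hn, hbags, ho, hdist⟩ := basicLoop_spec hk hα (l.map pt) hnd (by
    intro p hp
    rw [hmemps] at hp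
    exact ⟨hp, hc.mem_iff r (by simp) p
      (hk.gated.mem_of_betw hD hk.gated.gate_mem hα.1 hp)⟩)
  rw [← hlps] at hn hbags ho hdist
  have hbasic : TreeRecovery.basic o (toBag M φ r) (φ α) =
      ((basicLoop (toBag M φ r) (φ α) l o).1,
        chainEdges ((basicLoop (toBag M φ r) (φ α) l o).1.map Bag.rep),
        (basicLoop (toBag M φ r) (φ α) l o).2) := rfl
  rw [hbasic]
  simp only
  set R := basicLoop (toBag M φ r) (φ α) l o
  have hbags' : R.1 = ((l.map pt).map fun p => slice (treeDist M) r α p).map (toBag M φ') := by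
    rw [hbags, List.map_map (f := fun p => slice (treeDist M) r α p)]; rfl
  have hreps : R.1.map Bag.rep = l.map fun x => φ' (pt x) := by
    rw [hbags, List.map_map, List.map_map]; rfl
  have hpr : ∀ p, Betw (treeDist M) r.gate p α → p ∈ r.carrier := fun p hp =>
    hk.gated.mem_of_betw hD hk.gated.gate_mem hα.1 hp
  have hmemiff : ∀ p, Betw (treeDist M) r.gate p α → ∀ x ∈ (slice (treeDist M) r α p).carrier,
      x ∈ N ∪ {p | p ∈ l.map pt} ↔ x ∈ known M (slice (treeDist M) r α p) := by
    intro p hp x hx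
    rw [known_slice (hpr p hp), Set.mem_union, hc.mem_iff r (by simp) x hx.1,
      Set.mem_ofPred_eq, hmemps]
    constructor
    · rintro (h1 | h1)
      · exact Or.inr ⟨h1, hx⟩
      · exact Or.inl (slice_eq hD hp h1 hx (mem_slice_self hD hx.1)).symm
    · rintro (rfl | ⟨h1, -⟩)
      · exact Or.inr hp
      · exact Or.inl h1
  constructor
  · rw [hreps, hbags']
    refine hc.replace (r := r) (N' := N ∪ {p | p ∈ l.map pt}) (E' := pathEdges M r α) hS he
      Set.subset_union_left ?_ hn ho ?_ ?_ ?_ ?_ ?_ ?_ ?_ ?_ ?_ ?_ ?_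
    · rintro x (hx | hx)
      · exact Or.inl hx
      · exact Or.inr (hpr x ((hmemps x).1 hx))
    · intro r' hr'
      obtain ⟨p, hp, rfl⟩ := List.mem_map.1 hr'
      exact isGated_slice hD hk.gated hα.1 ((hmemps p).1 hp)
    · intro r' hr'
      obtain ⟨p, hp, rfl⟩ := List.mem_map.1 hr'
      exact slice_interior_subset hD
    · intro r' hr'
      obtain ⟨p, hp, rfl⟩ := List.mem_map.1 hr'
      exact hmemiff p ((hmemps p).1 hp)
    · intro r' hr'
      obtain ⟨p, hp, rfl⟩ := List.mem_map.1 hr'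
      exact hdist p hp
    · rw [List.pairwise_map]
      refine List.Pairwise.imp_of_mem (fun {p q} hp hq hne => ?_) hnd
      exact slice_interior_disjoint hD ((hmemps p).1 hp) ((hmemps q).1 hq) hne
    · rintro e ⟨h1, h2⟩
      exact ⟨h1, fun x hx => Or.inr ((hmemps x).2 (h2 x hx))⟩
    · intro e hee her
      induction e using Sym2.inductionOn with
      | _ x y =>
      have hxr := her x (by simp)
      have hyr := her y (by simp)
      obtain ⟨p, hp, hxp⟩ := exists_mem_slice hD α hxr
      obtain ⟨q, hq, hyq⟩ := exists_mem_slice hD α hyr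
      by_cases hpq : p = q
      · subst hpq
        refine Or.inr ⟨_, List.mem_map_of_mem ((hmemps p).2 hp), ?_⟩
        intro z hz
        rcases Sym2.mem_iff.1 hz with rfl | rfl
        · exact hxp
        · exact hyq
      · left
        -- Between different slices one passes through both projections. No vertex lies strictly
        -- inside an edge, so its ends are the projections themselves.
        have hdd := hD.dist_of_proj hp hq hxp.2.1 hxp.2.2 hyq.2.1 hyq.2.2 hpq
        obtain ⟨hxy, hb⟩ := adj_iff_treeDist M |>.1 hee
        have t1 := hD.triangle p q y
        have t2 := hD.triangle x p y
        have t3 := hD.triangle x p q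
        have t4 := hD.triangle x q y
        have hxe : p = x := by
          rcases hb p (by unfold Betw; linarith) with h1 | h1
          · exact h1
          · subst h1
            exact absurd (slice_eq hD hp hq (mem_slice_self hD hyr) hyq) hpq
        have hye : q = y := by
          rcases hb q (by unfold Betw; linarith) with h1 | h1
          · subst h1
            exact absurd (slice_eq hD hp hq hxp (mem_slice_self hD hxr)) hpq
          · exact h1
        subst hxe; subst hye
        refine ⟨hee, fun z hz => ?_⟩
        rcases Sym2.mem_iff.1 hz with rfl | rfl
        · exact hp
        · exact hq
    · intro x hx
      obtain ⟨p, hp, hxp⟩ := exists_mem_slice hD α hx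
      exact Or.inr ⟨_, List.mem_map_of_mem ((hmemps p).2 hp), hxp⟩
    · intro r' hr'
      obtain ⟨p, hp, rfl⟩ := List.mem_map.1 hr'
      exact hpr p ((hmemps p).1 hp)
    · intro r₁ h1 r₂ h2
      obtain ⟨p, hp, rfl⟩ := List.mem_map.1 h1
      obtain ⟨q, hq, rfl⟩ := List.mem_map.1 h2
      rintro ⟨h3, h4⟩
      have hp' := (hmemps p).1 hp
      exact h4 (slice_eq hD hp' ((hmemps q).1 hq) (mem_slice_self hD (hpr p hp')) h3)
    · exact coe_chainEdges l hlt pt hpt hpt' φ'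
  · intro b hb
    rw [hbags] at hb
    obtain ⟨p, hp, rfl⟩ := List.mem_map.1 hb
    have hp' := (hmemps p).1 hp
    have hmi : ∀ {c}, c ∈ (toBag M φ' (slice (treeDist M) r α p)).intr ↔
        ∃ i, M.label i ∈ (slice (treeDist M) r α p).interior ∧ c = Sum.inl i :=
      mem_intr_toBag hn ((known_slice (hpr p hp')).2 (Or.inl rfl))
        fun x hx => (hmemiff p hp' x hx.1).2 hx
    constructor
    · intro c hcm
      obtain ⟨i, hi, rfl⟩ := hmi.1 hcm
      exact (hc.mem_intr (r := r) (by simp)).2 ⟨i, slice_interior_subset hD hi, rfl⟩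
    · intro hcm
      obtain ⟨i, hi, hie⟩ := hmi.1 hcm
      have : α = M.label i := hc.naming.inj (hk.subset hα) (hc.naming.label_mem i)
        (hie.trans (hc.naming.label_eq i).symm)
      rw [← this] at hi
      exact hi.2 (slice_eq hD hp' (hD.betw_right _ _) hi.1 (mem_slice_self hD hα.1)).symm

/-! ## The procedure `explode` -/

open Classical in
/-- The labels in the same branch as `u` at `ρ`. -/
noncomputable def branchNodes (M : WeightedSemiLabeledTree V n) (ρ u : V) : Finset (Node n) :=
  (Finset.univ.filter fun i => ¬ Betw (treeDist M) u ρ (M.label i)).image Sum.inl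

/-- The strict inequality tested by `explode` says that the gate does not separate the two nodes.
This is an equivalence relation away from the gate (`not_betw_trans`), so each round removes a whole
class and `R` remains a union of classes, as `hcl` requires. -/
theorem explodeLoop_spec {φ : V → Node n} {N : Set V} {o : Oracle n} {r : Region V}
    (h : IsKnownRegion M φ N o r) (k : ℕ) (R : Finset (Node n)) (hk : R.card ≤ k)
    (hR : ∀ a ∈ R, ∃ v ∈ known M r, v ≠ r.gate ∧ φ v = a)
    (hcl : ∀ u ∈ known M r, φ u ∈ R → ∀ v ∈ known M r,
      ¬ Betw (treeDist M) u r.gate v → φ v ∈ R) :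
    ∃ us : List V, explodeLoop o (φ r.gate) k R =
        us.map (fun u => toBag M φ (branchRegion (treeDist M) r.gate u)) ∧
      (∀ u ∈ us, u ∈ known M r ∧ u ≠ r.gate ∧ φ u ∈ R) ∧
      us.Pairwise (fun u v => Betw (treeDist M) u r.gate v) ∧
      ∀ v ∈ known M r, φ v ∈ R → ∃ u ∈ us, ¬ Betw (treeDist M) u r.gate v := by
  have hD := isTreeMetric_treeDist M
  have hg : r.gate ∈ known M r := h.gated.gate_mem_known
  induction k generalizing R with
  | zero =>
    have : R = ∅ := by simpa using hk
    subst this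
    exact ⟨[], rfl, by simp, List.Pairwise.nil, by simp⟩
  | succ k ih =>
    by_cases hne : R.Nonempty
    · obtain ⟨u, hu, hug, huc⟩ := hR _ hne.choose_spec
      have huR : φ u ∈ R := huc ▸ hne.choose_spec
      classical
      set s := R.filter (fun v => o.dist (φ u) v < o.dist (φ u) (φ r.gate) +
        o.dist v (φ r.gate)) with hs
      have hunf : explodeLoop o (φ r.gate) (k + 1) R =
          ⟨insert (φ r.gate) s, φ r.gate⟩ :: explodeLoop o (φ r.gate) k (R \ s) := by
        rw [explodeLoop, dif_pos hne, ← huc, hs]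
      have hmem : ∀ v ∈ known M r, φ v ∈ R →
          (φ v ∈ s ↔ ¬ Betw (treeDist M) u r.gate v) := by
        intro v hv hvR
        rw [hs, Finset.mem_filter, h.dist u hu v hv, h.dist u hu _ hg, h.dist v hv _ hg]
        have := hD.triangle u r.gate v
        have := hD.symm v r.gate
        constructor
        · rintro ⟨-, h1⟩ h2
          unfold Betw at h2
          linarith
        · intro h1
          refine ⟨hvR, lt_of_le_of_ne (by linarith) fun h2 => h1 ?_⟩
          unfold Betw; linarith
      -- The chosen node passes its own test, so `R` shrinks and the bound on the number of rounds
      -- is never exhausted early.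
      have hus : φ u ∈ s := (hmem u hu huR).2 (hD.not_betw_self hug)
      obtain ⟨us, h1, h2, h3, h4⟩ := ih (R \ s) (by
          have : (R \ s).card < R.card := Finset.card_lt_card
            (Finset.sdiff_ssubset (Finset.filter_subset _ _) ⟨_, hus⟩)
          omega)
        (fun a ha => hR a (Finset.mem_sdiff.1 ha).1)
        (by
          intro w hw hwR v hv hwv
          rw [Finset.mem_sdiff] at hwR ⊢
          have hvR := hcl w hw hwR.1 v hv hwv
          refine ⟨hvR, fun hvs => hwR.2 ?_⟩
          rw [hmem v hv hvR] at hvs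
          rw [hmem w hw hwR.1]
          exact hD.not_betw_trans hvs fun hc => hwv (hD.betw_comm.1 hc))
      refine ⟨u :: us, ?_, ?_, ?_, ?_⟩
      · rw [hunf, h1, List.map_cons]
        congr 1
        unfold toBag
        rw [Bag.mk.injEq]
        refine ⟨?_, rfl⟩
        ext a
        simp only [Finset.mem_insert, Finset.mem_image, Finset.mem_filter, Finset.mem_univ,
          true_and]
        constructor
        · rintro (rfl | ha)
          · exact ⟨r.gate, ⟨Or.inl rfl, Or.inr rfl⟩, rfl⟩
          · obtain ⟨v, hv, hvg, rfl⟩ := hR a (Finset.mem_filter.1 ha).1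
            have := (hmem v hv (Finset.mem_filter.1 ha).1).1 ha
            exact ⟨v, ⟨Or.inr this, Or.inl (hv.2.resolve_right hvg)⟩, rfl⟩
        · rintro ⟨v, ⟨hv1 | hv1, hv2⟩, rfl⟩
          · exact Or.inl (by rw [hv1])
          · right
            have hvr := mem_carrier_of_not_betw h.gated hu.1 hv1
            have hvk : v ∈ known M r := ⟨hvr, hv2⟩
            exact (hmem v hvk (hcl u hu huR v hvk hv1)).2 hv1
      · intro w hw
        rcases List.mem_cons.1 hw with rfl | hw
        · exact ⟨hu, hug, huR⟩
        · obtain ⟨h5, h6, h7⟩ := h2 w hw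
          exact ⟨h5, h6, (Finset.mem_sdiff.1 h7).1⟩
      · refine List.pairwise_cons.2 ⟨fun w hw => ?_, h3⟩
        obtain ⟨h5, h6, h7⟩ := h2 w hw
        rw [Finset.mem_sdiff] at h7
        by_contra hcon
        exact h7.2 ((hmem w h5 h7.1).2 hcon)
      · intro v hv hvR
        by_cases hvs : φ v ∈ s
        · exact ⟨u, by simp, (hmem v hv hvR).1 hvs⟩
        · obtain ⟨w, hw, h5⟩ := h4 v hv (Finset.mem_sdiff.2 ⟨hvR, hvs⟩)
          exact ⟨w, by simp [hw], h5⟩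
    · rw [Finset.not_nonempty_iff_eq_empty] at hne
      subst hne
      refine ⟨[], ?_, by simp, List.Pairwise.nil, by simp⟩
      rw [explodeLoop, dif_neg (by simp)]
      rfl

/-- Nothing new is found; the region is only cut at its gate, and an edge at the gate goes to the
branch of its other end. Each interior is a complete branch of the whole tree, which laminarity uses
later, and it is non-empty, which the potential uses. -/
theorem Inv.explode {B : Bag n} {Q : List (Bag n)} {S : Skeleton n} {o : Oracle n}
    (h : Inv M (B :: Q) S o) :
    Inv M (explode o B ++ Q) S o ∧
      ∀ b ∈ explode o B, b.intr ⊆ B.intr ∧ b.intr.Nonempty ∧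
        ∃ p u, b.intr = branchNodes M p u := by
  classical
  obtain ⟨φ, N, rs, E, hc, hb, hS⟩ := h
  have hD := isTreeMetric_treeDist M
  obtain ⟨r, rs, rfl, rfl, rfl⟩ := List.map_eq_cons_iff.1 hb.symm
  have hk := hc.isKnownRegion (r := r) (by simp)
  have hg : r.gate ∈ known M r := hk.gated.gate_mem_known
  have hmemR : ∀ v ∈ known M r, φ v ∈ (toBag M φ r).nodes.erase (toBag M φ r).rep ↔
      v ≠ r.gate := by
    intro v hv
    rw [Finset.mem_erase, mem_toBag_nodes]
    constructor
    · rintro ⟨h1, -⟩ rfl; exact h1 rfl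
    · exact fun h1 => ⟨fun h2 => h1 (hc.naming.inj (hk.subset hv) (hk.subset hg) h2), v, hv, rfl⟩
  obtain ⟨us, h1, h2, h3, h4⟩ := explodeLoop_spec hk _
    ((toBag M φ r).nodes.erase (toBag M φ r).rep) le_rfl
    (by
      intro a ha
      obtain ⟨v, hv, rfl⟩ := mem_toBag_nodes.1 (Finset.mem_erase.1 ha).2
      exact ⟨v, hv, (hmemR v hv).1 ha, rfl⟩)
    (by
      intro u hu _ v hv huv
      rw [hmemR v hv]
      rintro rfl
      exact huv (hD.betw_right _ _))
  have hexp : TreeRecovery.explode o (toBag M φ r) =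
      (us.map (branchRegion (treeDist M) r.gate)).map (toBag M φ) := by
    rw [List.map_map]; exact h1
  have hint : ∀ u ∈ us, (branchRegion (treeDist M) r.gate u).interior ⊆ r.interior := by
    intro u hu x hx
    rw [mem_branchRegion_interior hD] at hx
    refine ⟨mem_carrier_of_not_betw hk.gated (h2 u hu).1.1 hx, ?_⟩
    rintro rfl
    exact hx (hD.betw_right _ _)
  have hmemiff : ∀ u ∈ us, ∀ x ∈ (branchRegion (treeDist M) r.gate u).carrier,
      x ∈ N ↔ x ∈ known M (branchRegion (treeDist M) r.gate u) := by
    intro u hu x hx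
    have hxr : x ∈ r.carrier := by
      rcases hx with rfl | hx
      · exact hg.1
      · exact mem_carrier_of_not_betw hk.gated (h2 u hu).1.1 hx
    rw [hc.mem_iff r (by simp) x hxr]
    exact ⟨fun h5 => ⟨hx, h5.2⟩, fun h5 => ⟨hxr, h5.2⟩⟩
  -- Beyond `x`, seen from the gate, there is a label in the same branch, so the branch of `x` is
  -- among those produced from known nodes.
  have hfind : ∀ x ∈ r.carrier, x ≠ r.gate → ∃ u ∈ us, ¬ Betw (treeDist M) u r.gate x := by
    intro x hx hxg
    obtain ⟨v, hv, hb⟩ := hD.exists_beyond (hasThirdBranch_treeDist M) r.gate x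
    have hxv : ¬ Betw (treeDist M) x r.gate v := by
      intro h5
      refine hxg (hD.eq_of_le ?_)
      have := hD.symm x r.gate
      unfold Betw at *; linarith
    have hvk : v ∈ known M r := ⟨mem_carrier_of_not_betw hk.gated hx hxv, Or.inl hv⟩
    obtain ⟨u, hu, huv⟩ := h4 v hvk ((hmemR v hvk).2 (by
      rintro rfl; exact hxv (hD.betw_right _ _)))
    exact ⟨u, hu, hD.not_betw_trans huv fun h5 => hxv (hD.betw_comm.1 h5)⟩
  constructor
  · have := hc.replace (φ' := φ) (r := r) (N' := N) (E' := ∅) (o' := o) (S' := ∅)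
      (rs' := us.map (branchRegion (treeDist M) r.gate)) hS
      (fun _ _ => rfl) subset_rfl Set.subset_union_left hc.naming (fun _ _ _ _ => rfl)
      (by
        intro r' hr'
        obtain ⟨u, hu, rfl⟩ := List.mem_map.1 hr'
        exact isGated_branchRegion hD _ _)
      (by
        intro r' hr'
        obtain ⟨u, hu, rfl⟩ := List.mem_map.1 hr'
        exact hint u hu)
      (by
        intro r' hr'
        obtain ⟨u, hu, rfl⟩ := List.mem_map.1 hr'
        exact hmemiff u hu)
      (by
        intro r' hr' x hx y hy
        obtain ⟨u, hu, rfl⟩ := List.mem_map.1 hr'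
        have hsub : ∀ z ∈ known M (branchRegion (treeDist M) r.gate u), z ∈ known M r :=
          fun z hz => by
            refine ⟨?_, hz.2⟩
            rcases hz.1 with rfl | h5
            · exact hg.1
            · exact mem_carrier_of_not_betw hk.gated (h2 u hu).1.1 h5
        exact hk.dist x (hsub x hx) y (hsub y hy))
      (by
        rw [List.pairwise_map]
        refine h3.imp fun {u v} huv => Set.disjoint_left.2 fun x hx hx' => ?_
        rw [mem_branchRegion_interior hD] at hx hx'
        exact hD.not_betw_trans hx (fun h5 => hx' (hD.betw_comm.1 h5)) huv)
      (by simp)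
      (by
        intro e hee her
        right
        induction e using Sym2.inductionOn with
        | _ x y =>
        have hxr := her x (by simp)
        have hyr := her y (by simp)
        have key : ∀ x y, M.graph.Adj x y → x ∈ r.carrier → x ≠ r.gate →
            ∃ r' ∈ us.map (branchRegion (treeDist M) r.gate), ∀ z ∈ s(x, y), z ∈ r'.carrier := by
          intro x y hxy hx hxg
          obtain ⟨u, hu, hux⟩ := hfind x hx hxg
          refine ⟨_, List.mem_map_of_mem hu, fun z hz => ?_⟩
          rcases Sym2.mem_iff.1 hz with rfl | rfl
          · exact Or.inr hux
          · by_cases hzg : z = r.gate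
            · exact Or.inl hzg
            · refine Or.inr (hD.not_betw_trans hux fun h5 => ?_)
              rcases ((adj_iff_treeDist M).1 hxy).2 _ h5 with h6 | h6
              · exact hxg h6.symm
              · exact hzg h6.symm
        by_cases hxg : x = r.gate
        · obtain ⟨r', h5, h6⟩ := key y x (SimpleGraph.Adj.symm hee) hyr
            (fun h5 => (SimpleGraph.Adj.ne hee) (hxg.trans h5.symm))
          exact ⟨r', h5, fun z hz => h6 z (by rwa [Sym2.eq_swap])⟩
        · exact key x y hee hxr hxg)
      (by
        intro x hx
        by_cases hxg : x = r.gate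
        · subst hxg; exact Or.inl (hk.subset hg)
        · obtain ⟨u, hu, hux⟩ := hfind x hx hxg
          exact Or.inr ⟨_, List.mem_map_of_mem hu, Or.inr hux⟩)
      (by
        intro r' hr'
        obtain ⟨u, hu, rfl⟩ := List.mem_map.1 hr'
        exact hg.1)
      (by
        intro r₁ h5 r₂ h6
        obtain ⟨u, hu, rfl⟩ := List.mem_map.1 h5
        obtain ⟨v, hv, rfl⟩ := List.mem_map.1 h6
        exact fun h7 => h7.2 rfl)
      (by simp)
    rw [hexp]
    simpa using this
  · intro b hb
    rw [hexp] at hb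
    obtain ⟨r', hr', rfl⟩ := List.mem_map.1 hb
    obtain ⟨u, hu, rfl⟩ := List.mem_map.1 hr'
    have hmi : ∀ {c}, c ∈ (toBag M φ (branchRegion (treeDist M) r.gate u)).intr ↔
        ∃ i, M.label i ∈ (branchRegion (treeDist M) r.gate u).interior ∧ c = Sum.inl i :=
      mem_intr_toBag hc.naming (isGated_branchRegion hD _ _).gate_mem_known
        fun x hx => (hmemiff u hu x hx.1).2 hx
    refine ⟨?_, ?_, r.gate, u, ?_⟩
    · intro c hcm
      obtain ⟨i, hi, rfl⟩ := hmi.1 hcm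
      exact (hc.mem_intr (r := r) (by simp)).2 ⟨i, hint u hu hi, rfl⟩
    · obtain ⟨hu1, hu2, -⟩ := h2 u hu
      obtain ⟨i, rfl⟩ := hu1.2.resolve_right hu2
      exact ⟨Sum.inl i, hmi.2 ⟨i, (mem_branchRegion_interior hD).2 (hD.not_betw_self hu2), rfl⟩⟩
    · ext c
      rw [hmi]
      simp only [mem_branchRegion_interior hD, branchNodes, Finset.mem_image, Finset.mem_filter,
        Finset.mem_univ, true_and]
      constructor
      · rintro ⟨i, hi, rfl⟩; exact ⟨i, hi, rfl⟩
      · rintro ⟨i, hi, rfl⟩; exact ⟨i, hi, rfl⟩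

end

end TreeRecovery

/-! ## Small bags -/

theorem Sym2.map_eq_self {α : Type*} {f : α → α} {e : Sym2 α} (h : ∀ x ∈ e, f x = x) :
    Sym2.map f e = e := by
  induction e using Sym2.inductionOn with
  | _ x y => rw [Sym2.map_mk, h x (by simp), h y (by simp)]

theorem IsTreeMetric.restrict {V : Type*} {D : V → V → ℝ} (hD : IsTreeMetric D) {C : Set V}
    (hC : ∀ x ∈ C, ∀ y ∈ C, ∀ z, Betw D x z y → z ∈ C) :
    IsTreeMetric fun x y : C => D x y where
  self u := hD.self u
  symm u v := hD.symm u v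
  pos u v h := hD.pos u v fun e => h (Subtype.ext e)
  triangle u v w := hD.triangle u v w
  median u v w := by
    obtain ⟨m, h1, h2, h3⟩ := hD.median u v w
    exact ⟨⟨m, hC u u.2 v v.2 m h1⟩, h1, h2, h3⟩
  branch u m v h y := hD.branch u m v h y

namespace TreeRecovery

section

variable {V : Type*} [Fintype V] {n : ℕ} {M : WeightedSemiLabeledTree V n}

theorem isTreeMetric_region {r : Region V} (hr : r.IsGated (treeDist M)) :
    IsTreeMetric fun x y : r.carrier => treeDist M x y :=
  (isTreeMetric_treeDist M).restrict fun _ hx _ hy _ hz =>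
    hr.mem_of_betw (isTreeMetric_treeDist M) hx hy hz

/-- If the label in a third branch lies outside the region, the gate is on the way to it and can
replace it. -/
theorem hasThirdBranch_region {r : Region V} (hr : r.IsGated (treeDist M)) :
    HasThirdBranch (fun x y : r.carrier => treeDist M x y)
      (Set.range fun x : known M r => (⟨x, x.2.1⟩ : r.carrier)) := by
  have hD := isTreeMetric_treeDist M
  rintro ⟨p, hpr⟩ hp ⟨u, hu⟩ ⟨w, hw⟩
  have hpk : p ∉ known M r := fun hc => hp ⟨⟨p, hc⟩, rfl⟩
  obtain ⟨v, hv, h1, h2⟩ := hasThirdBranch_treeDist M p (fun hc => hpk ⟨hpr, Or.inl hc⟩) u w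
  by_cases hvr : v ∈ r.carrier
  · exact ⟨⟨v, hvr⟩, ⟨⟨v, hvr, Or.inl hv⟩, rfl⟩, h1, h2⟩
  · refine ⟨⟨r.gate, hr.gate_mem⟩, ⟨⟨r.gate, hr.gate_mem_known⟩, rfl⟩, ?_⟩
    have h3 := hr.betw p hpr v hvr
    have s1 := hD.symm v p
    have s2 := hD.symm p r.gate
    have s3 := hD.symm v r.gate
    have key : ∀ z, Betw (treeDist M) v p z → Betw (treeDist M) r.gate p z := by
      intro z hz
      have := hD.triangle v r.gate z
      have := hD.triangle r.gate p z
      unfold Betw at *; linarith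
    exact ⟨key u h1, key w h2⟩

/-- The edges of a region. -/
def regionEdges (M : WeightedSemiLabeledTree V n) (r : Region V) : Set (Sym2 V) :=
  {e | e ∈ M.graph.edgeSet ∧ ∀ x ∈ e, x ∈ r.carrier}

theorem isTree_induce_region {r : Region V} (hr : r.IsGated (treeDist M)) :
    (M.graph.induce r.carrier).IsTree := by
  have hD := isTreeMetric_treeDist M
  have : Nonempty r.carrier := ⟨⟨r.gate, hr.gate_mem⟩⟩
  refine ⟨⟨fun x y => ?_⟩, M.isTree.isAcyclic.induce _⟩
  obtain ⟨p, hp, -⟩ := M.isTree.existsUnique_path x y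
  exact ⟨p.induce r.carrier fun z hz => hr.mem_of_betw hD x.2 y.2
    (M.isTree.pathDist_of_mem_support M.len hp hz)⟩

theorem exists_edge_of_mem_image {r : Region V} {φ : V → Node n} (hφ : Set.InjOn φ r.carrier)
    {x : V} (hx : x ∈ r.carrier) {b : Node n}
    (h : s(φ x, b) ∈ Sym2.map φ '' regionEdges M r) :
    ∃ y ∈ r.carrier, φ y = b ∧ M.graph.Adj x y := by
  obtain ⟨e, ⟨he, her⟩, hee⟩ := h
  induction e using Sym2.inductionOn with
  | _ u v =>
  have hu := her u (by simp)
  have hv := her v (by simp)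
  rw [Sym2.map_mk, Sym2.eq_iff] at hee
  rcases hee with ⟨h1, h2⟩ | ⟨h1, h2⟩
  · obtain rfl := hφ hu hx h1
    exact ⟨v, hv, h2, he⟩
  · obtain rfl := hφ hv hx h2
    exact ⟨u, hu, h1, SimpleGraph.Adj.symm he⟩

theorem exists_walk_of_walk_image {r : Region V} {φ : V → Node n} (hφ : Set.InjOn φ r.carrier)
    {a b : Node n}
    (p : (SimpleGraph.fromEdgeSet (Sym2.map φ '' regionEdges M r)).Walk a b) :
    ∀ x ∈ r.carrier, φ x = a → ∃ y, ∃ q : M.graph.Walk x y, φ y = b ∧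
      p.support = q.support.map φ ∧ p.edges = q.edges.map (Sym2.map φ) ∧
      ∀ z ∈ q.support, z ∈ r.carrier := by
  induction p with
  | nil =>
    intro x hx hxa
    exact ⟨x, SimpleGraph.Walk.nil, hxa, by simp [hxa], by simp, by simpa using hx⟩
  | cons h p ih =>
    rintro x hx rfl
    obtain ⟨z, hz, rfl, hxz⟩ := exists_edge_of_mem_image hφ hx
      ((SimpleGraph.fromEdgeSet_adj _).1 h).1
    obtain ⟨y, q, h1, h2, h3, h4⟩ := ih z hz rfl
    refine ⟨y, SimpleGraph.Walk.cons hxz q, h1, by simp [h2], by simp [h3], ?_⟩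
    intro w hw
    rw [SimpleGraph.Walk.support_cons, List.mem_cons] at hw
    rcases hw with rfl | hw
    · exact hx
    · exact h4 w hw

/-- The region itself, with fresh names for its unknown vertices, is a solution. Hence
`fullSkeleton` does not fall back on its default value. -/
theorem exists_isInducedTree {φ : V → Node n} {N : Set V} {o : Oracle n} {r : Region V}
    (hk : IsKnownRegion M φ N o r) :
    ∃ q : Skeleton n × ℕ, o.next ≤ q.2 ∧
      IsInducedTree o.dist (toBag M φ r).nodes o.next q.2 q.1 := by
  classical
  have hD := isTreeMetric_treeDist M
  have hne : Nonempty V := ⟨r.gate⟩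
  -- An enumeration of `V` shifted by `o.next` gives distinct names, different from all names in
  -- use.
  set φ' : V → Node n := fun x => if x ∈ known M r then φ x else
    Sum.inr (o.next + Fintype.equivFin V x) with hφ'
  have hφk : ∀ x ∈ known M r, φ' x = φ x := fun x hx => if_pos hx
  have hφn : ∀ x ∉ known M r, φ' x = Sum.inr (o.next + Fintype.equivFin V x) :=
    fun x hx => if_neg hx
  have hinj : Set.InjOn φ' r.carrier := by
    intro x hx y hy hxy
    by_cases hxk : x ∈ known M r <;> by_cases hyk : y ∈ known M r
    · rw [hφk x hxk, hφk y hyk] at hxy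
      exact hk.naming.inj (hk.subset hxk) (hk.subset hyk) hxy
    · rw [hφk x hxk, hφn y hyk] at hxy
      have := hk.naming.fresh x (hk.subset hxk) _ hxy
      omega
    · rw [hφn x hxk, hφk y hyk] at hxy
      have := hk.naming.fresh y (hk.subset hyk) _ hxy.symm
      omega
    · rw [hφn x hxk, hφn y hyk] at hxy
      have h1 := Sum.inr.inj hxy
      have h2 : (Fintype.equivFin V x : ℕ) = Fintype.equivFin V y := by omega
      exact (Fintype.equivFin V).injective (Fin.ext h2)
  set S : Skeleton n := (Set.toFinite (Sym2.map φ' '' regionEdges M r)).toFinset with hS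
  have hSc : (S : Set (Sym2 (Node n))) = Sym2.map φ' '' regionEdges M r := by simp [hS]
  have hSm : ∀ e, e ∈ S ↔ e ∈ Sym2.map φ' '' regionEdges M r := by
    intro e; rw [← hSc]; rfl
  set U : Finset (Node n) := (Finset.univ.filter (· ∈ r.carrier)).image φ' with hU
  have hUm : ∀ a, a ∈ U ↔ ∃ x ∈ r.carrier, φ' x = a := by intro a; simp [hU]
  have hR : ∀ a, a ∈ (toBag M φ r).nodes ↔ ∃ x ∈ known M r, φ' x = a := by
    intro a
    rw [mem_toBag_nodes]
    constructor
    · rintro ⟨x, hx, rfl⟩; exact ⟨x, hx, hφk x hx⟩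
    · rintro ⟨x, hx, rfl⟩; exact ⟨x, hx, (hφk x hx).symm⟩
  have hadj : ∀ x ∈ r.carrier, ∀ b,
      (SimpleGraph.fromEdgeSet (S : Set (Sym2 (Node n)))).Adj (φ' x) b ↔
        ∃ y ∈ r.carrier, φ' y = b ∧ M.graph.Adj x y := by
    intro x hx b
    rw [SimpleGraph.fromEdgeSet_adj, hSc]
    constructor
    · rintro ⟨h1, -⟩; exact exists_edge_of_mem_image hinj hx h1
    · rintro ⟨y, hy, rfl, hxy⟩
      refine ⟨⟨s(x, y), ⟨hxy, ?_⟩, rfl⟩, fun h => hxy.ne (hinj hx hy h)⟩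
      intro z hz
      rcases Sym2.mem_iff.1 hz with rfl | rfl
      · exact hx
      · exact hy
  have hψ : ∀ x ∈ r.carrier, Function.invFunOn φ' r.carrier (φ' x) = x :=
    fun x hx => hinj.leftInvOn_invFunOn hx
  refine ⟨(S, o.next + Fintype.card V), by simp, U, ?_, ?_, ?_, ?_,
    fun e => M.len (Sym2.map (Function.invFunOn φ' r.carrier) e), ?_, ?_⟩
  · intro a ha
    obtain ⟨x, hx, rfl⟩ := (hR a).1 ha
    exact (hUm _).2 ⟨x, hx.1, rfl⟩
  · intro e he
    obtain ⟨e, ⟨h1, h2⟩, rfl⟩ := (hSm e).1 he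
    constructor
    · induction e using Sym2.inductionOn with
      | _ u v =>
      rw [Sym2.map_mk, Sym2.mk_isDiag_iff]
      exact fun h => (SimpleGraph.Adj.ne h1) (hinj (h2 u (by simp)) (h2 v (by simp)) h)
    · intro a ha
      obtain ⟨x, hx, rfl⟩ := Sym2.mem_map.1 ha
      exact (hUm _).2 ⟨x, h2 x hx, rfl⟩
  · have e : M.graph.induce r.carrier ≃g (SimpleGraph.fromEdgeSet
        (S : Set (Sym2 (Node n)))).induce (U : Set (Node n)) :=
      { toEquiv := Equiv.ofBijective
          (fun x : r.carrier => (⟨φ' x, (hUm _).2 ⟨x, x.2, rfl⟩⟩ : (U : Set (Node n))))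
          ⟨fun x y hxy => Subtype.ext (hinj x.2 y.2 (congrArg Subtype.val hxy)), by
            rintro ⟨a, ha⟩
            obtain ⟨x, hx, rfl⟩ := (hUm a).1 ha
            exact ⟨⟨x, hx⟩, rfl⟩⟩
        map_rel_iff' := by
          rintro ⟨x, hx⟩ ⟨y, hy⟩
          change (SimpleGraph.fromEdgeSet (S : Set (Sym2 (Node n)))).Adj (φ' x) (φ' y) ↔
            M.graph.Adj x y
          rw [hadj x hx]
          constructor
          · rintro ⟨z, hz, h1, h2⟩; exact hinj hz hy h1 ▸ h2
          · exact fun h => ⟨y, hy, rfl, h⟩ }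
    exact e.isTree_iff.1 (isTree_induce_region hk.gated)
  · intro a ha haR
    obtain ⟨x, hx, rfl⟩ := (hUm a).1 ha
    have hxk : x ∉ known M r := fun hc => haR ((hR _).2 ⟨x, hc, rfl⟩)
    refine ⟨⟨_, ?_, ?_, hφn x hxk⟩, ?_⟩
    · omega
    · have := (Fintype.equivFin V x).2
      simp
    -- A vertex other than the gate has no neighbour outside the region, so a latent one keeps its
    -- full degree in the induced tree.
    · have hnb : ∀ y ∈ M.graph.neighborSet x, y ∈ r.carrier := by
        intro y hy
        by_contra hcon
        rcases ((adj_iff_treeDist M).1 hy).2 _ (hk.gated.betw x hx y hcon) with h1 | h1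
        · exact hxk ⟨hx, Or.inr h1.symm⟩
        · exact hcon (h1 ▸ hk.gated.gate_mem)
      have : (SimpleGraph.fromEdgeSet (S : Set (Sym2 (Node n)))).neighborSet (φ' x) =
          φ' '' M.graph.neighborSet x := by
        ext b
        rw [SimpleGraph.mem_neighborSet, hadj x hx]
        constructor
        · rintro ⟨y, -, h1, h2⟩; exact ⟨y, h2, h1⟩
        · rintro ⟨y, h1, h2⟩; exact ⟨y, hnb y h1, h2, h1⟩
      rw [this, (hinj.mono hnb).ncard_image]
      exact M.three_le_degree x fun hc => hxk ⟨hx, Or.inl hc⟩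
  · intro e he
    obtain ⟨e, ⟨h1, h2⟩, rfl⟩ := (hSm e).1 he
    change 0 < M.len (Sym2.map _ (Sym2.map φ' e))
    rw [Sym2.map_map, Sym2.map_eq_self (f := Function.invFunOn φ' r.carrier ∘ φ')
      fun x hx => hψ x (h2 x hx)]
    exact M.len_pos e h1
  · intro a ha b hb p hp
    obtain ⟨x, hx, rfl⟩ := (hR a).1 ha
    obtain ⟨y, hy, rfl⟩ := (hR b).1 hb
    have hd : o.dist (φ' x) (φ' y) = treeDist M x y := by
      rw [hφk x hx, hφk y hy, hk.dist x hx y hy]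
    rw [hd]
    have hex : ∀ p : (SimpleGraph.fromEdgeSet (S : Set (Sym2 (Node n)))).Walk (φ' x) (φ' y),
        p.IsPath → ∃ q : M.graph.Walk x y, q.IsPath ∧ p.edges = q.edges.map (Sym2.map φ') ∧
        ∀ z ∈ q.support, z ∈ r.carrier := by
      rw [hSc]
      intro p hp
      obtain ⟨y', q, h1, h2, h3, h4⟩ := exists_walk_of_walk_image hinj p x hx.1 rfl
      obtain rfl := hinj (h4 _ q.end_mem_support) hy.1 h1
      refine ⟨q, ?_, h3, h4⟩
      rw [SimpleGraph.Walk.isPath_def] at hp ⊢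
      rw [h2] at hp
      exact hp.of_map
    obtain ⟨q, hq, h3, h4⟩ := hex p hp
    rw [treeDist, M.isTree.pathDist_eq M.len hq, h3, List.map_map]
    congr 1
    refine List.map_congr_left fun e he => ?_
    rw [Function.comp_apply, Sym2.map_map,
      Sym2.map_eq_self (f := Function.invFunOn φ' r.carrier ∘ φ') fun z hz =>
      hψ z (h4 z (SimpleGraph.Walk.mem_support_of_mem_edges he hz))]

/-- The vertices of an induced tree are those of the region, up to names. -/
theorem exists_equiv_of_isInducedTree {φ : V → Node n} {N : Set V} {o : Oracle n} {r : Region V}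
    (hk : IsKnownRegion M φ N o r) {hi : ℕ} {S : Skeleton n}
    (h : IsInducedTree o.dist (toBag M φ r).nodes o.next hi S) :
    ∃ F : V → Node n, (∀ x ∈ known M r, F x = φ x) ∧ Set.InjOn F r.carrier ∧
      (∀ x ∈ r.carrier, x ∉ known M r → ∃ m, o.next ≤ m ∧ m < hi ∧ F x = Sum.inr m) ∧
      (S : Set (Sym2 (Node n))) = Sym2.map F '' regionEdges M r := by
  classical
  obtain ⟨U, hRU, hSU, htree, hdeg, ℓ, hℓ, hdist⟩ := h
  set G := SimpleGraph.fromEdgeSet (S : Set (Sym2 (Node n))) with hG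
  set G₂ := G.induce (U : Set (Node n)) with hG₂
  have hD := isTreeMetric_treeDist M
  have hGS : ∀ a b, G.Adj a b ↔ s(a, b) ∈ S := by
    intro a b
    rw [hG, SimpleGraph.fromEdgeSet_adj, Finset.mem_coe]
    exact ⟨fun h => h.1, fun h => ⟨h, fun e => (hSU _ h).1 (by simpa using e)⟩⟩
  set ℓ₂ : Sym2 (U : Set (Node n)) → ℝ := fun e => ℓ (Sym2.map Subtype.val e) with hℓ₂def
  have hℓ₂ : ∀ e ∈ G₂.edgeSet, 0 < ℓ₂ e := by
    intro e he
    induction e using Sym2.inductionOn with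
    | _ a b => exact hℓ _ ((hGS _ _).1 he)
  have hD₂ := htree.isTreeMetric_pathDist hℓ₂
  have hRk : ∀ x : known M r, φ x ∈ U := fun x => hRU (mem_toBag_nodes.2 ⟨x, x.2, rfl⟩)
  have ht₂ : HasThirdBranch (htree.pathDist ℓ₂)
      (Set.range fun x : known M r => (⟨φ x, hRk x⟩ : (U : Set (Node n)))) := by
    refine htree.hasThirdBranch_pathDist hℓ₂ ?_
    rintro ⟨a, ha⟩ haR
    have haR' : a ∉ (toBag M φ r).nodes := by
      intro hc
      obtain ⟨x, hx, rfl⟩ := mem_toBag_nodes.1 hc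
      exact haR ⟨⟨x, hx⟩, rfl⟩
    have h3 := (hdeg a ha haR').2
    have : G.neighborSet a = Subtype.val '' G₂.neighborSet ⟨a, ha⟩ := by
      ext b
      constructor
      · intro hb
        have hbU : b ∈ U := (hSU _ ((hGS a b).1 hb)).2 b (by simp)
        exact ⟨⟨b, hbU⟩, hb, rfl⟩
      · rintro ⟨b, hb, rfl⟩; exact hb
    rw [this, Set.ncard_image_of_injective _ Subtype.val_injective] at h3
    exact h3
  have hdd : ∀ x y : known M r, treeDist M x y =
      htree.pathDist ℓ₂ ⟨φ x, hRk x⟩ ⟨φ y, hRk y⟩ := by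
    intro x y
    obtain ⟨p, hp, -⟩ := htree.existsUnique_path ⟨φ x, hRk x⟩ ⟨φ y, hRk y⟩
    let f : G₂ →g G := (SimpleGraph.Embedding.induce (U : Set (Node n))).toHom
    have hp' : (p.map f).IsPath := hp.map Subtype.val_injective
    have h1 := (hdist (φ x) (mem_toBag_nodes.2 ⟨x, x.2, rfl⟩) (φ y)
      (mem_toBag_nodes.2 ⟨y, y.2, rfl⟩) _ hp').trans
      (congrArg (fun l => (l.map ℓ).sum) (SimpleGraph.Walk.edges_map f p))
    rw [hk.dist x x.2 y y.2, List.map_map] at h1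
    rw [h1, htree.pathDist_eq ℓ₂ hp]
    rfl
  -- The region and the given solution are both tree metrics with third branches relative to the
  -- known vertices, on which they agree. Uniqueness then matches them.
  obtain ⟨F, hF, hFd⟩ := (isTreeMetric_region hk.gated).exists_isometry hD₂
    (fun x : known M r => (⟨x, x.2.1⟩ : r.carrier))
    (fun x : known M r => (⟨φ x, hRk x⟩ : (U : Set (Node n))))
    (hasThirdBranch_region hk.gated) ht₂ hdd
  -- The isometry preserves betweenness, hence adjacency. The vertices between two vertices of the
  -- region stay in it by convexity.
  have hFadj : ∀ x y : r.carrier, M.graph.Adj x y ↔ s((F x : Node n), (F y : Node n)) ∈ S := by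
    intro x y
    rw [← hGS]
    change _ ↔ G₂.Adj (F x) (F y)
    rw [adj_iff_treeDist, htree.adj_iff_forall_betw hℓ₂]
    have hb : ∀ z, Betw (htree.pathDist ℓ₂) (F x) (F z) (F y) ↔ Betw (treeDist M) x z y := by
      intro z; unfold Betw; rw [hFd, hFd, hFd]
    constructor
    · rintro ⟨h1, h2⟩
      refine ⟨fun he => h1 (congrArg Subtype.val (F.injective he)), fun w hw => ?_⟩
      obtain ⟨z, rfl⟩ := F.surjective w
      rw [hb] at hw
      rcases h2 z hw with h3 | h3
      · exact Or.inl (congrArg F (Subtype.ext h3))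
      · exact Or.inr (congrArg F (Subtype.ext h3))
    · rintro ⟨h1, h2⟩
      refine ⟨fun he => h1 (congrArg F (Subtype.ext he)), fun w hw => ?_⟩
      have hwr := hk.gated.mem_of_betw hD x.2 y.2 hw
      rcases h2 (F ⟨w, hwr⟩) ((hb ⟨w, hwr⟩).2 hw) with h3 | h3
      · exact Or.inl (congrArg Subtype.val (F.injective h3))
      · exact Or.inr (congrArg Subtype.val (F.injective h3))
  set F' : V → Node n := fun x => if hx : x ∈ r.carrier then (F ⟨x, hx⟩ : Node n) else φ x
  have hF' : ∀ x (hx : x ∈ r.carrier), F' x = F ⟨x, hx⟩ := fun x hx => dif_pos hx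
  refine ⟨F', ?_, ?_, ?_, ?_⟩
  · intro x hx
    rw [hF' x hx.1]
    exact congrArg Subtype.val (hF ⟨x, hx⟩)
  · intro x hx y hy hxy
    rw [hF' x hx, hF' y hy] at hxy
    exact congrArg Subtype.val (F.injective (Subtype.ext hxy))
  · intro x hx hxk
    rw [hF' x hx]
    refine (hdeg _ (F ⟨x, hx⟩).2 fun hc => hxk ?_).1
    obtain ⟨y, hy, hyF⟩ := mem_toBag_nodes.1 hc
    have h1 := hF ⟨y, hy⟩
    have h2 : F ⟨y, hy.1⟩ = F ⟨x, hx⟩ := by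
      rw [h1]; exact Subtype.ext hyF
    have h3 : y = x := congrArg Subtype.val (F.injective h2)
    exact h3 ▸ hy
  · ext e
    rw [Finset.mem_coe]
    constructor
    · intro he
      induction e using Sym2.inductionOn with
      | _ a b =>
      obtain ⟨x, hx⟩ := F.surjective ⟨a, (hSU _ he).2 a (by simp)⟩
      obtain ⟨y, hy⟩ := F.surjective ⟨b, (hSU _ he).2 b (by simp)⟩
      have hxa : (F x : Node n) = a := congrArg Subtype.val hx
      have hyb : (F y : Node n) = b := congrArg Subtype.val hy
      refine ⟨s(x, y), ⟨(hFadj x y).2 (by rwa [hxa, hyb]), ?_⟩, ?_⟩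
      · intro z hz
        rcases Sym2.mem_iff.1 hz with rfl | rfl
        · exact x.2
        · exact y.2
      · rw [Sym2.map_mk, hF' x x.2, hF' y y.2, hxa, hyb]
    · rintro ⟨e, ⟨h1, h2⟩, rfl⟩
      induction e using Sym2.inductionOn with
      | _ x y =>
      have hx := h2 x (by simp)
      have hy := h2 y (by simp)
      rw [Sym2.map_mk, hF' x hx, hF' y hy]
      exact (hFadj ⟨x, hx⟩ ⟨y, hy⟩).1 h1

theorem Inv.fullSkeleton {B : Bag n} {Q : List (Bag n)} {S : Skeleton n} {o : Oracle n}
    (h : Inv M (B :: Q) S o) :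
    Inv M Q (S ∪ (fullSkeleton o B.nodes).1) ⟨o.dist, (fullSkeleton o B.nodes).2⟩ := by
  classical
  obtain ⟨φ, N, rs, E, hc, hb, hS⟩ := h
  obtain ⟨r, rs, rfl, rfl, rfl⟩ := List.map_eq_cons_iff.1 hb.symm
  have hk := hc.isKnownRegion (r := r) (by simp)
  have hex := exists_isInducedTree hk
  have hfull : TreeRecovery.fullSkeleton o (toBag M φ r).nodes = hex.choose := by
    rw [TreeRecovery.fullSkeleton, dif_pos hex]
  rw [hfull]
  obtain ⟨hlo, hind⟩ := hex.choose_spec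
  set q := hex.choose
  obtain ⟨F, hFk, hFi, hFn, hFS⟩ := exists_equiv_of_isInducedTree hk hind
  set φ' : V → Node n := fun x => if x ∈ r.carrier then F x else φ x with hφ'
  have hφr : ∀ x ∈ r.carrier, φ' x = F x := fun x hx => if_pos hx
  have hmem := hc.mem_iff r (by simp)
  have hφN : Set.EqOn φ' φ N := by
    intro x hx
    by_cases hxr : x ∈ r.carrier
    · rw [hφr x hxr]; exact hFk x ((hmem x hxr).1 hx)
    · exact if_neg hxr
  have hnew : ∀ x ∈ N ∪ r.carrier, x ∉ N →
      ∃ m, o.next ≤ m ∧ m < q.2 ∧ φ' x = Sum.inr m := by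
    intro x hx hxN
    have hxr := hx.resolve_left hxN
    rw [hφr x hxr]
    exact hFn x hxr fun hc => hxN ((hmem x hxr).2 hc)
  -- The region is found completely and replaced by no region. Distances to the new names are
  -- therefore never needed, and the oracle may leave them undefined.
  have := hc.replace (φ' := φ') (r := r) (N' := N ∪ r.carrier) (E' := regionEdges M r)
    (o' := ⟨o.dist, q.2⟩) (S' := q.1) (rs' := []) hS hφN Set.subset_union_left subset_rfl
    ⟨by
      intro x hx y hy hxy
      by_cases hxN : x ∈ N <;> by_cases hyN : y ∈ N
      · rw [hφN hxN, hφN hyN] at hxy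
        exact hc.naming.inj hxN hyN hxy
      · obtain ⟨m, h1, h2, h3⟩ := hnew y hy hyN
        rw [hφN hxN, h3] at hxy
        have := hc.naming.fresh x hxN m hxy
        omega
      · obtain ⟨m, h1, h2, h3⟩ := hnew x hx hxN
        rw [hφN hyN, h3] at hxy
        have := hc.naming.fresh y hyN m hxy.symm
        omega
      · have hxr := hx.resolve_left hxN
        have hyr := hy.resolve_left hyN
        rw [hφr x hxr, hφr y hyr] at hxy
        exact hFi hxr hyr hxy,
    fun i => Or.inl (hc.naming.label_mem i),
    fun i => by rw [hφN (hc.naming.label_mem i), hc.naming.label_eq],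
    by
      intro x hx m hm
      by_cases hxN : x ∈ N
      · rw [hφN hxN] at hm
        exact (hc.naming.fresh x hxN m hm).trans_le hlo
      · obtain ⟨m', h1, h2, h3⟩ := hnew x hx hxN
        rw [h3] at hm
        obtain rfl := Sum.inr.inj hm
        exact h2⟩
    (fun _ _ _ _ => rfl) (by simp) (by simp) (by simp) (by simp) (by simp)
    (fun e he => ⟨he.1, fun x hx => Or.inr (he.2 x hx)⟩)
    (fun e he her => Or.inl ⟨he, her⟩) (fun x hx => Or.inl (Or.inr hx)) (by simp) (by simp)
    (by
      rw [hFS]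
      refine Set.image_congr fun e he => ?_
      exact Sym2.map_congr fun x hx => (hφr x (he.2 x hx)).symm)
  simpa using this

end

end TreeRecovery

/-! ### Hitting sets of laminar families. -/

/-- A laminar family of large subsets of a finite set can be hit by few points. -/
theorem Finset.exists_hitting_set {α : Type*} [DecidableEq α] (F : Finset (Finset α))
    (I : Finset α) (m k : ℕ) (hm : 0 < m) (hI : I.card < m * (k + 1))
    (hF : ∀ A ∈ F, A ⊆ I ∧ m ≤ A.card)
    (hlam : ∀ A ∈ F, ∀ B ∈ F, Disjoint A B ∨ A ⊆ B ∨ B ⊆ A) :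
    ∃ H ⊆ I, H.card ≤ k ∧ ∀ A ∈ F, ∃ a ∈ A, a ∈ H := by
  classical
  -- The minimal members of a laminar family are disjoint, so by their size there are at most `k` of
  -- them. Every member contains a minimal one, so one point from each minimal member suffices.
  set Fm := F.filter fun A => ∀ B ∈ F, B ⊆ A → B = A with hFm
  have hne : ∀ A ∈ F, A.Nonempty := fun A hA =>
    Finset.card_pos.1 (hm.trans_le (hF A hA).2)
  have hdisj : (Fm : Set (Finset α)).PairwiseDisjoint id := by
    intro A hA B hB hAB
    have hA' := Finset.mem_filter.1 hA
    have hB' := Finset.mem_filter.1 hB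
    rcases hlam A hA'.1 B hB'.1 with h | h | h
    · exact h
    · exact absurd (hB'.2 A hA'.1 h) hAB
    · exact absurd (hA'.2 B hB'.1 h).symm hAB
  have hcard : Fm.card * m ≤ I.card := by
    calc Fm.card * m ≤ ∑ A ∈ Fm, A.card := by
          rw [← smul_eq_mul]
          exact Finset.card_nsmul_le_sum _ _ _ fun A hA => (hF A (Finset.mem_filter.1 hA).1).2
      _ = (Fm.biUnion id).card := (Finset.card_biUnion hdisj).symm
      _ ≤ I.card := Finset.card_le_card (Finset.biUnion_subset.2 fun A hA =>
          (hF A (Finset.mem_filter.1 hA).1).1)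
  have hk : Fm.card ≤ k := by
    by_contra hcon
    have : m * (k + 1) ≤ Fm.card * m := by
      rw [mul_comm]; exact Nat.mul_le_mul_right m (by omega)
    omega
  refine ⟨Fm.biUnion fun A => if h : A.Nonempty then {h.choose} else ∅, ?_, ?_, ?_⟩
  · refine Finset.biUnion_subset.2 fun A hA => ?_
    have hAF := (Finset.mem_filter.1 hA).1
    rw [dif_pos (hne A hAF), Finset.singleton_subset_iff]
    exact (hF A hAF).1 (hne A hAF).choose_spec
  · refine (Finset.card_biUnion_le_card_mul _ _ 1 fun A hA => ?_).trans (by simpa using hk)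
    have hAF := (Finset.mem_filter.1 hA).1
    rw [dif_pos (hne A hAF), Finset.card_singleton]
  · intro A hA
    obtain ⟨B, hB, hmin⟩ := (F.filter (· ⊆ A)).exists_min_image Finset.card
      ⟨A, Finset.mem_filter.2 ⟨hA, subset_rfl⟩⟩
    rw [Finset.mem_filter] at hB
    have hBm : B ∈ Fm := Finset.mem_filter.2 ⟨hB.1, fun C hC hCB =>
      Finset.eq_of_subset_of_card_le hCB
        (hmin C (Finset.mem_filter.2 ⟨hC, hCB.trans hB.2⟩))⟩
    refine ⟨(hne B hB.1).choose, hB.2 (hne B hB.1).choose_spec,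
      Finset.mem_biUnion.2 ⟨B, hBm, ?_⟩⟩
    rw [dif_pos (hne B hB.1), Finset.mem_singleton]

/-- A hitting set is padded to exactly `k` points, which makes it one of the possible samples. -/
theorem Finset.exists_embedding_of_subset {α : Type*} {I H : Finset α} {k : ℕ} (hH : H ⊆ I)
    (hHk : H.card ≤ k) (hk : k ≤ I.card) :
    ∃ f : Fin k ↪ {v // v ∈ I}, ∀ a ∈ H, ∃ i, (f i : α) = a := by
  classical
  obtain ⟨J, hHJ, hJI, hJ⟩ := Finset.exists_subsuperset_card_eq hH hHk hk
  let e : Fin k ≃ J := (finCongr hJ.symm).trans J.equivFin.symm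
  refine ⟨⟨fun i => ⟨e i, hJI (e i).2⟩, fun i j hij => ?_⟩, fun a ha => ?_⟩
  · exact e.injective (Subtype.ext (congrArg (fun z : {v // v ∈ I} => (z : α)) hij))
  · refine ⟨e.symm ⟨a, hHJ ha⟩, ?_⟩
    exact congrArg Subtype.val (e.apply_symm_apply ⟨a, hHJ ha⟩)

/-! ### Invariance along a run of the algorithm. -/

namespace TreeRecovery

section

variable {V : Type*} [Fintype V] {n : ℕ} {M : WeightedSemiLabeledTree V n}

theorem inv_initState {d : Fin n → Fin n → ℝ}
    (hd : ∀ i j, d i j = treeDist M (M.label i) (M.label j)) (root : Fin n) :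
    Inv M (initState d root).queue (initState d root).skel (initState d root).oracle := by
  classical
  set φ : V → Node n := fun x => if h : x ∈ Set.range M.label then Sum.inl h.choose
    else Sum.inr 0 with hφ
  have hφl : ∀ i, φ (M.label i) = Sum.inl i := by
    intro i
    have h : M.label i ∈ Set.range M.label := ⟨i, rfl⟩
    rw [hφ]
    simp only [dif_pos h]
    exact congrArg Sum.inl (M.label.injective h.choose_spec)
  set r : Region V := ⟨Set.univ, M.label root⟩ with hr
  have hk : ∀ x, x ∈ known M r ↔ x ∈ Set.range M.label := by
    intro x
    constructor
    · rintro ⟨-, h | h⟩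
      · exact h
      · exact ⟨root, h.symm⟩
    · exact fun h => ⟨trivial, Or.inl h⟩
  refine ⟨φ, Set.range M.label, [r], ∅, ?_, ?_, ?_⟩
  · exact
    { naming :=
      { inj := by
          rintro _ ⟨i, rfl⟩ _ ⟨j, rfl⟩ h
          rw [hφl, hφl] at h
          rw [Sum.inl.inj h]
        label_mem := fun i => ⟨i, rfl⟩
        label_eq := hφl
        fresh := by
          rintro _ ⟨i, rfl⟩ m hm
          rw [hφl] at hm
          exact absurd hm (by simp) }
      gated := by
        intro r' hr'
        rw [List.mem_singleton.1 hr']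
        exact ⟨trivial, fun x _ y hy => absurd trivial hy⟩
      mem_iff := by
        intro r' hr' x _
        rw [List.mem_singleton.1 hr', hk]
      dist := by
        intro r' hr' x hx y hy
        rw [List.mem_singleton.1 hr', hk] at hx hy
        obtain ⟨i, rfl⟩ := hx
        obtain ⟨j, rfl⟩ := hy
        rw [hφl, hφl, ← hd]
        rfl
      disj := by simp
      edges := by simp
      edges_cover := fun e _ => Or.inr ⟨r, by simp, fun x _ => trivial⟩
      cover := fun x => Or.inr ⟨r, by simp, trivial⟩
      gate_notMem := by
        intro r₁ h1 r₂ h2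
        rw [List.mem_singleton.1 h1, List.mem_singleton.1 h2]
        exact fun h => h.2 rfl
      outside := ⟨root, fun r' hr' => by
        rw [List.mem_singleton.1 hr']
        exact fun h => h.2 rfl⟩ }
  · rw [List.map_singleton]
    change [_] = [_]
    congr 1
    unfold toBag
    rw [Bag.mk.injEq]
    refine ⟨?_, (hφl root).symm⟩
    ext a
    simp only [Finset.mem_image, Finset.mem_filter, Finset.mem_univ, true_and, hk]
    constructor
    · rintro ⟨i, rfl⟩; exact ⟨_, ⟨i, rfl⟩, hφl i⟩
    · rintro ⟨_, ⟨i, rfl⟩, rfl⟩; exact ⟨i, (hφl i).symm⟩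
  · simp [initState]

/-- After its round a sampled node is in no interior: either it was in none before, being in no bag
or already a representative, or `basic` has just turned it into one. Interiors only shrink, so this
persists. -/
theorem Inv.splitAt {st : SplitState n} {Q : List (Bag n)} {S : Skeleton n}
    (h : Inv M (st.bags ++ Q) (S ∪ st.skel) st.oracle) (u : Node n) :
    Inv M ((splitAt st u).bags ++ Q) (S ∪ (splitAt st u).skel) (splitAt st u).oracle ∧
      ∀ b ∈ (splitAt st u).bags, u ∉ b.intr ∧ ∃ b' ∈ st.bags, b.intr ⊆ b'.intr := by
  classical
  unfold TreeRecovery.splitAt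
  split
  · rename_i hfind
    rw [List.find?_eq_none] at hfind
    refine ⟨h, fun b hb => ⟨fun hu => ?_, b, hb, subset_rfl⟩⟩
    exact hfind b hb (by simpa using (Finset.mem_erase.1 hu).2)
  · rename_i B hfind
    have hB : B ∈ st.bags := List.mem_of_find?_eq_some hfind
    have huB : u ∈ B.nodes := by simpa using List.find?_some hfind
    split
    · rename_i hu
      refine ⟨h, fun b hb => ⟨?_, b, hb, subset_rfl⟩⟩
      rw [hu]
      exact h.rep_notMem_intr (by simp [hB]) (by simp [hb])
    · rename_i hu
      have hperm : st.bags.Perm (B :: st.bags.erase B) := List.perm_cons_erase hB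
      have h' : Inv M (B :: (st.bags.erase B ++ Q)) (S ∪ st.skel) st.oracle :=
        h.perm (hperm.append_right Q).symm
      obtain ⟨h1, h2⟩ := h'.basic huB
      refine ⟨?_, ?_⟩
      · rw [← Finset.union_assoc]
        refine h1.perm ?_
        rw [List.append_assoc]
        exact (List.perm_append_comm_assoc _ _ _)
      · intro b hb
        rcases List.mem_append.1 hb with hb | hb
        · refine ⟨fun hub => ?_, b, List.mem_of_mem_erase hb, subset_rfl⟩
          have hd := (List.pairwise_cons.1 h'.disjoint_intr).1 b (by simp [hb])
          exact Finset.disjoint_left.1 hd (Finset.mem_erase.2 ⟨hu, huB⟩) hub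
        · exact ⟨(h2 b hb).2, B, hB, (h2 b hb).1⟩

theorem Inv.foldl_splitAt {Q : List (Bag n)} {S : Skeleton n} (us : List (Node n))
    {st : SplitState n} (h : Inv M (st.bags ++ Q) (S ∪ st.skel) st.oracle) :
    Inv M ((us.foldl TreeRecovery.splitAt st).bags ++ Q)
        (S ∪ (us.foldl TreeRecovery.splitAt st).skel)
        (us.foldl TreeRecovery.splitAt st).oracle ∧
      ∀ b ∈ (us.foldl TreeRecovery.splitAt st).bags, (∀ u ∈ us, u ∉ b.intr) ∧
        ∃ b' ∈ st.bags, b.intr ⊆ b'.intr := by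
  induction us generalizing st with
  | nil => exact ⟨h, fun b hb => ⟨by simp, b, hb, subset_rfl⟩⟩
  | cons u us ih =>
    obtain ⟨h1, h2⟩ := h.splitAt u
    obtain ⟨h3, h4⟩ := ih h1
    refine ⟨h3, fun b hb => ?_⟩
    obtain ⟨h5, b', hb', h6⟩ := h4 b hb
    obtain ⟨h7, b'', hb'', h8⟩ := h2 b' hb'
    refine ⟨fun v hv => ?_, b'', hb'', h6.trans h8⟩
    rcases List.mem_cons.1 hv with rfl | hv
    · exact fun h9 => h7 (h6 h9)
    · exact h5 v hv

theorem Inv.flatMap_explode {S : Skeleton n} {o : Oracle n} (l : List (Bag n))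
    {Q : List (Bag n)} (h : Inv M (l ++ Q) S o) :
    Inv M (l.flatMap (TreeRecovery.explode o) ++ Q) S o ∧
      ∀ c ∈ l.flatMap (TreeRecovery.explode o), ∃ b ∈ l, c.intr ⊆ b.intr ∧ c.intr.Nonempty ∧
        ∃ p u, c.intr = branchNodes M p u := by
  induction l generalizing Q with
  | nil => exact ⟨h, by simp⟩
  | cons b l ih =>
    obtain ⟨h1, h2⟩ := Inv.explode (Q := l ++ Q) h
    obtain ⟨h3, h4⟩ := ih (Q := TreeRecovery.explode o b ++ Q)
      (h1.perm (List.perm_append_comm_assoc _ _ _))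
    rw [List.flatMap_cons]
    refine ⟨h3.perm ?_, ?_⟩
    · rw [List.append_assoc]
      exact List.perm_append_comm_assoc _ _ _
    · intro c hc
      rcases List.mem_append.1 hc with hc | hc
      · exact ⟨b, by simp, h2 c hc⟩
      · obtain ⟨b', hb', h5⟩ := h4 c hc
        exact ⟨b', by simp [hb'], h5⟩

theorem Inv.bigsplitPass {B : Bag n} {Q : List (Bag n)} {S : Skeleton n} {o : Oracle n}
    (h : Inv M (B :: Q) S o) (us : List (Node n)) :
    Inv M ((bigsplitPass o B us).bags ++ Q) (S ∪ (bigsplitPass o B us).skel)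
        (bigsplitPass o B us).oracle ∧
      ∀ c ∈ (bigsplitPass o B us).bags, c.intr ⊆ B.intr ∧ (∀ u ∈ us, u ∉ c.intr) ∧
        c.intr.Nonempty ∧ ∃ p u, c.intr = branchNodes M p u := by
  obtain ⟨h1, h2⟩ := Inv.foldl_splitAt (M := M) (Q := Q) (S := S) us (st := ⟨[B], ∅, o⟩)
    (by simpa using h)
  obtain ⟨h3, h4⟩ := Inv.flatMap_explode _ h1
  refine ⟨h3, fun c hc => ?_⟩
  obtain ⟨b, hb, h5, h6⟩ := h4 c hc
  obtain ⟨h7, b', hb', h8⟩ := h2 b hb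
  rw [List.mem_singleton] at hb'
  subst hb'
  exact ⟨h5.trans h8, fun u hu h9 => h7 u hu (h5 h9), h6⟩

theorem Inv.splitOutcome {κ : ℕ} {s : State n} {B : Bag n} {Q : List (Bag n)}
    (h : Inv M s.queue s.skel s.oracle) (hs : s.queue = B :: Q) (us : List (Node n)) :
    Inv M (splitOutcome κ s B Q us).queue (splitOutcome κ s B Q us).skel
      (splitOutcome κ s B Q us).oracle := by
  classical
  unfold TreeRecovery.splitOutcome
  simp only
  split_ifs
  · rw [hs] at h
    exact (h.bigsplitPass us).1.perm List.perm_append_comm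
  · exact h

theorem Inv.step {κ : ℕ} {s s' : State n} (h : Inv M s.queue s.skel s.oracle)
    (hs' : s' ∈ (step κ s).support) : Inv M s'.queue s'.skel s'.oracle := by
  unfold TreeRecovery.step at hs'
  split at hs'
  · rw [PMF.mem_support_pure_iff] at hs'
    rw [hs']; exact h
  · rename_i B Q hq
    split at hs'
    · rw [PMF.mem_support_pure_iff] at hs'
      rw [hs']
      rw [hq] at h
      exact h.fullSkeleton
    · rw [PMF.mem_support_map_iff] at hs'
      obtain ⟨us, -, rfl⟩ := hs'
      exact h.splitOutcome hq _

theorem inv_run {κ : ℕ} {d : Fin n → Fin n → ℝ}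
    (hd : ∀ i j, d i j = treeDist M (M.label i) (M.label j)) (root : Fin n) (t : ℕ) :
    ∀ s ∈ (run κ d root t).support, Inv M s.queue s.skel s.oracle := by
  induction t with
  | zero =>
    intro s hs
    rw [run, PMF.mem_support_pure_iff] at hs
    rw [hs]
    exact inv_initState hd root
  | succ t ih =>
    intro s hs
    rw [run, PMF.mem_support_bind_iff] at hs
    obtain ⟨s', hs', hs⟩ := hs
    exact (ih s' hs').step hs

/-! ## The size of the problem decreases -/

theorem Inv.exists_notMem_intr {bags : List (Bag n)} {S : Skeleton n} {o : Oracle n}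
    (h : Inv M bags S o) : ∃ i, ∀ B ∈ bags, Sum.inl i ∉ B.intr := by
  obtain ⟨φ, N, rs, E, hc, rfl, hS⟩ := h
  obtain ⟨i, hi⟩ := hc.outside
  refine ⟨i, fun B hB hcon => ?_⟩
  obtain ⟨r, hr, rfl⟩ := List.mem_map.1 hB
  obtain ⟨j, hj, hij⟩ := (hc.mem_intr hr).1 hcon
  obtain rfl := Sum.inl.inj hij
  exact hi r hr hj

theorem Inv.card_intr_le {bags : List (Bag n)} {S : Skeleton n} {o : Oracle n}
    (h : Inv M bags S o) {B : Bag n} (hB : B ∈ bags) : B.intr.card ≤ n := by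
  classical
  obtain ⟨φ, N, rs, E, hc, rfl, hS⟩ := h
  obtain ⟨r, hr, rfl⟩ := List.mem_map.1 hB
  have : (toBag M φ r).intr ⊆ (Finset.univ : Finset (Fin n)).image Sum.inl := by
    intro a ha
    obtain ⟨j, -, rfl⟩ := (hc.mem_intr hr).1 ha
    simp
  exact (Finset.card_le_card this).trans (Finset.card_image_le.trans (by simp))

/-- The maximal degree, which is the sample size, vanishes only for a one-vertex tree. Samples are
thus non-empty whenever there is an interior to split. -/
theorem Inv.maxDeg_pos {bags : List (Bag n)} {S : Skeleton n} {o : Oracle n}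
    (h : Inv M bags S o) {B : Bag n} (hB : B ∈ bags) (hne : B.intr.Nonempty) :
    0 < M.maxDeg := by
  classical
  obtain ⟨φ, N, rs, E, hc, rfl, hS⟩ := h
  obtain ⟨r, hr, rfl⟩ := List.mem_map.1 hB
  obtain ⟨a, ha⟩ := hne
  obtain ⟨j, hj, -⟩ := (hc.mem_intr hr).1 ha
  have : Nontrivial V := ⟨⟨_, _, hj.2⟩⟩
  obtain ⟨w, hw⟩ := M.isTree.connected.preconnected.exists_adj_of_nontrivial r.gate
  have h1 : 0 < M.graph.degree r.gate := (M.graph.degree_pos_iff_exists_adj _).2 ⟨w, hw⟩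
  have h2 := h1.trans_le (M.graph.degree_le_maxDegree _)
  unfold SemiLabeledTree.maxDeg
  convert h2

/-- The label `i` acts as a root. If `j` is in both branches, both cut vertices lie on the path from
`j` to `i`, and the branch cut off nearer to `j` is contained in the other. -/
theorem branchNodes_laminar {p u q w : V} {i : Fin n} (hp : Sum.inl i ∉ branchNodes M p u)
    (hq : Sum.inl i ∉ branchNodes M q w) :
    Disjoint (branchNodes M p u) (branchNodes M q w) ∨
      branchNodes M p u ⊆ branchNodes M q w ∨ branchNodes M q w ⊆ branchNodes M p u := by
  classical
  have hD := isTreeMetric_treeDist M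
  have hm : ∀ p u j, Sum.inl j ∈ branchNodes M p u ↔
      ¬ Betw (treeDist M) u p (M.label j) := by
    intro p u j; simp [branchNodes]
  have hm' : ∀ p u a, a ∈ branchNodes M p u → ∃ j, a = Sum.inl j := by
    intro p u a ha
    simp only [branchNodes, Finset.mem_image] at ha
    obtain ⟨j, -, rfl⟩ := ha
    exact ⟨j, rfl⟩
  rw [or_iff_not_imp_left, Finset.not_disjoint_iff]
  rintro ⟨a, ha, hb⟩
  obtain ⟨j, rfl⟩ := hm' _ _ _ ha
  have key : ∀ p u q w, Sum.inl i ∉ branchNodes M p u → Sum.inl i ∉ branchNodes M q w →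
      Sum.inl j ∈ branchNodes M p u → Sum.inl j ∈ branchNodes M q w →
      treeDist M (M.label j) p ≤ treeDist M (M.label j) q →
      branchNodes M p u ⊆ branchNodes M q w := by
    intro p u q w hp hq ha hb hle c hc
    obtain ⟨k, rfl⟩ := hm' _ _ _ hc
    rw [hm] at hp hq ha hb hc ⊢
    rw [not_not] at hp hq
    have hjp : Betw (treeDist M) (M.label j) p (M.label i) := by
      by_contra h1; exact hD.not_betw_trans ha h1 hp
    have hjq : Betw (treeDist M) (M.label j) q (M.label i) := by
      by_contra h1; exact hD.not_betw_trans hb h1 hq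
    have hpq := (hD.betw_of_dist_le hjp hjq hle).1
    refine hD.not_betw_trans hb fun h1 => ?_
    have h2 : Betw (treeDist M) (M.label j) p (M.label k) := by
      have := hD.triangle (M.label j) p (M.label k)
      have := hD.triangle p q (M.label k)
      unfold Betw at *; linarith
    exact hD.not_betw_trans (fun h3 => ha (hD.betw_comm.1 h3)) hc h2
  rcases le_total (treeDist M (M.label j) p) (treeDist M (M.label j) q) with h | h
  · exact Or.inl (key p u q w hp hq ha hb h)
  · exact Or.inr (key q w p u hq hp hb ha h)

theorem mul_sqrt_le_of_lt {κ m s : ℕ} (hm : κ < m) (hs : s * (κ + 1) ≤ m + κ) :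
    (s : ℝ) * √(κ : ℝ) ≤ m := by
  have hq0 : 0 ≤ √(κ : ℝ) := Real.sqrt_nonneg _
  have hq : √(κ : ℝ) * √(κ : ℝ) = κ := Real.mul_self_sqrt (by positivity)
  set q := √(κ : ℝ)
  have h1 : (κ : ℝ) + 1 ≤ m := by exact_mod_cast hm
  have h2 : (s : ℝ) * (κ + 1) ≤ m + κ := by exact_mod_cast hs
  rw [← hq] at h1 h2
  have h3 : (s : ℝ) * (q * q + 1) * q ≤ (m + q * q) * q := mul_le_mul_of_nonneg_right h2 hq0
  -- With q = √κ the claim reduces to q³ ≤ m (q² - q + 1). As m ≥ q² + 1, it suffices that (q² +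
  -- 1)(q² - q + 1) - q³ = q² (q - 1)² + (q² - q + 1) is nonnegative.
  have h4 : q * q * q ≤ (q * q + 1) * (q * q + 1 - q) := by
    nlinarith [sq_nonneg (q * (q - 1)), sq_nonneg (q - 1)]
  have h5 : 0 ≤ q * q + 1 - q := by nlinarith [sq_nonneg (q - 1)]
  have h6 : (q * q + 1) * (q * q + 1 - q) ≤ m * (q * q + 1 - q) :=
    mul_le_mul_of_nonneg_right h1 h5
  have h7 : (s : ℝ) * q * (q * q + 1) ≤ m * (q * q + 1) := by nlinarith
  exact le_of_mul_le_mul_right h7 (by positivity)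

theorem maxSize_le {l : List (Bag n)} {k : ℕ} (h : ∀ b ∈ l, b.nodes.card ≤ k) :
    maxSize l ≤ k := by
  induction l with
  | nil => simp [maxSize]
  | cons b l ih =>
    have := ih fun c hc => h c (by simp [hc])
    have := h b (by simp)
    simp only [maxSize, List.map_cons, List.foldr_cons] at *
    omega

/-- Some sample makes all the bags small. -/
theorem Inv.exists_good_sample {κ : ℕ} {B : Bag n} {Q : List (Bag n)} {S : Skeleton n}
    {o : Oracle n} (h : Inv M (B :: Q) S o) (hκ : ¬ B.nodes.card ≤ κ) :
    ∃ us : Fin κ ↪ {v : Node n // v ∈ B.nodes.erase B.rep},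
      (maxSize (TreeRecovery.bigsplitPass o B (List.ofFn fun i => (us i : Node n))).bags : ℝ) *
        √(κ : ℝ) ≤ (B.nodes.card : ℝ) := by
  classical
  have hcard : B.intr.card + 1 = B.nodes.card := Finset.card_erase_add_one (h.rep_mem (by simp))
  set m := B.nodes.card with hm
  -- This is m / (κ + 1) rounded up. The interior has m - 1 < s (κ + 1) elements, so κ points hit
  -- all branches with at least `s` labels.
  set s := (m + κ) / (κ + 1) with hs
  have hs1 : s * (κ + 1) ≤ m + κ := Nat.div_mul_le_self _ _
  have hs2 : m + κ < (s + 1) * (κ + 1) := by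
    rw [mul_comm]; exact Nat.lt_mul_div_succ _ (by omega)
  have hs0 : 0 < s := Nat.div_pos (by omega) (by omega)
  obtain ⟨i, hi⟩ := h.exists_notMem_intr
  have hi' := hi B (by simp)
  set F : Finset (Finset (Node n)) := ((Finset.univ : Finset (V × V)).image
    fun x => branchNodes M x.1 x.2).filter fun A => A ⊆ B.intr ∧ s ≤ A.card with hF
  obtain ⟨H, hHI, hHk, hH⟩ := Finset.exists_hitting_set F B.intr s κ hs0
    (by nlinarith) (fun A hA => (Finset.mem_filter.1 hA).2) (by
      intro A hA A' hA'
      obtain ⟨h1, h2, -⟩ := Finset.mem_filter.1 hA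
      obtain ⟨h3, h4, -⟩ := Finset.mem_filter.1 hA'
      obtain ⟨⟨p, u⟩, -, rfl⟩ := Finset.mem_image.1 h1
      obtain ⟨⟨q, w⟩, -, rfl⟩ := Finset.mem_image.1 h3
      exact branchNodes_laminar (fun h5 => hi' (h2 h5)) (fun h5 => hi' (h4 h5)))
  obtain ⟨us, hus⟩ := Finset.exists_embedding_of_subset hHI hHk (by omega)
  refine ⟨us, ?_⟩
  refine (mul_le_mul_of_nonneg_right ?_ (Real.sqrt_nonneg _)).trans
    (mul_sqrt_le_of_lt (not_le.1 hκ) hs1)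
  obtain ⟨h1, h2⟩ := h.bigsplitPass (List.ofFn fun i => (us i : Node n))
  refine Nat.cast_le.2 (maxSize_le fun c hc => ?_)
  obtain ⟨h3, h4, -, p, u, h5⟩ := h2 c hc
  have h6 : c.intr.card + 1 = c.nodes.card :=
    Finset.card_erase_add_one (h1.rep_mem (List.mem_append_left _ hc))
  by_contra hcon
  -- A bag with more than `s` nodes has an interior of at least `s` labels, because its
  -- representative does not count. The sample would then hit this interior, yet it avoids all
  -- interiors.
  have h7 : c.intr ∈ F := Finset.mem_filter.2
    ⟨Finset.mem_image.2 ⟨(p, u), by simp, h5.symm⟩, h3, by omega⟩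
  obtain ⟨a, hac, haH⟩ := hH _ h7
  obtain ⟨j, rfl⟩ := hus a haH
  exact h4 _ (List.mem_ofFn.2 ⟨j, rfl⟩) hac

theorem sum_card_intr_le {l : List (Bag n)} (hl : l.Pairwise fun B B' => Disjoint B.intr B'.intr)
    {A : Finset (Node n)} (hA : ∀ b ∈ l, b.intr ⊆ A) :
    (l.map fun b => b.intr.card).sum ≤ A.card := by
  classical
  induction l generalizing A with
  | nil => simp
  | cons b l ih =>
    obtain ⟨h1, h2⟩ := List.pairwise_cons.1 hl
    have h3 := ih h2 (A := A \ b.intr) fun c hc => by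
      rw [Finset.subset_sdiff]
      exact ⟨hA c (by simp [hc]), (h1 c hc).symm⟩
    have h4 := Finset.card_sdiff_add_card_eq_card (hA b (by simp))
    rw [List.map_cons, List.sum_cons]
    omega

/-- A bound for the number of successful steps that remain. -/
def potential (s : State n) : ℕ := (s.queue.map fun B => max B.intr.card 1).sum

/-- The new interiors are non-empty, disjoint and contained in the old one without the sampled
nodes, so their sizes add up to less. If the old interior is empty there are no new bags, and the
maximum with 1 still makes the old bag count. -/
theorem Inv.potential_bigsplitPass_lt {B : Bag n} {Q : List (Bag n)} {S : Skeleton n}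
    {o : Oracle n} (h : Inv M (B :: Q) S o) {us : List (Node n)} (hus : ∀ u ∈ us, u ∈ B.intr)
    (hne : B.intr.Nonempty → us ≠ []) :
    ((TreeRecovery.bigsplitPass o B us).bags.map fun B => max B.intr.card 1).sum <
      max B.intr.card 1 := by
  classical
  obtain ⟨h1, h2⟩ := h.bigsplitPass us
  set l := (TreeRecovery.bigsplitPass o B us).bags
  have hmap : (l.map fun B => max B.intr.card 1) = l.map fun B => B.intr.card := by
    refine List.map_congr_left fun c hc => max_eq_left ?_
    exact Finset.card_pos.2 (h2 c hc).2.2.1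
  rw [hmap]
  have hd := (List.pairwise_append.1 h1.disjoint_intr).1
  rcases us with _ | ⟨u, us⟩
  · have hB : B.intr = ∅ := by
      by_contra hcon
      exact hne (Finset.nonempty_iff_ne_empty.2 hcon) rfl
    have := sum_card_intr_le hd fun c hc => (h2 c hc).1
    rw [hB, Finset.card_empty] at this
    omega
  · have := sum_card_intr_le (A := B.intr.erase u) hd fun c hc a ha =>
      Finset.mem_erase.2 ⟨fun he => (h2 c hc).2.1 u (by simp) (he ▸ ha), (h2 c hc).1 ha⟩
    have h3 := Finset.card_erase_lt_of_mem (hus u (by simp))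
    omega

end

end TreeRecovery

/-! ## Halting -/

theorem PMF.tsum_mul_le_of_support {α : Type*} (p : PMF α) {g : α → ℝ≥0∞} {c : ℝ≥0∞}
    (h : ∀ a ∈ p.support, g a ≤ c) : ∑' a, p a * g a ≤ c := by
  calc ∑' a, p a * g a ≤ ∑' a, p a * c := by
        refine ENNReal.tsum_le_tsum fun a => ?_
        by_cases ha : a ∈ p.support
        · exact mul_le_mul_right (h a ha) _
        · rw [PMF.mem_support_iff, not_not] at ha
          simp [ha]
    _ = c := by rw [ENNReal.tsum_mul_right, p.tsum_coe, one_mul]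

/-- If a natural number valued potential never increases and decreases with probability at least
`p` outside of `A`, then a Markov chain is in `A` with probability tending to one. -/
theorem PMF.tendsto_one_of_potential {α : Type*} (f : α → PMF α) (μ : ℕ → PMF α)
    (hμ : ∀ t, μ (t + 1) = (μ t).bind f) (Φ : α → ℕ) (A : Set α) {p : ℝ≥0∞} (hp : p ≠ 0)
    (h0 : ∑' s, μ 0 s * Φ s ≠ ∞)
    (hle : ∀ t, ∀ s ∈ (μ t).support, ∀ s' ∈ (f s).support, Φ s' ≤ Φ s)
    (hlt : ∀ t, ∀ s ∈ (μ t).support, s ∉ A → p ≤ (f s).toOuterMeasure {s' | Φ s' < Φ s}) :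
    Tendsto (fun t => (μ t).toOuterMeasure A) atTop (𝓝 1) := by
  classical
  set E : ℕ → ℝ≥0∞ := fun t => ∑' s, μ t s * Φ s with hE
  set q : ℕ → ℝ≥0∞ := fun t => (μ t).toOuterMeasure Aᶜ with hq
  -- Outside `A` a step lowers the potential with probability at least `p`, and then by at least one
  -- because it is an integer.
  have hstep : ∀ t, E (t + 1) + p * q t ≤ E t := by
    intro t
    have h1 : E (t + 1) = ∑' s, μ t s * ∑' s', f s s' * Φ s' := by
      simp only [hE, hμ, PMF.bind_apply]
      simp_rw [← ENNReal.tsum_mul_right, ← ENNReal.tsum_mul_left]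
      rw [ENNReal.tsum_comm]
      simp_rw [mul_assoc]
    have h2 : p * q t = ∑' s, μ t s * Aᶜ.indicator (fun _ => p) s := by
      simp only [hq, PMF.toOuterMeasure_apply]
      rw [← ENNReal.tsum_mul_left]
      refine tsum_congr fun s => ?_
      by_cases hs : s ∈ Aᶜ
      · simp only [Set.indicator_of_mem hs]; rw [mul_comm]
      · simp only [Set.indicator_of_notMem hs, mul_zero]
    rw [h1, h2, ← ENNReal.tsum_add]
    refine ENNReal.tsum_le_tsum fun s => ?_
    rw [← mul_add]
    by_cases hs : s ∈ (μ t).support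
    · refine mul_le_mul_right ?_ _
      calc (∑' s', f s s' * Φ s') + Aᶜ.indicator (fun _ => p) s
          ≤ (∑' s', f s s' * Φ s') + (f s).toOuterMeasure {s' | Φ s' < Φ s} := by
            refine add_le_add le_rfl ?_
            by_cases hsA : s ∈ A
            · simp [hsA]
            · simpa [hsA] using hlt t s hs hsA
        _ = ∑' s', f s s' * (Φ s' + ({s' | Φ s' < Φ s} : Set α).indicator (fun _ => 1) s') := by
            rw [PMF.toOuterMeasure_apply, ← ENNReal.tsum_add]
            refine tsum_congr fun s' => ?_
            rw [mul_add]
            congr 1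
            by_cases hs' : s' ∈ ({s' | Φ s' < Φ s} : Set α)
            · simp only [Set.indicator_of_mem hs', mul_one]
            · simp only [Set.indicator_of_notMem hs', mul_zero]
        _ ≤ Φ s := by
            refine PMF.tsum_mul_le_of_support _ fun s' hs' => ?_
            have h3 := hle t s hs s' hs'
            by_cases h4 : s' ∈ ({s' | Φ s' < Φ s} : Set α)
            · rw [Set.indicator_of_mem h4]
              exact_mod_cast (h4 : Φ s' < Φ s)
            · rw [Set.indicator_of_notMem h4, add_zero]
              exact_mod_cast h3
    · rw [PMF.mem_support_iff, not_not] at hs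
      simp [hs]
  have hsum : ∀ T, E T + ∑ t ∈ Finset.range T, p * q t ≤ E 0 := by
    intro T
    induction T with
    | zero => simp
    | succ T ih =>
      rw [Finset.sum_range_succ, add_comm (∑ t ∈ Finset.range T, p * q t), ← add_assoc]
      exact (add_le_add_left (hstep T) _).trans ih
  -- Summed over time, the drops are bounded by the initial expectation, so the probabilities `q t`
  -- are summable and tend to zero.
  have htsum : ∑' t, p * q t ≠ ∞ := by
    refine ne_top_of_le_ne_top h0 ?_
    rw [ENNReal.tsum_eq_iSup_nat]
    exact iSup_le fun T => le_add_self.trans (hsum T)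
  rw [ENNReal.tsum_mul_left] at htsum
  have hq0 : Tendsto q atTop (𝓝 0) := by
    refine ENNReal.tendsto_atTop_zero_of_tsum_ne_top fun htop => htsum ?_
    rw [htop, ENNReal.mul_top hp]
  have hA : ∀ t, (μ t).toOuterMeasure A = 1 - q t := by
    intro t
    have h1 : (μ t).toOuterMeasure A + q t = 1 := by
      simp only [hq, PMF.toOuterMeasure_apply]
      rw [← ENNReal.tsum_add, ← (μ t).tsum_coe]
      refine tsum_congr fun s => ?_
      by_cases hs : s ∈ A <;> simp [hs]
    have h2 : q t ≠ ∞ := ne_top_of_le_ne_top ENNReal.one_ne_top (h1 ▸ le_add_self)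
    rw [← h1, ENNReal.add_sub_cancel_right h2]
  simp_rw [hA]
  have := ENNReal.Tendsto.sub (tendsto_const_nhds (x := (1 : ℝ≥0∞)) (f := atTop)) hq0
    (Or.inl ENNReal.one_ne_top)
  simpa using this

namespace TreeRecovery

variable {V : Type*} [Fintype V] {n : ℕ} {M : WeightedSemiLabeledTree V n}

theorem potential_cons {s : State n} {B : Bag n} {Q : List (Bag n)} (h : s.queue = B :: Q) :
    potential s = max B.intr.card 1 + (Q.map fun B => max B.intr.card 1).sum := by
  rw [potential, h, List.map_cons, List.sum_cons]

theorem Inv.potential_splitOutcome {s : State n} {B : Bag n} {Q : List (Bag n)}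
    (h : Inv M s.queue s.skel s.oracle) (hs : s.queue = B :: Q)
    (us : Fin M.maxDeg ↪ {v : Node n // v ∈ B.nodes.erase B.rep}) :
    potential (TreeRecovery.splitOutcome M.maxDeg s B Q (List.ofFn fun i => (us i : Node n))) ≤
        potential s ∧
      ((maxSize (TreeRecovery.bigsplitPass s.oracle B
        (List.ofFn fun i => (us i : Node n))).bags : ℝ) * √(M.maxDeg : ℝ) ≤ (B.nodes.card : ℝ) →
      potential (TreeRecovery.splitOutcome M.maxDeg s B Q (List.ofFn fun i => (us i : Node n))) <
        potential s) := by
  classical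
  have hlt : potential ⟨Q ++ (TreeRecovery.bigsplitPass s.oracle B
      (List.ofFn fun i => (us i : Node n))).bags, s.skel ∪ (TreeRecovery.bigsplitPass s.oracle B
      (List.ofFn fun i => (us i : Node n))).skel, (TreeRecovery.bigsplitPass s.oracle B
      (List.ofFn fun i => (us i : Node n))).oracle⟩ < potential s := by
    rw [hs] at h
    have := h.potential_bigsplitPass_lt (us := List.ofFn fun i => (us i : Node n))
      (by
        intro u hu
        obtain ⟨i, rfl⟩ := List.mem_ofFn.1 hu
        exact (us i).2)
      (by
        intro hne hnil
        have h1 := h.maxDeg_pos (by simp) hne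
        have h2 := congrArg List.length hnil
        rw [List.length_ofFn, List.length_nil] at h2
        omega)
    rw [potential_cons hs, potential, List.map_append, List.sum_append]
    omega
  unfold TreeRecovery.splitOutcome
  simp only
  split_ifs with hc
  · exact ⟨hlt.le, fun _ => hlt⟩
  · exact ⟨le_rfl, fun hc' => absurd hc' hc⟩

theorem potential_fullSkeleton_lt {s : State n} {B : Bag n} {Q : List (Bag n)}
    (hs : s.queue = B :: Q) (S : Skeleton n) (o : Oracle n) :
    potential ⟨Q, S, o⟩ < potential s := by
  rw [potential_cons hs, potential]
  have : 1 ≤ max B.intr.card 1 := le_max_right _ _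
  change (Q.map fun B => max B.intr.card 1).sum < _
  omega

theorem Inv.potential_step_le {s s' : State n} (h : Inv M s.queue s.skel s.oracle)
    (hs' : s' ∈ (TreeRecovery.step M.maxDeg s).support) : potential s' ≤ potential s := by
  unfold TreeRecovery.step at hs'
  split at hs'
  · rw [PMF.mem_support_pure_iff] at hs'
    rw [hs']
  · rename_i B Q hq
    split at hs'
    · rw [PMF.mem_support_pure_iff] at hs'
      rw [hs']
      exact (potential_fullSkeleton_lt hq _ _).le
    · rw [PMF.mem_support_map_iff] at hs'
      obtain ⟨us, -, rfl⟩ := hs'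
      exact (h.potential_splitOutcome hq us).1

/-- A small bag is removed with certainty. For a large one, a good sample is one of at most n^Δ
equally likely samples. The maximum with 1 keeps the bound at most one. -/
theorem Inv.le_toOuterMeasure_step {s : State n} (h : Inv M s.queue s.skel s.oracle)
    (hs : s.queue ≠ []) :
    ((max (n ^ M.maxDeg) 1 : ℕ) : ℝ≥0∞)⁻¹ ≤
      (TreeRecovery.step M.maxDeg s).toOuterMeasure {s' | potential s' < potential s} := by
  classical
  have hp1 : ((max (n ^ M.maxDeg) 1 : ℕ) : ℝ≥0∞)⁻¹ ≤ 1 := by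
    rw [ENNReal.inv_le_one]
    exact_mod_cast le_max_right _ _
  unfold TreeRecovery.step
  split
  · rename_i hq
    exact absurd hq hs
  · rename_i B Q hq
    split
    · rw [PMF.toOuterMeasure_pure_apply, if_pos]
      · exact hp1
      · exact potential_fullSkeleton_lt hq _ _
    · rename_i hc
      have h' := h
      rw [hq] at h'
      obtain ⟨us, hus⟩ := h'.exists_good_sample hc
      have hmem := (h.potential_splitOutcome hq us).2 hus
      rw [PMF.toOuterMeasure_map_apply]
      have hne := nonempty_samples B hc
      refine le_trans ?_ (measure_mono (Set.singleton_subset_iff.2 hmem))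
      rw [PMF.toOuterMeasure_apply_singleton, PMF.uniformOfFintype_apply]
      refine ENNReal.inv_le_inv.2 (Nat.cast_le.2 (le_max_of_le_left ?_))
      rw [Fintype.card_embedding_eq, Fintype.card_fin, Fintype.card_coe]
      refine (Nat.descFactorial_le_pow _ _).trans (Nat.pow_le_pow_left ?_ _)
      exact h'.card_intr_le (by simp)

/-- The algorithm is correct for every additive distance oracle. -/
theorem algorithmRecovers_of_treeDist (M : WeightedSemiLabeledTree V n) {d : Fin n → Fin n → ℝ}
    (hd : ∀ i j, d i j = treeDist M (M.label i) (M.label j)) :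
    AlgorithmRecovers M.maxDeg d M.toSemiLabeledTree := by
  intro root
  have hinv := fun t => inv_run (κ := M.maxDeg) hd root t
  refine ⟨fun t s hs hq => ?_, ?_⟩
  · have h := hinv t s hs
    rw [hq] at h
    exact h.recovers
  · refine PMF.tendsto_one_of_potential (step M.maxDeg) _ (fun t => rfl) potential _
      (p := ((max (n ^ M.maxDeg) 1 : ℕ) : ℝ≥0∞)⁻¹) ?_ ?_ ?_ ?_
    · exact ENNReal.inv_ne_zero.2 (ENNReal.natCast_ne_top _)
    · refine ne_top_of_le_ne_top (ENNReal.natCast_ne_top (potential (initState d root)))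
        (PMF.tsum_mul_le_of_support _ fun s hs => ?_)
      rw [run, PMF.mem_support_pure_iff] at hs
      rw [hs]
    · exact fun t s hs s' hs' => (hinv t s hs).potential_step_le hs'
    · exact fun t s hs hq => (hinv t s hs).le_toOuterMeasure_step hq

end TreeRecovery

/-! ## Orthant probabilities of bivariate Gaussian vectors -/

namespace ProbabilityTheory

open Real in
/-- The standard Gaussian measure of a planar cone is proportional to its opening angle. -/
theorem gaussianReal_prod_cone {S : Set (ℝ × ℝ)} (hS : MeasurableSet S) {Θ : Set ℝ}
    (hΘ : MeasurableSet Θ) (hΘ' : Θ ⊆ Set.Ioo (-π) π)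
    (h : ∀ r > 0, ∀ θ ∈ Set.Ioo (-π) π, (r * cos θ, r * sin θ) ∈ S ↔ θ ∈ Θ) :
    ((gaussianReal 0 1).prod (gaussianReal 0 1)) S =
      (∫⁻ r in Set.Ioi 0, ENNReal.ofReal r * ENNReal.ofReal ((2 * π)⁻¹ * exp (-r ^ 2 / 2))) *
        volume Θ := by
  have hone : (1 : ℝ≥0) ≠ 0 := one_ne_zero
  rw [gaussianReal_of_var_ne_zero 0 hone,
    prod_withDensity (measurable_gaussianPDF 0 1) (measurable_gaussianPDF 0 1),
    withDensity_apply _ hS, ← lintegral_indicator hS, ← Measure.volume_eq_prod,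
    ← lintegral_comp_polarCoord_symm, polarCoord_target]
  -- The product density depends on the radius only, so the integrand factorizes in polar
  -- coordinates.
  have key : ∀ p ∈ Set.Ioi (0 : ℝ) ×ˢ Set.Ioo (-π) π,
      ENNReal.ofReal p.1 • S.indicator (fun z : ℝ × ℝ => gaussianPDF 0 1 z.1 * gaussianPDF 0 1 z.2)
        (polarCoord.symm p) =
      (ENNReal.ofReal p.1 * ENNReal.ofReal ((2 * π)⁻¹ * exp (-p.1 ^ 2 / 2))) *
        Θ.indicator 1 p.2 := by
    rintro ⟨r, θ⟩ ⟨hr, hθ⟩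
    have hiff := h r hr θ hθ
    simp only [polarCoord_symm_apply, smul_eq_mul]
    by_cases hmem : θ ∈ Θ
    · rw [Set.indicator_of_mem (hiff.2 hmem), Set.indicator_of_mem hmem, Pi.one_apply, mul_one]
      congr 1
      rw [gaussianPDF, gaussianPDF, ← ENNReal.ofReal_mul (gaussianPDFReal_nonneg _ _ _)]
      congr 1
      simp only [gaussianPDFReal, sub_zero, NNReal.coe_one, mul_one]
      rw [mul_mul_mul_comm, ← mul_inv, mul_self_sqrt (by positivity), ← exp_add]
      congr 2
      nlinarith [sin_sq_add_cos_sq θ]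
    · rw [Set.indicator_of_notMem (fun hc => hmem (hiff.1 hc)), Set.indicator_of_notMem hmem]
      simp
  have hind : AEMeasurable (Θ.indicator (1 : ℝ → ℝ≥0∞)) (volume.restrict (Set.Ioo (-π) π)) :=
    (measurable_one.indicator hΘ).aemeasurable
  rw [setLIntegral_congr_fun (measurableSet_Ioi.prod measurableSet_Ioo) key,
    Measure.volume_eq_prod, ← Measure.prod_restrict]
  refine (lintegral_prod_mul (f := fun r : ℝ => ENNReal.ofReal r *
    ENNReal.ofReal ((2 * π)⁻¹ * exp (-r ^ 2 / 2))) (by fun_prop) hind).trans ?_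
  rw [lintegral_indicator_one hΘ, Measure.restrict_apply hΘ, Set.inter_eq_left.2 hΘ']

-- The radial integral is never evaluated: the cone of all directions has mass one, which forces its
-- value to be 1 / 2π.
open Real in
theorem measureReal_gaussianReal_prod_cone {S : Set (ℝ × ℝ)} (hS : MeasurableSet S) {a b : ℝ}
    (ha : -π ≤ a) (hab : a ≤ b) (hb : b ≤ π)
    (h : ∀ r > 0, ∀ θ ∈ Set.Ioo (-π) π, (r * cos θ, r * sin θ) ∈ S ↔ θ ∈ Set.Ioo a b) :
    ((gaussianReal 0 1).prod (gaussianReal 0 1)).real S = (b - a) / (2 * π) := by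
  have h1 := gaussianReal_prod_cone MeasurableSet.univ measurableSet_Ioo subset_rfl
    (Θ := Set.Ioo (-π) π) (fun r _ θ hθ => ⟨fun _ => hθ, fun _ => Set.mem_univ _⟩)
  have h2 := gaussianReal_prod_cone hS measurableSet_Ioo (Set.Ioo_subset_Ioo ha hb) h
  generalize (∫⁻ r in Set.Ioi (0 : ℝ),
    ENNReal.ofReal r * ENNReal.ofReal ((2 * π)⁻¹ * exp (-r ^ 2 / 2))) = c at h1 h2
  have h1' := congrArg ENNReal.toReal h1
  rw [measure_univ, Real.volume_Ioo, ENNReal.toReal_mul, ENNReal.toReal_one,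
    ENNReal.toReal_ofReal (by linarith [pi_pos])] at h1'
  rw [Measure.real, h2, Real.volume_Ioo, ENNReal.toReal_mul, ENNReal.toReal_ofReal (by linarith)]
  rw [eq_div_iff (by positivity)]
  linear_combination (-(b - a)) * h1'

open Real in
/-- The positive quadrant has probability `1 / 4 + arcsin ρ / 2π` under a centered Gaussian law with
correlation `ρ`. -/
theorem HasGaussianLaw.measureReal_pos_and_pos {Ω : Type*} [MeasurableSpace Ω] {P : Measure Ω}
    {U V : Ω → ℝ} (h : HasGaussianLaw (fun ω => (U ω, V ω)) P) (hU : P[U] = 0) (hV : P[V] = 0)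
    {a b φ : ℝ} (ha : 0 < a) (hb : 0 < b) (hφ : φ ∈ Set.Ioo (-(π / 2)) (π / 2))
    (hUU : Var[U; P] = a ^ 2) (hVV : Var[V; P] = b ^ 2) (hUV : cov[U, V; P] = a * b * sin φ) :
    P.real {ω | 0 < U ω ∧ 0 < V ω} = 1 / 4 + φ / (2 * π) := by
  have := h.isProbabilityMeasure
  have hcos : 0 < cos φ := cos_pos_of_mem_Ioo hφ
  have hU2 : MemLp U 2 P := h.fst.memLp_two
  have hV2 : MemLp V 2 P := h.snd.memLp_two
  have hUi : Integrable U P := h.fst.integrable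
  have hVi : Integrable V P := h.snd.integrable
  -- Gram–Schmidt: U = a G₁ and V = b (sin φ · G₁ + cos φ · G₂) with G₁, G₂ independent and standard
  -- normal.
  set G₁ : Ω → ℝ := fun ω => a⁻¹ * U ω with hG₁
  set G₂ : Ω → ℝ := fun ω => (b * cos φ)⁻¹ * V ω - (sin φ / (a * cos φ)) * U ω with hG₂
  have hG : HasGaussianLaw (fun ω => (G₁ ω, G₂ ω)) P :=
    h.map_fun (.prod (a⁻¹ • ContinuousLinearMap.fst ℝ ℝ ℝ)
      ((b * cos φ)⁻¹ • ContinuousLinearMap.snd ℝ ℝ ℝ -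
        (sin φ / (a * cos φ)) • ContinuousLinearMap.fst ℝ ℝ ℝ))
  have hsc := sin_sq_add_cos_sq φ
  have hVU : cov[V, U; P] = a * b * sin φ := by rw [covariance_comm, hUV]
  have e1 : Var[G₁; P] = 1 := by
    rw [hG₁, variance_const_mul, hUU]; field_simp
  have e2 : cov[G₁, G₂; P] = 0 := by
    rw [hG₁, hG₂, covariance_const_mul_left, covariance_fun_sub_right hU2 (hV2.const_mul _)
      (hU2.const_mul _), covariance_const_mul_right, covariance_const_mul_right, hUV,
      covariance_self hU2.aemeasurable, hUU]
    field_simp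
    ring
  have e3 : Var[G₂; P] = 1 := by
    rw [← covariance_self hG.snd.aemeasurable]
    nth_rewrite 1 [hG₂]
    rw [covariance_fun_sub_left (hV2.const_mul _) (hU2.const_mul _)
        hG.snd.memLp_two,
      covariance_const_mul_left, covariance_const_mul_left, hG₂,
      covariance_fun_sub_right hU2 (hV2.const_mul _) (hU2.const_mul _),
      covariance_fun_sub_right hV2 (hV2.const_mul _) (hU2.const_mul _),
      covariance_const_mul_right, covariance_const_mul_right, covariance_const_mul_right,
      covariance_const_mul_right, hUV, hVU, covariance_self hU2.aemeasurable,
      covariance_self hV2.aemeasurable, hUU, hVV]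
    field_simp
    linear_combination -hsc
  have m1 : P[G₁] = 0 := by rw [hG₁, integral_const_mul, hU, mul_zero]
  have m2 : P[G₂] = 0 := by
    rw [hG₂, integral_sub (hVi.const_mul _) (hUi.const_mul _), integral_const_mul,
      integral_const_mul, hU, hV]
    simp
  have hlaw : P.map (fun ω => (G₁ ω, G₂ ω)) = (gaussianReal 0 1).prod (gaussianReal 0 1) := by
    rw [(indepFun_iff_map_prod_eq_prod_map_map hG.fst.aemeasurable hG.snd.aemeasurable).1
      (hG.indepFun_of_covariance_eq_zero e2), hG.fst.map_eq_gaussianReal,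
      hG.snd.map_eq_gaussianReal, m1, m2, e1, e3, Real.toNNReal_one]
  have hS : MeasurableSet {p : ℝ × ℝ | 0 < p.1 ∧ 0 < sin φ * p.1 + cos φ * p.2} := by
    exact (measurableSet_lt measurable_const measurable_fst).inter
      (measurableSet_lt measurable_const (measurable_fst.const_mul _ |>.add
        (measurable_snd.const_mul _)))
  have hset : {ω | 0 < U ω ∧ 0 < V ω} =
      (fun ω => (G₁ ω, G₂ ω)) ⁻¹' {p : ℝ × ℝ | 0 < p.1 ∧ 0 < sin φ * p.1 + cos φ * p.2} := by
    ext ω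
    have hv : sin φ * G₁ ω + cos φ * G₂ ω = b⁻¹ * V ω := by
      simp only [hG₁, hG₂]; field_simp; ring
    simp only [Set.mem_preimage, Set.mem_ofPred_eq, hv]
    simp only [hG₁, mul_pos_iff_of_pos_left (inv_pos.2 ha), mul_pos_iff_of_pos_left (inv_pos.2 hb)]
  -- In polar coordinates the conditions are cos θ > 0 and sin (θ + φ) > 0, a cone from -φ to π/2 of
  -- opening π/2 + φ.
  rw [hset, ← map_measureReal_apply_of_aemeasurable hG.aemeasurable hS, hlaw,
    measureReal_gaussianReal_prod_cone hS (a := -φ) (b := π / 2) (by linarith [hφ.2, pi_pos])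
      (by linarith [hφ.1]) (by linarith [pi_pos])]
  · field_simp
    ring
  · rintro r hr θ ⟨hθ, hθ'⟩
    have e : sin φ * (r * cos θ) + cos φ * (r * sin θ) = r * sin (θ + φ) := by
      rw [sin_add]; ring
    simp only [Set.mem_ofPred_eq, e, mul_pos_iff_of_pos_left hr, Set.mem_Ioo]
    obtain ⟨hφ1, hφ2⟩ := hφ
    constructor
    · rintro ⟨h1, h2⟩
      have hlt : θ < π / 2 := by
        by_contra! hc
        exact absurd (cos_nonpos_of_pi_div_two_le_of_le hc (by linarith)) h1.not_ge
      have hgt : -(π / 2) < θ := by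
        by_contra! hc
        rw [← cos_neg] at h1
        exact absurd (cos_nonpos_of_pi_div_two_le_of_le (by linarith) (by linarith)) h1.not_ge
      refine ⟨?_, hlt⟩
      by_contra! hc
      exact absurd (sin_nonpos_of_nonpos_of_neg_pi_le (by linarith) (by linarith)) h2.not_ge
    · rintro ⟨h1, h2⟩
      exact ⟨cos_pos_of_mem_Ioo ⟨by linarith, h2⟩,
        sin_pos_of_pos_of_lt_pi (by linarith) (by linarith)⟩

end ProbabilityTheory

/-! ## The Kendall `τ` coefficient of Gaussian pairs -/

section Kendall

variable {Ω : Type*} [MeasurableSpace Ω] {P : Measure Ω} {X Y : Ω → ℝ}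

theorem kendallTau_comp_left_of_strictMono {f : ℝ → ℝ} (hf : StrictMono f) :
    kendallTau P (fun ω => f (X ω)) Y = kendallTau P X Y := by
  simp only [kendallTau, mul_pos_iff, mul_neg_iff, sub_pos, sub_neg, hf.lt_iff_lt]

theorem kendallTau_comp_left_of_strictAnti {f : ℝ → ℝ} (hf : StrictAnti f) :
    kendallTau P (fun ω => f (X ω)) Y = -kendallTau P X Y := by
  simp only [kendallTau, mul_pos_iff, mul_neg_iff, sub_pos, sub_neg, hf.lt_iff_gt, neg_sub]
  simp only [or_comm]

theorem kendallTau_comm : kendallTau P X Y = kendallTau P Y X := by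
  simp only [kendallTau, mul_comm]

theorem abs_sin_kendallTau_comp_left {f : ℝ → ℝ} (hf : StrictMono f ∨ StrictAnti f) :
    |Real.sin (Real.pi / 2 * kendallTau P (fun ω => f (X ω)) Y)| =
      |Real.sin (Real.pi / 2 * kendallTau P X Y)| := by
  rcases hf with hf | hf
  · rw [kendallTau_comp_left_of_strictMono hf]
  · rw [kendallTau_comp_left_of_strictAnti hf, mul_neg, Real.sin_neg, abs_neg]

theorem abs_sin_kendallTau_comp {f g : ℝ → ℝ} (hf : StrictMono f ∨ StrictAnti f)
    (hg : StrictMono g ∨ StrictAnti g) :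
    |Real.sin (Real.pi / 2 * kendallTau P (fun ω => f (X ω)) (fun ω => g (Y ω)))| =
      |Real.sin (Real.pi / 2 * kendallTau P X Y)| := by
  rw [abs_sin_kendallTau_comp_left hf, kendallTau_comm, abs_sin_kendallTau_comp_left hg,
    kendallTau_comm]

theorem covariance_sub_copy [IsProbabilityMeasure P] (hX : MemLp X 2 P) (hY : MemLp Y 2 P) :
    cov[fun p : Ω × Ω => X p.1 - X p.2, fun p => Y p.1 - Y p.2; P.prod P] = 2 * cov[X, Y; P] := by
  have hX1 : MemLp (fun p : Ω × Ω => X p.1) 2 (P.prod P) := hX.comp_fst P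
  have hX2 : MemLp (fun p : Ω × Ω => X p.2) 2 (P.prod P) := hX.comp_snd P
  have hY1 : MemLp (fun p : Ω × Ω => Y p.1) 2 (P.prod P) := hY.comp_fst P
  have hY2 : MemLp (fun p : Ω × Ω => Y p.2) 2 (P.prod P) := hY.comp_snd P
  have h1 : cov[fun p : Ω × Ω => X p.1, fun p => Y p.1; P.prod P] = cov[X, Y; P] := by
    have := covariance_map_fun (μ := P.prod P) (Z := Prod.fst) (X := X) (Y := Y)
      (by simpa using hX.aestronglyMeasurable) (by simpa using hY.aestronglyMeasurable)
      measurable_fst.aemeasurable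
    simpa using this.symm
  have h2 : cov[fun p : Ω × Ω => X p.2, fun p => Y p.2; P.prod P] = cov[X, Y; P] := by
    have := covariance_map_fun (μ := P.prod P) (Z := Prod.snd) (X := X) (Y := Y)
      (by simpa using hX.aestronglyMeasurable) (by simpa using hY.aestronglyMeasurable)
      measurable_snd.aemeasurable
    simpa using this.symm
  have h3 : cov[fun p : Ω × Ω => X p.1, fun p => Y p.2; P.prod P] = 0 :=
    covariance_fst_snd_prod hX hY
  have h4 : cov[fun p : Ω × Ω => X p.2, fun p => Y p.1; P.prod P] = 0 := by
    rw [covariance_comm]; exact covariance_fst_snd_prod hY hX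
  rw [covariance_fun_sub_fun_sub hX1 hX2 hY1 hY2, h1, h2, h3, h4]
  ring

theorem variance_sub_copy [IsProbabilityMeasure P] (hX : MemLp X 2 P) :
    Var[fun p : Ω × Ω => X p.1 - X p.2; P.prod P] = 2 * Var[X; P] := by
  rw [← covariance_self hX.aemeasurable, ← covariance_sub_copy hX hX, covariance_self]
  exact ((hX.comp_fst P).sub (hX.comp_snd P)).aemeasurable

theorem integral_sub_copy [IsProbabilityMeasure P] (hX : Integrable X P) :
    ∫ p : Ω × Ω, (X p.1 - X p.2) ∂(P.prod P) = 0 := by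
  rw [integral_sub (hX.comp_fst P) (hX.comp_snd P), integral_fun_fst, integral_fun_snd]
  simp

theorem ProbabilityTheory.HasGaussianLaw.sub_copy {E : Type*} [NormedAddCommGroup E]
    [NormedSpace ℝ E] [MeasurableSpace E] [BorelSpace E] [SecondCountableTopology E]
    [CompleteSpace E] {A : Ω → E} (h : HasGaussianLaw A P) :
    HasGaussianLaw (fun p : Ω × Ω => A p.1 - A p.2) (P.prod P) := by
  have := h.isProbabilityMeasure
  have h1 : HasGaussianLaw (fun p : Ω × Ω => A p.1) (P.prod P) := ⟨by
    have e : (P.prod P).map (fun p : Ω × Ω => A p.1) = P.map A := by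
      change (P.prod P).map (A ∘ Prod.fst) = _
      rw [← AEMeasurable.map_map_of_aemeasurable (by simpa using h.aemeasurable)
        measurable_fst.aemeasurable]
      simp
    rw [e]; exact h.isGaussian_map⟩
  have h2 : HasGaussianLaw (fun p : Ω × Ω => A p.2) (P.prod P) := ⟨by
    have e : (P.prod P).map (fun p : Ω × Ω => A p.2) = P.map A := by
      change (P.prod P).map (A ∘ Prod.snd) = _
      rw [← AEMeasurable.map_map_of_aemeasurable (by simpa using h.aemeasurable)
        measurable_snd.aemeasurable]
      simp
    rw [e]; exact h.isGaussian_map⟩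
  exact ((indepFun_prod₀ h.aemeasurable h.aemeasurable).hasGaussianLaw h1 h2).sub

-- The difference of two copies is a centred Gaussian pair with correlation sin φ. Concordance is
-- the union of two opposite quadrants, of probability 1/4 + φ/2π each; discordance is that of the
-- other two, where φ becomes -φ. The difference is 2φ/π.
open Real in
theorem kendallTau_eq_of_hasGaussianLaw (h : HasGaussianLaw (fun ω => (X ω, Y ω)) P)
    {a b φ : ℝ} (ha : 0 < a) (hb : 0 < b) (hφ : φ ∈ Set.Ioo (-(π / 2)) (π / 2))
    (hX : Var[X; P] = a ^ 2) (hY : Var[Y; P] = b ^ 2) (hXY : cov[X, Y; P] = a * b * sin φ) :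
    π / 2 * kendallTau P X Y = φ := by
  have := h.isProbabilityMeasure
  set U : Ω × Ω → ℝ := fun p => X p.1 - X p.2 with hU
  set V : Ω × Ω → ℝ := fun p => Y p.1 - Y p.2 with hV
  have hUV : HasGaussianLaw (fun p => (U p, V p)) (P.prod P) := h.sub_copy
  have hUnV : HasGaussianLaw (fun p => (U p, -V p)) (P.prod P) :=
    hUV.map_fun (.prod (ContinuousLinearMap.fst ℝ ℝ ℝ) (-ContinuousLinearMap.snd ℝ ℝ ℝ))
  have hnUV : HasGaussianLaw (fun p => (-U p, V p)) (P.prod P) :=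
    hUV.map_fun (.prod (-ContinuousLinearMap.fst ℝ ℝ ℝ) (ContinuousLinearMap.snd ℝ ℝ ℝ))
  have hnUnV : HasGaussianLaw (fun p => (-U p, -V p)) (P.prod P) := hUV.neg
  have eU : ∫ p, U p ∂(P.prod P) = 0 := integral_sub_copy h.fst.integrable
  have eV : ∫ p, V p ∂(P.prod P) = 0 := integral_sub_copy h.snd.integrable
  have enU : ∫ p, -U p ∂(P.prod P) = 0 := by rw [integral_neg, eU, neg_zero]
  have enV : ∫ p, -V p ∂(P.prod P) = 0 := by rw [integral_neg, eV, neg_zero]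
  have vU : Var[U; P.prod P] = (√2 * a) ^ 2 := by
    rw [hU, variance_sub_copy h.fst.memLp_two, hX, mul_pow, sq_sqrt zero_le_two]
  have vV : Var[V; P.prod P] = (√2 * b) ^ 2 := by
    rw [hV, variance_sub_copy h.snd.memLp_two, hY, mul_pow, sq_sqrt zero_le_two]
  have vnU : Var[fun p => -U p; P.prod P] = (√2 * a) ^ 2 := by rw [variance_fun_neg, vU]
  have vnV : Var[fun p => -V p; P.prod P] = (√2 * b) ^ 2 := by rw [variance_fun_neg, vV]
  have cUV : cov[U, V; P.prod P] = √2 * a * (√2 * b) * sin φ := by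
    rw [hU, hV, covariance_sub_copy h.fst.memLp_two h.snd.memLp_two, hXY]
    linear_combination (-(a * b * sin φ)) * mul_self_sqrt (zero_le_two (α := ℝ))
  have hφ' : -φ ∈ Set.Ioo (-(π / 2)) (π / 2) := ⟨by linarith [hφ.2], by linarith [hφ.1]⟩
  have ha' : 0 < √2 * a := by positivity
  have hb' : 0 < √2 * b := by positivity
  have q1 := hUV.measureReal_pos_and_pos eU eV ha' hb' hφ vU vV cUV
  have q2 := hnUnV.measureReal_pos_and_pos enU enV ha' hb' hφ vnU vnV
    (by rw [covariance_fun_neg_left, covariance_fun_neg_right, cUV, neg_neg])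
  have q3 := hUnV.measureReal_pos_and_pos eU enV ha' hb' hφ' vU vnV
    (by rw [covariance_fun_neg_right, cUV, sin_neg, mul_neg])
  have q4 := hnUV.measureReal_pos_and_pos enU eV ha' hb' hφ' vnU vV
    (by rw [covariance_fun_neg_left, cUV, sin_neg, mul_neg])
  simp only [Left.neg_pos_iff] at q2 q3 q4
  have hUm : AEMeasurable U (P.prod P) := hUV.fst.aemeasurable
  have hVm : AEMeasurable V (P.prod P) := hUV.snd.aemeasurable
  have hc : (P.prod P).real {p | 0 < U p * V p} = 1 / 4 + φ / (2 * π) + (1 / 4 + φ / (2 * π)) := by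
    rw [← q1]
    nth_rewrite 2 [q1]
    rw [← q2, ← measureReal_union₀]
    · congr 1
      ext p
      exact mul_pos_iff (a := U p) (b := V p)
    · exact (nullMeasurableSet_lt hUm aemeasurable_const).inter
        (nullMeasurableSet_lt hVm aemeasurable_const)
    · refine Disjoint.aedisjoint (Set.disjoint_left.2 fun p hp hp' => ?_)
      exact lt_asymm hp.1 hp'.1
  have hd : (P.prod P).real {p | U p * V p < 0} =
      1 / 4 + -φ / (2 * π) + (1 / 4 + -φ / (2 * π)) := by
    rw [← q3]
    nth_rewrite 2 [q3]
    rw [← q4, ← measureReal_union₀]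
    · congr 1
      ext p
      exact mul_neg_iff (a := U p) (b := V p)
    · exact (nullMeasurableSet_lt hUm aemeasurable_const).inter
        (nullMeasurableSet_lt aemeasurable_const hVm)
    · refine Disjoint.aedisjoint (Set.disjoint_left.2 fun p hp hp' => ?_)
      exact lt_asymm hp.1 hp'.1
  rw [kendallTau, hc, hd]
  field_simp
  ring

/-- The quadrant computation excludes correlation one. Here it is enough that ties have probability
zero. -/
theorem kendallTau_self_of_hasGaussianLaw (h : HasGaussianLaw X P) (hX : 0 < Var[X; P]) :
    kendallTau P X X = 1 := by
  have := h.isProbabilityMeasure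
  set U : Ω × Ω → ℝ := fun p => X p.1 - X p.2 with hU
  have hUg : HasGaussianLaw U (P.prod P) := h.sub_copy
  have h0 : (P.prod P) {p | U p = 0} = 0 := by
    have e := hUg.map_eq_gaussianReal
    have hv : Var[U; P.prod P].toNNReal ≠ 0 := by
      rw [hU, variance_sub_copy h.memLp_two]
      exact (Real.toNNReal_pos.2 (by linarith)).ne'
    have := nullSingletonClass_gaussianReal (μ := ∫ p, U p ∂(P.prod P)) hv
    have h1 : (P.prod P).map U {0} = 0 := by rw [e]; exact measure_singleton 0
    rwa [Measure.map_apply_of_aemeasurable hUg.aemeasurable (measurableSet_singleton 0)] at h1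
  have h1 : (P.prod P).real {p | 0 < U p * U p} = 1 := by
    have : {p | 0 < U p * U p} = {p | U p = 0}ᶜ := by
      ext p; simp [mul_self_pos]
    rw [this, Measure.real, (prob_compl_eq_one_iff₀ (.of_null h0)).2 h0, ENNReal.toReal_one]
  have h2 : {p | U p * U p < 0} = ∅ := by
    ext p; simp [mul_self_nonneg]
  rw [kendallTau, h1, h2]
  simp

end Kendall

/-! ## The Markov property of factorizing densities -/

namespace MeasureTheory

theorem lmarginal_mul_of_dependsOn {V : Type*} [DecidableEq V] {s : Finset V}
    {f h : (V → ℝ) → ℝ≥0∞} (hf : Measurable f) {t : Set V} (hh : DependsOn h t)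
    (hst : ∀ v ∈ t, v ∉ s) :
    lmarginal (fun _ => volume) s (fun x => h x * f x) =
      fun x => h x * lmarginal (fun _ => volume) s f x := by
  ext x
  have e : ∀ y, h (Function.updateFinset x s y) = h x := fun y =>
    hh fun v hv => by simp [Function.updateFinset, hst v hv]
  simp only [lmarginal, e]
  exact lintegral_const_mul _ (hf.comp measurable_updateFinset)

theorem _root_.DependsOn.lmarginal {V : Type*} [DecidableEq V] {s : Finset V}
    {f : (V → ℝ) → ℝ≥0∞} {t : Set V} (hf : DependsOn f t) :
    DependsOn (lmarginal (fun _ => volume) s f) t := by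
  intro x y hxy
  refine lintegral_congr fun u => hf fun v hv => ?_
  by_cases h : v ∈ s <;> simp [Function.updateFinset, h, hxy v hv]

variable {V : Type*} [Fintype V] [DecidableEq V]

/-- The integral of a product in which only the variable `w` is shared by the factors. -/
theorem lintegral_mul_of_dependsOn {A : Finset V} {w : V} (hw : w ∉ A) {F H : (V → ℝ) → ℝ≥0∞}
    (hF : Measurable F) (hH : Measurable H) (hFd : DependsOn F (insert w A))
    (hHd : DependsOn H (A : Set V)ᶜ) :
    ∫⁻ z, F z * H z =
      ∫⁻ t : ℝ, lmarginal (fun _ => volume) A F (Function.update 0 w t) *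
        lmarginal (fun _ => volume) (insert w A)ᶜ H (Function.update 0 w t) := by
  have hdisj : Disjoint A (insert w A)ᶜ := by
    rw [Finset.disjoint_left]; intro x hx hx'
    exact Finset.mem_compl.1 hx' (Finset.mem_insert_of_mem hx)
  have hu : (Finset.univ : Finset V) = insert w (A ∪ (insert w A)ᶜ) := by
    ext x
    simp only [Finset.mem_univ, Finset.mem_insert, Finset.mem_union, Finset.mem_compl, true_iff]
    tauto
  have hwn : w ∉ A ∪ (insert w A)ᶜ := by simp [hw]
  have hFH : Measurable fun z => H z * F z := hH.mul hF
  have h1 : lmarginal (fun _ => volume) (A ∪ (insert w A)ᶜ) (fun z => H z * F z) =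
      fun z => lmarginal (fun _ => volume) A F z * lmarginal (fun _ => volume) (insert w A)ᶜ H z := by
    rw [lmarginal_union' _ _ hFH hdisj, lmarginal_mul_of_dependsOn hF hHd (fun v hv => hv)]
    simp_rw [mul_comm (H _)]
    exact lmarginal_mul_of_dependsOn hH hFd.lmarginal (fun v hv hv' => by
      rw [Finset.mem_compl] at hv'
      exact hv' (by simpa using hv))
  simp_rw [mul_comm (F _)]
  rw [volume_pi, lintegral_eq_lmarginal_univ (0 : V → ℝ), hu, lmarginal_insert _ hFH hwn, h1]

/-- Conditional independence given the separating coordinate `w`: a function of `A ∪ {w}` that is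
independent of the coordinate `w` is independent of all functions of the complement of `A`. -/
theorem lintegral_mul_eq_of_separated {A : Finset V} {w : V} (hw : w ∉ A)
    {g h : (V → ℝ) → ℝ≥0∞} (hg : Measurable g) (hh : Measurable h)
    (hgd : DependsOn g (insert w A)) (hhd : DependsOn h (A : Set V)ᶜ)
    (hone : ∫⁻ z, g z * h z = 1)
    {F H : (V → ℝ) → ℝ≥0∞} (hF : Measurable F) (hH : Measurable H)
    (hFd : DependsOn F (insert w A)) (hHd : DependsOn H (A : Set V)ᶜ) (hF1 : F ≤ 1) (hH1 : H ≤ 1)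
    (hind : ∀ W : Set ℝ, MeasurableSet W → ∫⁻ z, (g z * h z) * (F z * W.indicator 1 (z w)) =
      (∫⁻ z, (g z * h z) * F z) * ∫⁻ z, (g z * h z) * W.indicator 1 (z w)) :
    ∫⁻ z, (g z * h z) * (F z * H z) =
      (∫⁻ z, (g z * h z) * F z) * ∫⁻ z, (g z * h z) * H z := by
  -- `LA` integrates out the coordinates in `A`, and `LB` those outside `A ∪ {w}`; the coordinate
  -- `w` is kept as `t`.
  set LA : ((V → ℝ) → ℝ≥0∞) → ℝ → ℝ≥0∞ := fun f t =>
    lmarginal (fun _ => volume) A f (Function.update 0 w t) with hLA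
  set LB : ((V → ℝ) → ℝ≥0∞) → ℝ → ℝ≥0∞ := fun f t =>
    lmarginal (fun _ => volume) (insert w A)ᶜ f (Function.update 0 w t) with hLB
  have hupd : Measurable fun t : ℝ => Function.update (0 : V → ℝ) w t := measurable_update 0
  have mul_dep : ∀ {f k : (V → ℝ) → ℝ≥0∞} {s : Set V}, DependsOn f s → DependsOn k s →
      DependsOn (fun z => f z * k z) s := fun hf hk x y hxy => by
    simp only [hf hxy, hk hxy]
  set c := ∫⁻ z, (g z * h z) * F z with hc
  have hgF : Measurable fun z => g z * F z := hg.mul hF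
  have hhH : Measurable fun z => h z * H z := hh.mul hH
  have hgFd := mul_dep hgd hFd
  have hhHd := mul_dep hhd hHd
  have mA : ∀ {f}, Measurable f → Measurable (LA f) := fun hf => (hf.lmarginal _).comp hupd
  have mB : ∀ {f}, Measurable f → Measurable (LB f) := fun hf => (hf.lmarginal _).comp hupd
  have window : ∀ (W : Set ℝ), MeasurableSet W → ∀ {f : (V → ℝ) → ℝ≥0∞}, Measurable f →
      DependsOn f (insert w A) →
      ∫⁻ z, (f z * h z) * W.indicator 1 (z w) = ∫⁻ t in W, LA f t * LB h t := by
    intro W hW f hf hfd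
    have hWm : Measurable fun z : V → ℝ => W.indicator (1 : ℝ → ℝ≥0∞) (z w) :=
      (measurable_one.indicator hW).comp (measurable_pi_apply w)
    have hWd : DependsOn (fun z : V → ℝ => W.indicator (1 : ℝ → ℝ≥0∞) (z w)) {w} :=
      fun x y hxy => by simp only [hxy w rfl]
    have e1 : ∀ z, (f z * h z) * W.indicator 1 (z w) = (W.indicator 1 (z w) * f z) * h z :=
      fun z => by ring
    have hWd' : DependsOn (fun z : V → ℝ => W.indicator (1 : ℝ → ℝ≥0∞) (z w)) (insert w A) :=
      fun x y hxy => hWd fun v hv => hxy v (by simp_all)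
    simp_rw [e1]
    have hWf : Measurable fun z : V → ℝ => W.indicator (1 : ℝ → ℝ≥0∞) (z w) * f z := hWm.mul hf
    rw [lintegral_mul_of_dependsOn hw hWf hh (mul_dep hWd' hfd) hhd,
      lmarginal_mul_of_dependsOn hf hWd (by simpa using hw), ← lintegral_indicator hW]
    refine lintegral_congr fun t => ?_
    by_cases ht : t ∈ W <;> simp [ht, hLA, hLB]
  have hfin : ∫⁻ t, LA g t * LB h t = 1 := by
    rw [← hone, lintegral_mul_of_dependsOn hw hg hh hgd hhd]
  have mAB : Measurable fun t => LA g t * LB h t := (mA hg).mul (mB hh)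
  have mAB' : Measurable fun t => LA g t * LB (fun z => h z * H z) t := (mA hg).mul (mB hhH)
  -- Independence of `F` from the coordinate `w`, tested on windows `W`, says that the conditional
  -- mean of `F` given `w` is the constant `c`.
  have ae1 : ∀ᵐ t : ℝ, LA (fun z => g z * F z) t * LB h t = c * (LA g t * LB h t) := by
    refine ae_eq_of_forall_setLIntegral_eq_of_sigmaFinite ((mA hgF).mul (mB hh))
      (mAB.const_mul c) fun W hW _ => ?_
    rw [lintegral_const_mul _ mAB, ← window W hW hgF hgFd, ← window W hW hg hgd,
      ← hind W hW]
    exact lintegral_congr fun z => by ring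
  have ae2 : ∀ᵐ t : ℝ, LA g t * LB h t < ∞ :=
    ae_lt_top mAB (by rw [hfin]; exact ENNReal.one_ne_top)
  have hA : ∀ t, LA (fun z => g z * F z) t ≤ LA g t := fun t =>
    lmarginal_mono (fun z => mul_le_of_le_one_right' (hF1 z)) _
  have hB : ∀ t, LB (fun z => h z * H z) t ≤ LB h t := fun t =>
    lmarginal_mono (fun z => mul_le_of_le_one_right' (hH1 z)) _
  -- The factor `LB h t` is cancelled. Where it is 0 or ∞, the bounds F ≤ 1 and H ≤ 1 make both
  -- sides vanish, at ∞ because `LA g t * LB h t` is finite almost everywhere.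
  have ae3 : ∀ᵐ t : ℝ, LA (fun z => g z * F z) t * LB (fun z => h z * H z) t =
      c * (LA g t * LB (fun z => h z * H z) t) := by
    filter_upwards [ae1, ae2] with t h1 h2
    by_cases h0 : LB h t = 0
    · have : LB (fun z => h z * H z) t = 0 := le_antisymm (h0 ▸ hB t) zero_le
      simp [this]
    by_cases hi : LB h t = ∞
    · have hg0 : LA g t = 0 := by
        by_contra hne
        rw [hi, ENNReal.mul_top hne] at h2
        exact lt_irrefl _ h2
      have : LA (fun z => g z * F z) t = 0 := le_antisymm (hg0 ▸ hA t) zero_le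
      simp [this, hg0]
    · rw [← mul_assoc, ENNReal.mul_left_inj h0 hi] at h1
      rw [h1, mul_assoc]
  calc ∫⁻ z, (g z * h z) * (F z * H z) = ∫⁻ z, (g z * F z) * (h z * H z) :=
        lintegral_congr fun z => by ring
    _ = ∫⁻ t, LA (fun z => g z * F z) t * LB (fun z => h z * H z) t :=
        lintegral_mul_of_dependsOn hw hgF hhH hgFd hhHd
    _ = ∫⁻ t, c * (LA g t * LB (fun z => h z * H z) t) := lintegral_congr_ae ae3
    _ = c * ∫⁻ z, g z * (h z * H z) := by
        rw [lintegral_const_mul _ mAB',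
          lintegral_mul_of_dependsOn hw hg hhH hgd hhHd]
    _ = c * ∫⁻ z, (g z * h z) * H z := by simp_rw [mul_assoc]

end MeasureTheory

namespace ProbabilityTheory

variable {V : Type*} [Fintype V] [DecidableEq V]

/-- Meant for the residual `R` of the regression of a coordinate in `A` on the coordinate `w`: it
involves `w`, but is independent of it. -/
theorem IndepFun.of_separated {A : Finset V} {w : V} (hw : w ∉ A)
    {g h : (V → ℝ) → ℝ≥0∞} (hg : Measurable g) (hh : Measurable h)
    (hgd : DependsOn g (insert w A)) (hhd : DependsOn h (A : Set V)ᶜ)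
    {μ : Measure (V → ℝ)} [IsProbabilityMeasure μ]
    (hμ : μ = volume.withDensity (fun z => g z * h z))
    {R Y : (V → ℝ) → ℝ} (hR : Measurable R) (hY : Measurable Y)
    (hRd : DependsOn R (insert w A)) (hYd : DependsOn Y (A : Set V)ᶜ)
    (hind : IndepFun R (fun z => z w) μ) : IndepFun R Y μ := by
  have hgh : Measurable fun z => g z * h z := hg.mul hh
  have key : ∀ {f : (V → ℝ) → ℝ} (_ : Measurable f) {S : Set ℝ} (_ : MeasurableSet S),
      ∫⁻ z, (g z * h z) * S.indicator 1 (f z) = μ (f ⁻¹' S) := by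
    intro f hf S hS
    have hm : Measurable fun z => S.indicator (1 : ℝ → ℝ≥0∞) (f z) :=
      (measurable_one.indicator hS).comp hf
    rw [← lintegral_indicator_one (hf hS), hμ, lintegral_withDensity_eq_lintegral_mul _ hgh
      (measurable_one.indicator (hf hS))]
    rfl
  have key2 : ∀ {f k : (V → ℝ) → ℝ} (_ : Measurable f) (_ : Measurable k) {S K : Set ℝ}
      (_ : MeasurableSet S) (_ : MeasurableSet K),
      ∫⁻ z, (g z * h z) * (S.indicator 1 (f z) * K.indicator 1 (k z)) =
        μ (f ⁻¹' S ∩ k ⁻¹' K) := by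
    intro f k hf hk S K hS hK
    rw [← lintegral_indicator_one ((hf hS).inter (hk hK)), hμ,
      lintegral_withDensity_eq_lintegral_mul _ hgh
      (measurable_one.indicator ((hf hS).inter (hk hK)))]
    refine lintegral_congr fun z => ?_
    rw [Set.inter_indicator_one]
    rfl
  rw [indepFun_iff_measure_inter_preimage_eq_mul] at hind ⊢
  intro S K hS hK
  have hz : Measurable fun z : V → ℝ => z w := measurable_pi_apply w
  have hone : ∫⁻ z, g z * h z = 1 := by
    rw [← measure_univ (μ := μ), hμ, withDensity_apply _ MeasurableSet.univ, Measure.restrict_univ]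
  rw [← key2 hR hY hS hK, ← key hR hS, ← key hY hK]
  refine lintegral_mul_eq_of_separated hw hg hh hgd hhd hone
    ((measurable_one.indicator hS).comp hR) ((measurable_one.indicator hK).comp hY)
    (fun x y hxy => by simp only [hRd hxy]) (fun x y hxy => by simp only [hYd hxy])
    (fun z => Set.indicator_le_self _ _ _) (fun z => Set.indicator_le_self _ _ _) fun W hW => ?_
  rw [key2 hR hz hS hW, key hR hS, key hz hW]
  exact hind S W hS hW

end ProbabilityTheory

/-! ## Correlations in Gaussian tree models -/

/-- `A` is the branch of `u` at `w`, which edges leave only towards `w`. Unit edge lengths give a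
metric in which to define it. -/
theorem SimpleGraph.IsTree.exists_separated {V : Type*} [Finite V] {G : SimpleGraph V}
    (hG : G.IsTree) {u v w : V} {p : G.Walk u v} (hp : p.IsPath) (hw : w ∈ p.support)
    (hne : u ≠ w) :
    ∃ A : Set V, u ∈ A ∧ w ∉ A ∧ v ∉ A ∧ ∀ x ∈ A, ∀ y, G.Adj x y → y = w ∨ y ∈ A := by
  have hℓ : ∀ e ∈ G.edgeSet, (0 : ℝ) < (fun _ => 1) e := fun _ _ => one_pos
  have hD := hG.isTreeMetric_pathDist hℓ
  refine ⟨{x | ¬ Betw (hG.pathDist fun _ => 1) x w u}, hD.not_betw_self hne,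
    fun h => h (hD.betw_left _ _),
    fun h => h (hD.betw_comm.1 ((hG.betw_iff_mem_support hℓ hp).2 hw)), fun x hx y hxy => ?_⟩
  by_contra! hcon
  obtain ⟨hyw, hy⟩ := hcon
  have hy : Betw (hG.pathDist fun _ => 1) y w u := by simpa using hy
  rcases hD.branch _ _ _ hy x with h | h
  · rcases ((hG.adj_iff_forall_betw hℓ).1 hxy).2 w h with rfl | rfl
    · exact hx (hD.betw_left _ _)
    · exact hyw rfl
  · exact hx h

namespace ProbabilityTheory

variable {V : Type*} [Fintype V]

/-- A nonzero linear functional of a nondegenerate Gaussian vector has positive variance. -/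
theorem variance_pos_of_absolutelyContinuous {μ : Measure (V → ℝ)} [IsGaussian μ]
    (hμ : μ ≪ volume) (L : (V → ℝ) →L[ℝ] ℝ) (hL : L ≠ 0) : 0 < Var[L; μ] := by
  refine (variance_nonneg _ _).lt_of_ne fun h0 => ?_
  have hL2 : MemLp L 2 μ := (IsGaussian.hasGaussianLaw_id.map L).memLp_two
  have hae := ae_eq_integral_of_variance_eq_zero hL2 h0.symm
  set m := ∫ z, L z ∂μ
  have hcon : ∃ p, L p = m := by
    have := hae.exists
    exact this
  obtain ⟨p, hp⟩ := hcon
  have hker : LinearMap.ker L.toLinearMap ≠ ⊤ := by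
    rw [Ne, LinearMap.ker_eq_top]
    exact fun h => hL (ContinuousLinearMap.coe_injective h)
  -- Zero variance would concentrate the law on a hyperplane, which is a Lebesgue null set.
  have hnull : volume {z | L z = m} = 0 := by
    have := Measure.addHaar_affineSubspace (volume : Measure (V → ℝ))
      (AffineSubspace.mk' p (LinearMap.ker L.toLinearMap)) (fun h => hker (by
        rw [← AffineSubspace.direction_mk' p (LinearMap.ker L.toLinearMap), h,
          AffineSubspace.direction_top]))
    convert this using 2
    ext z
    simp [AffineSubspace.mem_mk', ← hp, sub_eq_zero]
  have h1 : ∀ᵐ z ∂μ, L z ≠ m := by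
    rw [ae_iff]
    simpa using hμ hnull
  obtain ⟨z, hz, hz'⟩ := (hae.and h1).exists
  exact hz' hz

end ProbabilityTheory

namespace IsGaussianGraphicalModel

variable {V Ω : Type*} [Fintype V] [MeasurableSpace Ω] {G : SimpleGraph V} {P : Measure Ω}
  {Z : V → Ω → ℝ}

theorem measurable_pi (hZ : IsGaussianGraphicalModel G P Z) :
    Measurable fun ω => fun v => Z v ω :=
  measurable_pi_iff.2 hZ.measurable

theorem absolutelyContinuous (hZ : IsGaussianGraphicalModel G P Z) :
    P.map (fun ω => fun v => Z v ω) ≪ volume := by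
  obtain ⟨φ, ψ, -, -, -, h⟩ := hZ.factorizes
  rw [h]
  exact withDensity_absolutelyContinuous _ _

theorem memLp (hZ : IsGaussianGraphicalModel G P Z) (v : V) : MemLp (Z v) 2 P :=
  (hZ.gaussian.eval v).memLp_two

theorem variance_sub_pos (hZ : IsGaussianGraphicalModel G P Z) {u v : V} (huv : u ≠ v) (β : ℝ) :
    0 < Var[fun ω => Z u ω - β * Z v ω; P] := by
  have := hZ.gaussian.isGaussian_map
  have := variance_pos_of_absolutelyContinuous hZ.absolutelyContinuous
    (ContinuousLinearMap.proj u - β • ContinuousLinearMap.proj v) (fun h => by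
      classical
      have := DFunLike.congr_fun h (Pi.single u 1)
      simp [huv.symm] at this)
  rwa [variance_map (by fun_prop) hZ.measurable_pi.aemeasurable] at this

theorem variance_pos (hZ : IsGaussianGraphicalModel G P Z) (u : V) : 0 < Var[Z u; P] := by
  have := hZ.gaussian.isGaussian_map
  have := variance_pos_of_absolutelyContinuous hZ.absolutelyContinuous
    (ContinuousLinearMap.proj u) (fun h => by
      classical
      have := DFunLike.congr_fun h (Pi.single u 1)
      simp at this)
  rwa [variance_map (by fun_prop) hZ.measurable_pi.aemeasurable] at this

/-- Strict Cauchy–Schwarz, because the residual of the regression of `Z u` on `Z v` has positive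
variance. It makes the edge lengths positive. -/
theorem covariance_sq_lt [IsProbabilityMeasure P] (hZ : IsGaussianGraphicalModel G P Z) {u v : V}
    (huv : u ≠ v) : cov[Z u, Z v; P] ^ 2 < Var[Z u; P] * Var[Z v; P] := by
  have hv := hZ.variance_pos v
  have h := hZ.variance_sub_pos huv (cov[Z u, Z v; P] / Var[Z v; P])
  rw [variance_fun_sub (hZ.memLp u) ((hZ.memLp v).const_mul _), variance_const_mul,
    covariance_const_mul_right] at h
  have e : Var[Z u; P] - 2 * (cov[Z u, Z v; P] / Var[Z v; P] * cov[Z u, Z v; P]) +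
      (cov[Z u, Z v; P] / Var[Z v; P]) ^ 2 * Var[Z v; P] =
      (Var[Z u; P] * Var[Z v; P] - cov[Z u, Z v; P] ^ 2) / Var[Z v; P] := by
    field_simp
    ring
  rw [e] at h
  linarith [(div_pos_iff_of_pos_right hv).1 h]

/-- The density of a graphical model splits into two factors that share only the variable `w` of a
separating vertex. -/
theorem exists_factorization [DecidableEq V] (hZ : IsGaussianGraphicalModel G P Z) {A : Finset V}
    {w : V} (hA : ∀ x ∈ A, ∀ y, G.Adj x y → y = w ∨ y ∈ A) :
    ∃ g h : (V → ℝ) → ℝ≥0∞, Measurable g ∧ Measurable h ∧ DependsOn g (insert w A) ∧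
      DependsOn h (A : Set V)ᶜ ∧
      P.map (fun ω => fun v => Z v ω) = volume.withDensity (fun z => g z * h z) := by
  classical
  obtain ⟨φ, ψ, hφ, hψ, hψd, hd⟩ := hZ.factorizes
  -- An edge not contained in `A ∪ {w}` does not meet `A`, since neighbours of `A` are in `A ∪ {w}`.
  -- The vertex potential of `w` goes to the second factor.
  set E₁ := G.edgeFinset.filter fun e => ∀ v ∈ e, v ∈ insert w A with hE₁
  set E₂ := G.edgeFinset.filter fun e => ¬ ∀ v ∈ e, v ∈ insert w A with hE₂
  refine ⟨fun z => ((∏ v ∈ A, φ v (z v)) * ∏ e ∈ E₁, ψ e z : ℝ≥0),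
    fun z => ((∏ v ∈ Aᶜ, φ v (z v)) * ∏ e ∈ E₂, ψ e z : ℝ≥0), ?_, ?_, ?_, ?_, ?_⟩
  · exact measurable_coe_nnreal_ennreal.comp
      ((Finset.measurable_fun_prod _ fun v _ => (hφ v).comp (measurable_pi_apply v)).mul
        (Finset.measurable_fun_prod _ fun e _ => hψ e))
  · exact measurable_coe_nnreal_ennreal.comp
      ((Finset.measurable_fun_prod _ fun v _ => (hφ v).comp (measurable_pi_apply v)).mul
        (Finset.measurable_fun_prod _ fun e _ => hψ e))
  · intro x y hxy
    have e1 : ∏ v ∈ A, φ v (x v) = ∏ v ∈ A, φ v (y v) :=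
      Finset.prod_congr rfl fun v hv => by rw [hxy v (Set.mem_insert_of_mem _ hv)]
    have e2 : ∏ e ∈ E₁, ψ e x = ∏ e ∈ E₁, ψ e y := Finset.prod_congr rfl fun e he =>
      hψd e fun v hv => hxy v (by simpa using (Finset.mem_filter.1 he).2 v hv)
    simp only [e1, e2]
  · intro x y hxy
    have e1 : ∏ v ∈ Aᶜ, φ v (x v) = ∏ v ∈ Aᶜ, φ v (y v) :=
      Finset.prod_congr rfl fun v hv => by rw [hxy v (by simpa using hv)]
    have e2 : ∏ e ∈ E₂, ψ e x = ∏ e ∈ E₂, ψ e y := by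
      refine Finset.prod_congr rfl fun e he => hψd e fun v hv => hxy v fun hvA => ?_
      rw [hE₂, Finset.mem_filter, SimpleGraph.mem_edgeFinset] at he
      refine he.2 fun b hb => ?_
      rcases eq_or_ne b v with rfl | hbv
      · exact Finset.mem_insert_of_mem hvA
      · rw [(Sym2.mem_and_mem_iff hbv.symm).1 ⟨hv, hb⟩, SimpleGraph.mem_edgeSet] at he
        simpa using hA v hvA b he.1
    simp only [e1, e2]
  · rw [hd]
    congr 1
    ext z
    rw [← ENNReal.coe_mul, mul_mul_mul_comm, Finset.prod_mul_prod_compl]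
    congr 2
    rw [hE₁, hE₂, Finset.prod_filter_mul_prod_filter_not]

/-- In a Gaussian tree model, the partial correlation given a separating vertex vanishes. -/
theorem variance_mul_covariance [IsProbabilityMeasure P] (hZ : IsGaussianGraphicalModel G P Z)
    (hG : G.IsTree) {u v w : V} {p : G.Walk u v} (hp : p.IsPath) (hw : w ∈ p.support)
    (hne : u ≠ w) :
    Var[Z w; P] * cov[Z u, Z v; P] = cov[Z u, Z w; P] * cov[Z w, Z v; P] := by
  classical
  obtain ⟨A', hu, hwA, hv, hA'⟩ := hG.exists_separated hp hw hne
  obtain ⟨A, rfl⟩ := A'.toFinite.exists_finset_coe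
  obtain ⟨g, h, hg, hh, hgd, hhd, hd⟩ := hZ.exists_factorization hA'
  set μ := P.map (fun ω => fun v => Z v ω) with hμ
  have hμg : IsGaussian μ := hZ.gaussian.isGaussian_map
  have hid : HasGaussianLaw (fun z : V → ℝ => fun v => z v) μ := IsGaussian.hasGaussianLaw_id
  have hL2 : ∀ x : V, MemLp (fun z : V → ℝ => z x) 2 μ := fun x => (hid.eval x).memLp_two
  have hcov : ∀ x y, cov[Z x, Z y; P] = cov[fun z : V → ℝ => z x, fun z => z y; μ] := fun x y =>
    (covariance_map_fun (measurable_pi_apply x).aestronglyMeasurable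
      (measurable_pi_apply y).aestronglyMeasurable hZ.measurable_pi.aemeasurable).symm
  have hvar : Var[Z w; P] = Var[fun z : V → ℝ => z w; μ] := by
    rw [← covariance_self (hZ.measurable w).aemeasurable, hcov, covariance_self (measurable_pi_apply w).aemeasurable]
  have hvpos := hZ.variance_pos w
  set β := cov[Z u, Z w; P] / Var[Z w; P] with hβ
  -- The residual is uncorrelated with coordinate `w`, hence independent of it by Gaussianity.
  -- Separation then makes it independent of coordinate `v`, and zero covariance with `v` is the
  -- claim.
  set R : (V → ℝ) → ℝ := fun z => z u - β * z w with hR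
  have hRw : IndepFun R (fun z => z w) μ := by
    have hpair : HasGaussianLaw (fun z => (R z, z w)) μ :=
      hid.map_fun (((ContinuousLinearMap.proj u : (V → ℝ) →L[ℝ] ℝ) -
        β • (ContinuousLinearMap.proj w : (V → ℝ) →L[ℝ] ℝ)).prod (ContinuousLinearMap.proj w))
    refine hpair.indepFun_of_covariance_eq_zero ?_
    rw [hR, covariance_fun_sub_left (hL2 u) ((hL2 w).const_mul _) (hL2 w),
      covariance_const_mul_left, covariance_self (measurable_pi_apply w).aemeasurable, ← hcov, ← hvar, hβ]
    field_simp
    ring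
  have hRd : DependsOn R (insert w A) := fun x y hxy => by
    simp only [hR, hxy u (Set.mem_insert_of_mem _ hu), hxy w (Set.mem_insert _ _)]
  have hRv := IndepFun.of_separated (by simpa using hwA) hg hh hgd hhd hd
    (by fun_prop : Measurable R) (measurable_pi_apply v) hRd
    (fun x y hxy => hxy v (by simpa using hv)) hRw
  have h0 := hRv.covariance_eq_zero ((hL2 u).sub ((hL2 w).const_mul _)) (hL2 v)
  rw [hR, covariance_fun_sub_left (hL2 u) ((hL2 w).const_mul _) (hL2 v),
    covariance_const_mul_left, ← hcov, ← hcov, hβ] at h0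
  field_simp at h0
  linarith

end IsGaussianGraphicalModel

/-! ## Recovery from Kendall `τ` coefficients -/

/-- Pearson's correlation coefficient. -/
noncomputable def pearsonCorr {Ω : Type*} [MeasurableSpace Ω] (P : Measure Ω) (X Y : Ω → ℝ) : ℝ :=
  cov[X, Y; P] / (√Var[X; P] * √Var[Y; P])

theorem pearsonCorr_comm {Ω : Type*} [MeasurableSpace Ω] (P : Measure Ω) (X Y : Ω → ℝ) :
    pearsonCorr P X Y = pearsonCorr P Y X := by
  rw [pearsonCorr, pearsonCorr, covariance_comm, mul_comm]

namespace IsGaussianGraphicalModel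

variable {V Ω : Type*} [Fintype V] [MeasurableSpace Ω] {G : SimpleGraph V} {P : Measure Ω}
  {Z : V → Ω → ℝ}

theorem pearsonCorr_self (hZ : IsGaussianGraphicalModel G P Z) (u : V) :
    pearsonCorr P (Z u) (Z u) = 1 := by
  have := hZ.variance_pos u
  rw [pearsonCorr, covariance_self (hZ.measurable u).aemeasurable, Real.mul_self_sqrt this.le,
    div_self this.ne']

/-- The length `-log |ρ|` of an edge with correlation `ρ`. -/
noncomputable def edgeLength (P : Measure Ω) (Z : V → Ω → ℝ) : Sym2 V → ℝ :=
  Sym2.lift ⟨fun u v => -Real.log |pearsonCorr P (Z u) (Z v)|,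
    fun u v => by simp only [pearsonCorr_comm P (Z u)]⟩

variable [IsProbabilityMeasure P]

theorem abs_pearsonCorr_lt_one (hZ : IsGaussianGraphicalModel G P Z) {u v : V} (huv : u ≠ v) :
    |pearsonCorr P (Z u) (Z v)| < 1 := by
  have hu := hZ.variance_pos u
  have hv := hZ.variance_pos v
  rw [← sq_lt_one_iff_abs_lt_one, pearsonCorr, div_pow, mul_pow, Real.sq_sqrt hu.le,
    Real.sq_sqrt hv.le, div_lt_one (by positivity)]
  exact hZ.covariance_sq_lt huv

theorem pearsonCorr_mul (hZ : IsGaussianGraphicalModel G P Z) (hG : G.IsTree) {u v w : V}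
    {p : G.Walk u v} (hp : p.IsPath) (hw : w ∈ p.support) (hne : u ≠ w) :
    pearsonCorr P (Z u) (Z v) = pearsonCorr P (Z u) (Z w) * pearsonCorr P (Z w) (Z v) := by
  have hu := Real.sqrt_pos.2 (hZ.variance_pos u)
  have hv := Real.sqrt_pos.2 (hZ.variance_pos v)
  have hw' := Real.sqrt_pos.2 (hZ.variance_pos w)
  have h := hZ.variance_mul_covariance hG hp hw hne
  rw [← Real.mul_self_sqrt (hZ.variance_pos w).le] at h
  unfold pearsonCorr
  field_simp
  linarith

theorem edgeLength_pos (hZ : IsGaussianGraphicalModel G P Z)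
    (hcov : ∀ u v, G.Adj u v → cov[Z u, Z v; P] ≠ 0) : ∀ e ∈ G.edgeSet, 0 < edgeLength P Z e := by
  intro e
  induction e with
  | _ u v =>
    intro huv
    have h0 : pearsonCorr P (Z u) (Z v) ≠ 0 :=
      div_ne_zero (hcov u v huv) (mul_pos (Real.sqrt_pos.2 (hZ.variance_pos u))
        (Real.sqrt_pos.2 (hZ.variance_pos v))).ne'
    exact neg_pos.2 (Real.log_neg (abs_pos.2 h0) (hZ.abs_pearsonCorr_lt_one (G.ne_of_adj huv)))

/-- Correlations multiply along paths. -/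
theorem neg_log_abs_pearsonCorr (hZ : IsGaussianGraphicalModel G P Z) (hG : G.IsTree)
    (hcov : ∀ u v, G.Adj u v → cov[Z u, Z v; P] ≠ 0) {u v : V} (p : G.Walk u v) (hp : p.IsPath) :
    pearsonCorr P (Z u) (Z v) ≠ 0 ∧
      -Real.log |pearsonCorr P (Z u) (Z v)| = (p.edges.map (edgeLength P Z)).sum := by
  induction p with
  | nil => simp [hZ.pearsonCorr_self]
  | @cons u w v huw q ih =>
    obtain ⟨h0, h1⟩ := ih hp.of_cons
    have h2 : pearsonCorr P (Z u) (Z w) ≠ 0 :=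
      div_ne_zero (hcov u w huw) (mul_pos (Real.sqrt_pos.2 (hZ.variance_pos u))
        (Real.sqrt_pos.2 (hZ.variance_pos w))).ne'
    rw [hZ.pearsonCorr_mul hG hp (w := w) (by simp) huw.ne]
    refine ⟨mul_ne_zero h2 h0, ?_⟩
    rw [abs_mul, Real.log_mul (abs_ne_zero.2 h2) (abs_ne_zero.2 h0), neg_add, h1]
    rfl

theorem abs_sin_kendallTau (hZ : IsGaussianGraphicalModel G P Z) (u v : V) :
    |Real.sin (Real.pi / 2 * kendallTau P (Z u) (Z v))| = |pearsonCorr P (Z u) (Z v)| := by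
  rcases eq_or_ne u v with rfl | huv
  · rw [kendallTau_self_of_hasGaussianLaw (hZ.gaussian.eval u) (hZ.variance_pos u),
      hZ.pearsonCorr_self, mul_one, Real.sin_pi_div_two]
  · have hlt := abs_lt.1 (hZ.abs_pearsonCorr_lt_one huv)
    have hu := hZ.variance_pos u
    have hv := hZ.variance_pos v
    have hsin : Real.sin (Real.arcsin (pearsonCorr P (Z u) (Z v))) = pearsonCorr P (Z u) (Z v) :=
      Real.sin_arcsin hlt.1.le hlt.2.le
    rw [kendallTau_eq_of_hasGaussianLaw (hZ.gaussian.prodMk u v) (Real.sqrt_pos.2 hu)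
      (Real.sqrt_pos.2 hv) ⟨Real.neg_pi_div_two_lt_arcsin.2 hlt.1,
        Real.arcsin_lt_pi_div_two.2 hlt.2⟩ (Real.sq_sqrt hu.le).symm (Real.sq_sqrt hv.le).symm, hsin]
    rw [hsin, pearsonCorr, mul_div_cancel₀]
    exact (mul_pos (Real.sqrt_pos.2 hu) (Real.sqrt_pos.2 hv)).ne'

end IsGaussianGraphicalModel

theorem mainTheorem8 {V Ω : Type*} [Fintype V] [MeasurableSpace Ω] {n : ℕ}
    (T : SemiLabeledTree V n) (P : Measure Ω) [IsProbabilityMeasure P]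
    (Z : V → Ω → ℝ) (hZ : IsGaussianGraphicalModel T.graph P Z)
    (hcov : ∀ u v, T.graph.Adj u v → covariance (Z u) (Z v) P ≠ 0)
    (f : V → ℝ → ℝ) (hf : ∀ v, StrictMono (f v) ∨ StrictAnti (f v))
    (Y : V → Ω → ℝ) (hY : ∀ v ω, Y v ω = f v (Z v ω))
    (X : Fin n → Ω → ℝ) (hX : ∀ i, X i = Y (T.label i)) :
    TreeRecovery.AlgorithmRecovers T.maxDeg (kendallDist P X) T := by
  refine TreeRecovery.algorithmRecovers_of_treeDist
    ⟨T, IsGaussianGraphicalModel.edgeLength P Z, hZ.edgeLength_pos hcov⟩ fun i j => ?_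
  have hX' : ∀ i, X i = fun ω => f (T.label i) (Z (T.label i) ω) := fun i =>
    (hX i).trans (funext (hY (T.label i)))
  obtain ⟨p, hp⟩ := T.isTree.connected.exists_isPath (T.label i) (T.label j)
  rw [kendallDist, hX', hX', abs_sin_kendallTau_comp (hf _) (hf _), hZ.abs_sin_kendallTau,
    (hZ.neg_log_abs_pearsonCorr T.isTree hcov p hp).2]
  exact (T.isTree.pathDist_eq _ hp).symm
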